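/- Identify $\mathbb R^2$ with $\mathbb C$. A magnetic field is a signed Borel measure $\mu$ on $\mathbb C$ of locally finite variation whose discrete part $\mu_{\rm disc}=2\pi\sum_{\lambda}\alpha_\lambda\delta_\lambda$ is supported on a set without finite accumulation points (the solenoids, with intensities $\alpha_\lambda\neq 0$). A potential of $\mu$ is a real $\Psi\in L_{1,\rm loc}$ with $\Delta\Psi=\mu$ in the sense of distributions. A set $\Lambda\subset\mathbb C$ is uniformly discrete if, for some $r>0$, any two distinct points of $\Lambda$ are at distance at least $r$. With $\partial=(\partial_1-i\partial_2)/2$, the operator $\mathcal P_-$ in $L_2(\mathbb R^2)$ of the field $\mu$ with potential $\Psi$ is the one associated with the quadratic form $$\mathfrak p_-[\psi]=4\int|\partial(e^{\Psi}\psi)|^2e^{-2\Psi}\,dx$$ on all $\psi\in L_2$ for which $\partial(e^\Psi\psi)$ is a locally integrable function and the form is finite; for $\mathcal P_{-\max}$ the derivative is taken in the sense of distributions on the complement of the set of solenoids of $\mu$, and for $\mathcal P_{-EV}$ (considered only for intensities in $[-\frac12,\frac12)$) in the sense of distributions on the whole plane. Zero modes are the elements of the null space of the operator. **Theorem.** Let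 $\theta_0<1$ and $\gamma>0$. Let $\mu_0$ be a magnetic field with solenoid set $\Lambda_0$ and intensities $\alpha_{0,\lambda}$; let $\lambda_0(z)$ be a point of $\Lambda_0$ closest to $z$ and $\alpha_0(z)=\alpha_{0,\lambda_0(z)}$. Suppose that $\mu_0$ has a potential $\Psi_0$ such that $$\Psi_0(z)-\alpha_0(z)\ln|z-\lambda_0(z)|\ge\gamma|z|^2\qquad\text{for all } z\notin\Lambda_0 \text{ with } |z| \text{ large enough.}$$ Let $\Lambda\subset\mathbb C$ be uniformly discrete, let $\alpha_\lambda$ ($\lambda\in\Lambda$) be real numbers with $|\alpha_\lambda|\le\theta_0$, and put $\mu=2\pi\sum_{\lambda\in\Lambda}\alpha_\lambda\delta_\lambda$. Let $\Phi$ map $\Lambda$ onto a uniformly discrete set $\Lambda'=\Phi(\Lambda)$ so that, for some $a\ge0$ and $t<1$, $|\Phi(\lambda)-\lambda|\le a|\lambda|^{t}$ for all $\lambda\in\Lambda$ with $|\lambda|$ large enough, and so that the numbers $\alpha'_{\lambda'}=\sum_{\lambda\in\Lambda,\,\Phi(\lambda)=\lambda'}\alpha_\lambda$ satisfy $|\alpha'_{\lambda'}|\le\theta_0$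 for all $\lambda'\in\Lambda'$. Put $\mu'=2\pi\sum_{\lambda'\in\Lambda'}\alpha'_{\lambda'}\delta_{\lambda'}$. Suppose that $\Lambda_0\cup\Lambda\cup\Lambda'$ is uniformly discrete. Let $\lambda(z)$, $\lambda'(z)$ be points of $\Lambda$, $\Lambda'$ closest to $z$, $\alpha(z)=\alpha_{\lambda(z)}$, $\alpha'(z)=\alpha'_{\lambda'(z)}$. (Logarithmic terms that belong to an empty set are replaced by $0$.) 1. The field $\mu_0+\mu'-\mu$ has a potential $U$ such that for every $\gamma'$ with $0<\gamma'<\gamma$ $$U(z)-\alpha_0(z)\ln|z-\lambda_0(z)|-\alpha'(z)\ln|z-\lambda'(z)|+\alpha(z)\ln|z-\lambda(z)|\ge\gamma'|z|^2$$ for all $z\notin\Lambda_0\cup\Lambda\cup\Lambda'$ with $|z|$ large enough. 2. If $0<\alpha_{0,\lambda}\le\theta_0$ for all $\lambda\in\Lambda_0$, and all intensities of the field $\mu_0+\mu'-\mu$ are at most $\theta_0$ (which is automatic if $\Lambda_0,\Lambda,\Lambda'$ are pairwise disjoint), then the operator $\mathcal P_{-\max}$ of the field $\mu_0+\mu'-\mu$,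 defined with any potential of this field, has infinitely many linearly independent zero modes. 3. If $\alpha_{0,\lambda}\in[-\frac12,\frac12)$ for all $\lambda\in\Lambda_0$, and all intensities of the field $\mu_0+\mu'-\mu$ lie in $[-\frac12,\frac12)$, then the operator $\mathcal P_{-EV}$ of the field $\mu_0+\mu'-\mu$, defined with any potential of this field, has infinitely many linearly independent zero modes. -/

import Mathlib

open MeasureTheory Set Metric
open scoped ContDiff InnerProductSpace

noncomputable section

namespace AharonovBohm

/-- `dist (l, Λ \ {l}) ≥ r` for all `l ∈ Λ`, with one `r > 0`. -/
def UniformlyDiscrete (Λ : Set ℂ) : Prop :=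
  ∃ r : ℝ, 0 < r ∧ ∀ x ∈ Λ, ∀ y ∈ Λ, x ≠ y → r ≤ dist x y

theorem UniformlyDiscrete.finite_inter_closedBall {Λ : Set ℂ} (h : UniformlyDiscrete Λ) (R : ℝ) :
    (Λ ∩ closedBall 0 R).Finite := by
  obtain ⟨r, hr, hΛ⟩ := h
  have hcl : IsClosed Λ := isClosed_of_pairwise_le_dist hr fun x hx y hy hxy => hΛ x hx y hy hxy
  have hK : IsCompact (Λ ∩ closedBall (0 : ℂ) R) := (isCompact_closedBall 0 R).inter_left hcl
  refine hK.finite (isDiscrete_iff_discreteTopology.2 ?_)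
  exact DiscreteTopology.of_forall_le_dist hr fun x y hxy =>
    hΛ x x.2.1 y y.2.1 fun he => hxy (Subtype.ext he)

/-- A magnetic field: a signed Borel measure on the plane with locally finite variation, whose
discrete part has no finite accumulation point. It is given by its decomposition
`μ = μ_cont + μ_disc`, where `μ_cont = contPos - contNeg` is a difference of two locally finite
Borel measures without atoms, and `μ_disc = 2π ∑ α_l δ_l` with `α_l = intensity l`. -/
structure MagneticField where
  contPos : Measure ℂ
  contNeg : Measure ℂ
  intensity : ℂ → ℝ
  isLocallyFinite_contPos : IsLocallyFiniteMeasure contPos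
  isLocallyFinite_contNeg : IsLocallyFiniteMeasure contNeg
  noAtoms_contPos : NullSingletonClass contPos
  noAtoms_contNeg : NullSingletonClass contNeg
  finite_solenoids : ∀ R : ℝ, ({z | intensity z ≠ 0} ∩ closedBall 0 R).Finite

namespace MagneticField

/-- The support of the discrete part: the positions of the Aharonov-Bohm solenoids. -/
def solenoids (μ : MagneticField) : Set ℂ := {z | μ.intensity z ≠ 0}

/-- The integral of a test function `φ` against the signed measure `μ`. -/
def integral (μ : MagneticField) (φ : ℂ → ℝ) : ℝ :=
  (∫ z, φ z ∂μ.contPos) - (∫ z, φ z ∂μ.contNeg)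
    + 2 * Real.pi * ∑ᶠ z : ℂ, μ.intensity z * φ z

theorem isLocallyFinite_add {ν₁ ν₂ : Measure ℂ} (h₁ : IsLocallyFiniteMeasure ν₁)
    (h₂ : IsLocallyFiniteMeasure ν₂) : IsLocallyFiniteMeasure (ν₁ + ν₂) := by
  refine ⟨fun x => ?_⟩
  obtain ⟨s, hs, hs'⟩ := h₁.finiteAtNhds x
  obtain ⟨t, ht, ht'⟩ := h₂.finiteAtNhds x
  refine ⟨s ∩ t, Filter.inter_mem hs ht, ?_⟩
  rw [Measure.add_apply]
  exact ENNReal.add_lt_top.2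
    ⟨(measure_mono inter_subset_left).trans_lt hs', (measure_mono inter_subset_right).trans_lt ht'⟩

theorem noAtoms_add {ν₁ ν₂ : Measure ℂ} (h₁ : NullSingletonClass ν₁) (h₂ : NullSingletonClass ν₂) :
    NullSingletonClass (ν₁ + ν₂) :=
  ⟨fun x => by rw [Measure.add_apply, measure_singleton, measure_singleton, add_zero]⟩

instance : Add MagneticField where
  add μ ν :=
    { contPos := μ.contPos + ν.contPos
      contNeg := μ.contNeg + ν.contNeg
      intensity := fun z => μ.intensity z + ν.intensity z
      isLocallyFinite_contPos :=
        isLocallyFinite_add μ.isLocallyFinite_contPos ν.isLocallyFinite_contPos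
      isLocallyFinite_contNeg :=
        isLocallyFinite_add μ.isLocallyFinite_contNeg ν.isLocallyFinite_contNeg
      noAtoms_contPos := noAtoms_add μ.noAtoms_contPos ν.noAtoms_contPos
      noAtoms_contNeg := noAtoms_add μ.noAtoms_contNeg ν.noAtoms_contNeg
      finite_solenoids := fun R =>
        ((μ.finite_solenoids R).union (ν.finite_solenoids R)).subset fun z hz => by
          by_cases h : μ.intensity z = 0
          · exact Or.inr ⟨fun h' => hz.1 (by simp [h, h']), hz.2⟩
          · exact Or.inl ⟨h, hz.2⟩ }

instance : Neg MagneticField where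
  neg μ :=
    { contPos := μ.contNeg
      contNeg := μ.contPos
      intensity := fun z => -μ.intensity z
      isLocallyFinite_contPos := μ.isLocallyFinite_contNeg
      isLocallyFinite_contNeg := μ.isLocallyFinite_contPos
      noAtoms_contPos := μ.noAtoms_contNeg
      noAtoms_contNeg := μ.noAtoms_contPos
      finite_solenoids := fun R => (μ.finite_solenoids R).subset fun _ hz =>
        ⟨fun h => hz.1 (by simp [h]), hz.2⟩ }

instance : Sub MagneticField where
  sub μ ν := μ + -ν

open Classical in
/-- The purely discrete field `2π ∑_{l ∈ Λ} α_l δ_l`. -/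
def discrete (Λ : Set ℂ) (hΛ : UniformlyDiscrete Λ) (α : ℂ → ℝ) : MagneticField where
  contPos := 0
  contNeg := 0
  intensity := fun z => if z ∈ Λ then α z else 0
  isLocallyFinite_contPos := ⟨fun _ => ⟨univ, Filter.univ_mem, by simp⟩⟩
  isLocallyFinite_contNeg := ⟨fun _ => ⟨univ, Filter.univ_mem, by simp⟩⟩
  noAtoms_contPos := ⟨fun _ => by simp⟩
  noAtoms_contNeg := ⟨fun _ => by simp⟩
  finite_solenoids := fun R => (hΛ.finite_inter_closedBall R).subset fun z hz => by
    refine ⟨?_, hz.2⟩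
    by_contra h
    exact hz.1 (by simp [h])

end MagneticField

/-- `Ψ` is a scalar potential of the field `μ`: `Ψ ∈ L¹_loc` and `ΔΨ = μ` in the sense of
distributions on the plane. -/
def IsPotential (μ : MagneticField) (Ψ : ℂ → ℝ) : Prop :=
  LocallyIntegrable Ψ volume ∧
    ∀ φ : ℂ → ℝ, ContDiff ℝ ∞ φ → HasCompactSupport φ →
      ∫ z, Ψ z * Laplacian.laplacian φ z = μ.integral φ

/-- The intensity at `l'` after the points of `Λ` have been moved by `Φ`:
the sum of `α_l` over the `l ∈ Λ` with `Φ l = l'`. -/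
def movedIntensity (Λ : Set ℂ) (α : ℂ → ℝ) (Φ : ℂ → ℂ) (l' : ℂ) : ℝ :=
  ∑ᶠ l ∈ {l | l ∈ Λ ∧ Φ l = l'}, α l

/-- `n z` is a point of `Λ` closest to `z`, for every `z` (no condition if `Λ` is empty). -/
def IsNearestPoint (Λ : Set ℂ) (n : ℂ → ℂ) : Prop :=
  Λ.Nonempty → ∀ z, n z ∈ Λ ∧ ∀ l ∈ Λ, dist z (n z) ≤ dist z l

/-- The logarithmic correction `α_{n(z)} ln |z - n(z)|`, with `α` the intensities of `μ`. It
vanishes if `μ` has no solenoids. -/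
def logTerm (μ : MagneticField) (n : ℂ → ℂ) (z : ℂ) : ℝ :=
  μ.intensity (n z) * Real.log ‖z - n z‖

/-- The derivative `∂φ = (∂₁φ - i ∂₂φ) / 2`. -/
def holDeriv (φ : ℂ → ℂ) (z : ℂ) : ℂ :=
  (fderiv ℝ φ z 1 - Complex.I * fderiv ℝ φ z Complex.I) / 2

/-- `∂u = w` in the sense of distributions on `ℂ \ S`, both sides being locally integrable
functions there. -/
def IsWeakHolDeriv (S : Set ℂ) (u w : ℂ → ℂ) : Prop :=
  LocallyIntegrableOn u Sᶜ volume ∧ LocallyIntegrableOn w Sᶜ volume ∧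
    ∀ φ : ℂ → ℂ, ContDiff ℝ ∞ φ → HasCompactSupport φ → tsupport φ ⊆ Sᶜ →
      ∫ z, u z * holDeriv φ z = -∫ z, w z * φ z

theorem integrable_mul_test {S : Set ℂ} {u φ : ℂ → ℂ} (hu : LocallyIntegrableOn u Sᶜ volume)
    (hφ : Continuous φ) (hc : HasCompactSupport φ) (hs : tsupport φ ⊆ Sᶜ) :
    Integrable (fun z => u z * φ z) volume := by
  have h1 : IntegrableOn u (tsupport φ) volume := hu.integrableOn_compact_subset hs hc
  have h2 : IntegrableOn (fun z => u z * φ z) (tsupport φ) volume :=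
    h1.mul_continuousOn hφ.continuousOn hc
  refine (integrableOn_iff_integrable_of_support_subset fun z hz => ?_).1 h2
  exact subset_tsupport φ fun h0 => hz (by simp [h0])

theorem tsupport_holDeriv_subset (φ : ℂ → ℂ) : tsupport (holDeriv φ) ⊆ tsupport φ := by
  refine closure_minimal (fun z hz => ?_) (isClosed_tsupport φ)
  by_contra h
  have h0 : fderiv ℝ φ z = 0 := by
    by_contra h1
    exact h (support_fderiv_subset ℝ h1)
  exact hz (by simp [holDeriv, h0])

theorem integrable_mul_holDeriv {S : Set ℂ} {u φ : ℂ → ℂ}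
    (hu : LocallyIntegrableOn u Sᶜ volume) (hφ : ContDiff ℝ ∞ φ)
    (hc : HasCompactSupport φ) (hs : tsupport φ ⊆ Sᶜ) :
    Integrable (fun z => u z * holDeriv φ z) volume := by
  have hd : Continuous (fderiv ℝ φ) := hφ.continuous_fderiv (by simp)
  have hcont : Continuous (holDeriv φ) := by
    unfold holDeriv
    fun_prop
  exact integrable_mul_test hu hcont
    (hc.of_isClosed_subset (isClosed_tsupport _) (tsupport_holDeriv_subset φ))
    ((tsupport_holDeriv_subset φ).trans hs)

theorem IsWeakHolDeriv.add {S : Set ℂ} {u w u' w' : ℂ → ℂ} (h : IsWeakHolDeriv S u w)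
    (h' : IsWeakHolDeriv S u' w') : IsWeakHolDeriv S (u + u') (w + w') := by
  refine ⟨h.1.add h'.1, h.2.1.add h'.2.1, fun φ h1 h2 h3 => ?_⟩
  simp only [Pi.add_apply, add_mul]
  rw [integral_add (integrable_mul_holDeriv h.1 h1 h2 h3) (integrable_mul_holDeriv h'.1 h1 h2 h3),
    integral_add (integrable_mul_test h.2.1 h1.continuous h2 h3)
      (integrable_mul_test h'.2.1 h1.continuous h2 h3), h.2.2 φ h1 h2 h3, h'.2.2 φ h1 h2 h3]
  ring

theorem IsWeakHolDeriv.smul {S : Set ℂ} {u w : ℂ → ℂ} (h : IsWeakHolDeriv S u w) (c : ℂ) :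
    IsWeakHolDeriv S (c • u) (c • w) := by
  refine ⟨h.1.smul c, h.2.1.smul c, fun φ h1 h2 h3 => ?_⟩
  simp only [Pi.smul_apply, smul_eq_mul, mul_assoc]
  rw [integral_const_mul, integral_const_mul, h.2.2 φ h1 h2 h3]
  ring

theorem IsWeakHolDeriv.congr {S : Set ℂ} {u w u' w' : ℂ → ℂ} (h : IsWeakHolDeriv S u w)
    (hu : u =ᵐ[volume] u') (hw : w =ᵐ[volume] w') : IsWeakHolDeriv S u' w' := by
  refine ⟨h.1.congr (ae_restrict_of_ae hu), h.2.1.congr (ae_restrict_of_ae hw),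
    fun φ h1 h2 h3 => ?_⟩
  rw [← integral_congr_ae (hu.mono fun z hz => by simp only [hz] :
      (fun z => u z * holDeriv φ z) =ᵐ[volume] fun z => u' z * holDeriv φ z),
    ← integral_congr_ae (hw.mono fun z hz => by simp only [hz] :
      (fun z => w z * φ z) =ᵐ[volume] fun z => w' z * φ z)]
  exact h.2.2 φ h1 h2 h3

theorem IsWeakHolDeriv.zero (S : Set ℂ) : IsWeakHolDeriv S 0 0 :=
  ⟨locallyIntegrableOn_zero, locallyIntegrableOn_zero, fun φ _ _ _ => by simp⟩

/-- The Hilbert space `L₂(ℝ²)`. -/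
abbrev L2 : Type := Lp ℂ 2 (volume : Measure ℂ)

/-- The pairs `(ψ, h)` in `L₂ × L₂` with `∂(e^Ψ ψ) = e^Ψ h` as distributions on `ℂ \ S`.
So `ψ` belongs to the domain of the spin-down form
`p₋[ψ] = 4 ∫ |∂(e^Ψ ψ)|² e^{-2Ψ} dx` (the derivative being a function, the integral finite) exactly
if there is such an `h`, and then `p₋[ψ] = 4 ‖h‖²`. -/
def formGraph (Ψ : ℂ → ℝ) (S : Set ℂ) : Submodule ℂ (L2 × L2) where
  carrier := {p | IsWeakHolDeriv S (fun z => (Real.exp (Ψ z) : ℂ) * p.1 z)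
    (fun z => (Real.exp (Ψ z) : ℂ) * p.2 z)}
  zero_mem' := (IsWeakHolDeriv.zero S).congr
    ((Lp.coeFn_zero ℂ 2 (volume : Measure ℂ)).mono fun z hz => by
      simp only [Prod.fst_zero, hz, Pi.zero_apply, mul_zero])
    ((Lp.coeFn_zero ℂ 2 (volume : Measure ℂ)).mono fun z hz => by
      simp only [Prod.snd_zero, hz, Pi.zero_apply, mul_zero])
  add_mem' := fun {p q} hp hq => (IsWeakHolDeriv.add hp hq).congr
    ((Lp.coeFn_add p.1 q.1).mono fun z hz => by
      simp only [Prod.fst_add, hz, Pi.add_apply, mul_add])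
    ((Lp.coeFn_add p.2 q.2).mono fun z hz => by
      simp only [Prod.snd_add, hz, Pi.add_apply, mul_add])
  smul_mem' := fun c p hp => (IsWeakHolDeriv.smul hp c).congr
    ((Lp.coeFn_smul c p.1).mono fun z hz => by
      simp only [Prod.smul_fst, hz, Pi.smul_apply, smul_eq_mul]; ring)
    ((Lp.coeFn_smul c p.2).mono fun z hz => by
      simp only [Prod.smul_snd, hz, Pi.smul_apply, smul_eq_mul]; ring)

/-- The graph of the operator associated with the spin-down form `p₋`: `(ψ, g)` belongs to it if
`ψ` is in the form domain and `p₋(ψ, φ) = (g, φ)` for all `φ` in the form domain. (The form is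
`p₋(ψ, φ) = 4 (h, k)` for `(ψ, h), (φ, k)` in `formGraph`.) -/
def spinDownGraph (Ψ : ℂ → ℝ) (S : Set ℂ) : Submodule ℂ (L2 × L2) where
  carrier := {p | ∃ h : L2, (p.1, h) ∈ formGraph Ψ S ∧
    ∀ q ∈ formGraph Ψ S, 4 * inner ℂ q.2 h = inner ℂ q.1 p.2}
  zero_mem' := ⟨0, (formGraph Ψ S).zero_mem, fun q _ => by simp⟩
  add_mem' := by
    rintro p p' ⟨h, hp, hh⟩ ⟨h', hp', hh'⟩
    refine ⟨h + h', (formGraph Ψ S).add_mem hp hp', fun q hq => ?_⟩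
    rw [Prod.snd_add, inner_add_right, inner_add_right, mul_add, hh q hq, hh' q hq]
  smul_mem' := by
    rintro c p ⟨h, hp, hh⟩
    refine ⟨c • h, (formGraph Ψ S).smul_mem c hp, fun q hq => ?_⟩
    rw [Prod.smul_snd, inner_smul_right, inner_smul_right, ← hh q hq]
    ring

/-- The operator `P_{-max}` of the field `μ` with potential `Ψ` (its graph): the derivatives in the
form are taken in the sense of distributions outside the solenoids. -/
def pauliMinusMax (μ : MagneticField) (Ψ : ℂ → ℝ) : Submodule ℂ (L2 × L2) :=
  spinDownGraph Ψ μ.solenoids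

/-- The operator `P_{-EV}` (its graph) of a field with potential `Ψ` and with all intensities in
`[-1/2, 1/2)`: the derivatives in the form are taken in the sense of distributions on the whole
plane. -/
def pauliMinusEV (Ψ : ℂ → ℝ) : Submodule ℂ (L2 × L2) :=
  spinDownGraph Ψ ∅

/-- The zero modes: the null space of an operator in `L₂` given by its graph. -/
def zeroModes (A : Submodule ℂ (L2 × L2)) : Submodule ℂ L2 :=
  A.comap (LinearMap.inl ℂ L2 L2)

end AharonovBohm

end

noncomputable section

namespace AharonovBohm

/-! A function `ψ` with `∂(e^V ψ) = 0` is `e^{-V}` times an antiholomorphic function. Two potentials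
`U`, `V` of one field differ by a weakly harmonic function, hence by `Re F` with `F` entire (Weyl's
lemma, `WeaklyHarmonicOn.exists_re_eq`). For every polynomial `P` the function `e^{-V} conj(e^F)
P(conj z)` is therefore a candidate zero mode, with modulus `e^{-U} |P(conj z)|`. It remains to find
one potential `U` for which all these are square integrable (`not_finiteDimensional_zeroModes`). The
equation then holds on the whole plane, so both operators are served at once.

The potential is `U = Ψ₀ + W` with `W = ∑ α_l (ln|z - Φ l| - ln|z - l| + affine correction)`. The
correction does not change the field. It turns the term of a distant `l` into a difference of values
of `ln|1 - w| + Re w` at `w = z/Φ l` and `w = z/l`, as in a Weierstrass product of genus one; such a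
term is `O(|z|² |l|^{t-3})`, which is summable over a uniformly discrete set. Heuristically the
distant points contribute `|z|^{1+t}`, and so do the `|z|²` points at distance of order `|z|`, each
moved by `|z|^t`. Hence `W`, without its nearest logarithms, grows slower than `|z|²`
(`IsShift.exists_abs_shiftPotential_sub_le`), and the quadratic growth of `Ψ₀` survives with any
smaller constant.

Square integrability has two sources. Far out, a Gaussian factor beats the polynomial, and near a
solenoid `e^{-2U}` is at most a Gaussian times `|z - p|^{-2θ}` with `θ < 1`; these singularities are
summed over the separated set of all points (`integrable_exp_mul_norm_eval_sq`). On bounded sets the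
growth condition is silent; there `e^{-2U}` is locally integrable because every intensity is less
than `1` (`IsPotential.locallyIntegrable_exp`): near any point the positive part of the field has
mass below `2π`, and Jensen's inequality applies to its logarithmic potential. -/

/-! ### The Laplacian on test functions and integration by parts. -/

theorem laplacian_eq_fderiv_fderiv {φ : ℂ → ℝ} (hφ : ContDiff ℝ 2 φ) (z : ℂ) :
    Laplacian.laplacian φ z = fderiv ℝ (fun w => fderiv ℝ φ w 1) z 1
      + fderiv ℝ (fun w => fderiv ℝ φ w Complex.I) z Complex.I := by
  have hd : DifferentiableAt ℝ (fderiv ℝ φ) z :=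
    (hφ.fderiv_right (m := 1) (by norm_num)).differentiable (by norm_num) z
  rw [InnerProductSpace.laplacian_eq_iteratedFDeriv_complexPlane]
  simp only [iteratedFDeriv_two_apply]
  have h (v : ℂ) : fderiv ℝ (fun w => fderiv ℝ φ w v) z = (fderiv ℝ (fderiv ℝ φ) z).flip v := by
    have := (hd.hasFDerivAt.clm_apply (hasFDerivAt_const v z)).fderiv
    rw [this]; simp
  rw [h, h]; simp

theorem continuous_laplacian {φ : ℂ → ℝ} (hφ : ContDiff ℝ 2 φ) :
    Continuous (Laplacian.laplacian φ) := by
  have h1 (v : ℂ) : ContDiff ℝ 1 (fun w => fderiv ℝ φ w v) :=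
    (hφ.fderiv_right (m := 1) (by norm_num)).clm_apply contDiff_const
  have h2 (v : ℂ) : Continuous (fun z => fderiv ℝ (fun w => fderiv ℝ φ w v) z v) :=
    ((h1 v).continuous_fderiv (by norm_num)).clm_apply continuous_const
  exact ((h2 1).add (h2 Complex.I)).congr fun z => (laplacian_eq_fderiv_fderiv hφ z).symm

theorem tsupport_laplacian_subset {φ : ℂ → ℝ} :
    tsupport (Laplacian.laplacian φ) ⊆ tsupport φ := by
  refine closure_minimal (fun z hz => ?_) (isClosed_tsupport φ)
  by_contra h
  have h0 : φ =ᶠ[nhds z] fun _ => 0 := notMem_tsupport_iff_eventuallyEq.1 h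
  refine hz ?_
  rw [(InnerProductSpace.laplacian_congr_nhds h0).self_of_nhds]
  simp

theorem hasCompactSupport_laplacian {φ : ℂ → ℝ} (hc : HasCompactSupport φ) :
    HasCompactSupport (Laplacian.laplacian φ) :=
  hc.of_isClosed_subset (isClosed_tsupport _) tsupport_laplacian_subset

theorem integrable_mul_of_hasCompactSupport {f g : ℂ → ℝ} (hf : LocallyIntegrable f)
    (hg : Continuous g) (hc : HasCompactSupport g) : Integrable (fun z => f z * g z) := by
  simpa only [smul_eq_mul, mul_comm] using hf.integrable_smul_left_of_hasCompactSupport hg hc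

theorem integral_mul_fderiv_eq_neg {f φ : ℂ → ℝ} (hf : ContDiff ℝ 1 f) (hφ : ContDiff ℝ 1 φ)
    (hc : HasCompactSupport φ) (v : ℂ) :
    ∫ z, f z * fderiv ℝ φ z v = -∫ z, fderiv ℝ f z v * φ z := by
  have h1 : Continuous fun z => fderiv ℝ f z v :=
    (hf.continuous_fderiv (by norm_num)).clm_apply continuous_const
  have h2 : Continuous fun z => fderiv ℝ φ z v :=
    (hφ.continuous_fderiv (by norm_num)).clm_apply continuous_const
  exact integral_mul_fderiv_eq_neg_fderiv_mul_of_integrable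
    (integrable_mul_of_hasCompactSupport h1.locallyIntegrable hφ.continuous hc)
    (integrable_mul_of_hasCompactSupport hf.continuous.locallyIntegrable h2
      (hc.fderiv_apply (𝕜 := ℝ) v))
    (integrable_mul_of_hasCompactSupport hf.continuous.locallyIntegrable hφ.continuous hc)
    (fun x _ => hf.differentiable (by norm_num) x) (fun x _ => hφ.differentiable (by norm_num) x)

/-- Only one derivative is moved: the gradients of the regularised logarithms still have a locally
integrable limit, their Laplacians do not. -/
theorem integral_mul_laplacian {f φ : ℂ → ℝ} (hf : ContDiff ℝ 1 f) (hφ : ContDiff ℝ ∞ φ)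
    (hc : HasCompactSupport φ) :
    ∫ z, f z * Laplacian.laplacian φ z = -∫ z, (fderiv ℝ f z 1 * fderiv ℝ φ z 1
      + fderiv ℝ f z Complex.I * fderiv ℝ φ z Complex.I) := by
  have hφ2 : ContDiff ℝ 2 φ := contDiff_infty.1 hφ 2
  have h1 (v : ℂ) : ContDiff ℝ 1 (fun w => fderiv ℝ φ w v) :=
    (hφ2.fderiv_right (m := 1) (by norm_num)).clm_apply contDiff_const
  have h1c (v : ℂ) : HasCompactSupport (fun w => fderiv ℝ φ w v) := hc.fderiv_apply (𝕜 := ℝ) v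
  have h2 (v : ℂ) : Continuous (fun z => fderiv ℝ (fun w => fderiv ℝ φ w v) z v) :=
    ((h1 v).continuous_fderiv (by norm_num)).clm_apply continuous_const
  have hfd (v : ℂ) : Continuous fun z => fderiv ℝ f z v :=
    (hf.continuous_fderiv (by norm_num)).clm_apply continuous_const
  have h3 (v : ℂ) := integral_mul_fderiv_eq_neg hf (h1 v) (h1c v) v
  have hi (v : ℂ) := integrable_mul_of_hasCompactSupport hf.continuous.locallyIntegrable (h2 v)
    ((h1c v).fderiv_apply (𝕜 := ℝ) v)
  have hi' (v : ℂ) := integrable_mul_of_hasCompactSupport (hfd v).locallyIntegrable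
    (h1 v).continuous (h1c v)
  simp_rw [laplacian_eq_fderiv_fderiv hφ2, mul_add]
  rw [integral_add (hi _) (hi _), h3, h3, integral_add (hi' _) (hi' _)]
  ring

/-- This is why the affine corrections that make the series of logarithms converge leave the field
unchanged. -/
theorem integral_affine_mul_laplacian (c : ℝ) (b : ℂ) {φ : ℂ → ℝ} (hφ : ContDiff ℝ ∞ φ)
    (hc : HasCompactSupport φ) :
    ∫ z, (c + (z * b).re) * Laplacian.laplacian φ z = 0 := by
  have hL (z : ℂ) : HasFDerivAt (fun z : ℂ => c + (z * b).re)
      (Complex.reCLM.comp ((ContinuousLinearMap.mul ℝ ℂ).flip b)) z := by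
    have := (Complex.reCLM.comp ((ContinuousLinearMap.mul ℝ ℂ).flip b)).hasFDerivAt (x := z)
    exact (this.const_add c)
  have hsm : ContDiff ℝ 1 (fun z : ℂ => c + (z * b).re) :=
    contDiff_const.add (Complex.reCLM.contDiff.comp (contDiff_id.mul contDiff_const))
  have hφ1 : ContDiff ℝ 1 φ := contDiff_infty.1 hφ 1
  have h0 (v : ℂ) : ∫ z, fderiv ℝ φ z v = 0 := by
    have := integral_mul_fderiv_eq_neg (f := fun _ => (1 : ℝ)) contDiff_const hφ1 hc v
    simpa using this
  have hi (v : ℂ) : Integrable fun z => fderiv ℝ φ z v :=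
    ((hφ1.continuous_fderiv (by norm_num)).clm_apply continuous_const).integrable_of_hasCompactSupport
      (hc.fderiv_apply (𝕜 := ℝ) v)
  rw [integral_mul_laplacian hsm hφ hc]
  simp_rw [(hL _).fderiv]
  rw [integral_add ((hi 1).const_mul _) ((hi _).const_mul _), integral_const_mul,
    integral_const_mul, h0, h0]
  simp

/-! ### Local singularities and the fundamental solution of the Laplacian. -/

/-- Powers `‖z‖ ^ (-s)` with `s < 2` are locally integrable on the plane. -/
theorem locallyIntegrable_norm_rpow {s : ℝ} (hs : s < 2) :
    LocallyIntegrable (fun z : ℂ => ‖z‖ ^ (-s)) := by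
  refine (locallyIntegrable_iff).2 fun K hK => ?_
  obtain ⟨R, hR⟩ := hK.isBounded.subset_closedBall (0 : ℂ)
  refine IntegrableOn.mono_set ?_ hR
  rw [← integrable_indicator_iff isClosed_closedBall.measurableSet]
  have h1 : (closedBall (0 : ℂ) R).indicator (fun z : ℂ => ‖z‖ ^ (-s))
      = fun z : ℂ => (Iic R).indicator (fun x : ℝ => x ^ (-s)) ‖z‖ := by
    ext z; simp [indicator]
  rw [h1, integrable_fun_norm_addHaar]
  simp only [Complex.finrank_real_complex]
  have h2 : IntegrableOn (fun x : ℝ => x ^ (1 - s)) (Ioc 0 R) := by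
    rcases le_or_gt R 0 with h | h
    · simp [Ioc_eq_empty_of_le h]
    · rw [← intervalIntegrable_iff_integrableOn_Ioc_of_le h.le]
      exact intervalIntegral.intervalIntegrable_rpow' (by linarith)
  change IntegrableOn (fun y : ℝ => y ^ (2 - 1) • (Iic R).indicator (fun x : ℝ => x ^ (-s)) y)
    (Ioi 0) volume
  rw [← integrable_indicator_iff measurableSet_Ioi]
  rw [← integrable_indicator_iff measurableSet_Ioc] at h2
  refine h2.congr (Filter.Eventually.of_forall fun x => ?_)
  by_cases hx : 0 < x
  · by_cases hxR : x ≤ R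
    · simp [indicator, hx, hxR]
      rw [sub_eq_add_neg, Real.rpow_add hx, Real.rpow_one]
    · simp [indicator, hx, hxR]
  · simp [indicator, hx]

theorem abs_log_le_add_inv {x : ℝ} (hx : 0 ≤ x) : |Real.log x| ≤ x + x⁻¹ := by
  rcases hx.eq_or_lt with rfl | hx
  · simp
  have h1 := Real.log_le_sub_one_of_pos hx
  have h2 := Real.log_le_sub_one_of_pos (inv_pos.2 hx)
  rw [Real.log_inv] at h2
  have := inv_pos.2 hx
  rw [abs_le]; constructor <;> linarith

theorem locallyIntegrable_log_norm : LocallyIntegrable fun z : ℂ => Real.log ‖z‖ := by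
  have h1 : LocallyIntegrable fun z : ℂ => ‖z‖ + ‖z‖ ^ (-(1 : ℝ)) :=
    continuous_norm.locallyIntegrable.add (locallyIntegrable_norm_rpow (by norm_num))
  refine h1.mono (Real.measurable_log.comp measurable_norm).aestronglyMeasurable
    (Filter.Eventually.of_forall fun z => ?_)
  rw [Real.norm_eq_abs, Real.norm_of_nonneg (by positivity), Real.rpow_neg_one]
  exact abs_log_le_add_inv (norm_nonneg z)

theorem locallyIntegrable_comp_sub {f : ℂ → ℝ} (hf : LocallyIntegrable f) (w : ℂ) :
    LocallyIntegrable fun z => f (z - w) := by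
  refine (locallyIntegrable_iff).2 fun K hK => ?_
  have hK' : IsCompact ((fun z => z - w) '' K) := hK.image (by fun_prop)
  have h1 := hf.integrableOn_isCompact hK'
  have h2 : MeasurePreserving (fun z : ℂ => z - w) volume volume := measurePreserving_sub_right _ w
  have h3 := (h2.integrableOn_comp_preimage (MeasurableEquiv.subRight w).measurableEmbedding
    (f := f) (s := (fun z => z - w) '' K)).2 h1
  exact h3.mono_set (subset_preimage_image _ _)

theorem locallyIntegrable_log_norm_sub (w : ℂ) :
    LocallyIntegrable fun z : ℂ => Real.log ‖z - w‖ :=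
  locallyIntegrable_comp_sub locallyIntegrable_log_norm w

theorem laplacian_comp_add_right {φ : ℂ → ℝ} (w z : ℂ) :
    Laplacian.laplacian (fun x => φ (x + w)) z = Laplacian.laplacian φ (z + w) := by
  simp only [InnerProductSpace.laplacian_eq_iteratedFDeriv_complexPlane]
  rw [iteratedFDeriv_comp_add_right]

/-- The radial derivative of a test function, integrated over the plane. -/
theorem integral_fderiv_self_div_sq {φ : ℂ → ℝ} (hφ : ContDiff ℝ 1 φ) (hc : HasCompactSupport φ) :
    ∫ z : ℂ, fderiv ℝ φ z z / ‖z‖ ^ 2 = -(2 * Real.pi) * φ 0 := by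
  set e : ℝ → ℂ := fun θ => Real.cos θ + Real.sin θ * Complex.I with he
  have hec : Continuous e := by
    simp only [he]; fun_prop
  have hne (θ : ℝ) : ‖e θ‖ = 1 := by
    simp only [he]
    rw [Complex.ofReal_cos, Complex.ofReal_sin, Complex.norm_cos_add_sin_mul_I]
  obtain ⟨R, hR0, hR⟩ : ∃ R : ℝ, 0 < R ∧ ∀ z : ℂ, R ≤ ‖z‖ → φ z = 0 ∧ fderiv ℝ φ z = 0 := by
    obtain ⟨R, hR⟩ := hc.isBounded.subset_closedBall (0 : ℂ)
    refine ⟨max R 0 + 1, by positivity, fun z hz => ?_⟩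
    have hz' : z ∉ tsupport φ := fun h => by
      have := hR h
      rw [mem_closedBall_zero_iff] at this
      linarith [le_max_left R 0]
    refine ⟨image_eq_zero_of_notMem_tsupport hz', ?_⟩
    by_contra h1
    exact hz' ((support_fderiv_subset ℝ) h1)
  rw [← Complex.integral_comp_polarCoord_symm]
  -- The Jacobian `r` and one more factor `r` from `z = r e(θ)` cancel `‖z‖²`, leaving the pure
  -- radial derivative, which integrates to `-φ 0` along each ray.
  have h1 : ∫ p in polarCoord.target, p.1 • (fderiv ℝ φ (Complex.polarCoord.symm p)
      (Complex.polarCoord.symm p) / ‖Complex.polarCoord.symm p‖ ^ 2)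
      = ∫ p in Ioi (0 : ℝ) ×ˢ Ioo (-Real.pi) Real.pi, fderiv ℝ φ (p.1 • e p.2) (e p.2) := by
    rw [polarCoord_target]
    refine setIntegral_congr_fun (measurableSet_Ioi.prod measurableSet_Ioo) fun p hp => ?_
    have hp1 : 0 < p.1 := hp.1
    have h2 : Complex.polarCoord.symm p = p.1 • e p.2 := by
      rw [Complex.polarCoord_symm_apply]; simp [he, mul_add]
    rw [h2]
    simp only [norm_smul, hne, map_smul, smul_eq_mul, Real.norm_eq_abs, abs_of_pos hp1]
    field_simp
  rw [h1]
  have hcont : Continuous fun p : ℝ × ℝ => fderiv ℝ φ (p.1 • e p.2) (e p.2) := by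
    have := hφ.continuous_fderiv (by norm_num)
    exact (this.comp (continuous_fst.smul (hec.comp continuous_snd))).clm_apply
      (hec.comp continuous_snd)
  have hint : IntegrableOn (fun p : ℝ × ℝ => fderiv ℝ φ (p.1 • e p.2) (e p.2))
      (Ioi (0 : ℝ) ×ˢ Ioo (-Real.pi) Real.pi) (volume.prod volume) := by
    have h2 : IntegrableOn (fun p : ℝ × ℝ => fderiv ℝ φ (p.1 • e p.2) (e p.2))
      (Icc (0 : ℝ) R ×ˢ Icc (-Real.pi) Real.pi) (volume.prod volume) :=
      hcont.continuousOn.integrableOn_compact (isCompact_Icc.prod isCompact_Icc)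
    refine h2.of_forall_sdiff_eq_zero (measurableSet_Ioi.prod measurableSet_Ioo) fun p hp => ?_
    have hp1 : 0 < p.1 := hp.1.1
    have : R ≤ p.1 := by
      by_contra h
      exact hp.2 ⟨⟨hp1.le, (not_le.1 h).le⟩, hp.1.2.1.le, hp.1.2.2.le⟩
    rw [(hR (p.1 • e p.2) (by rw [norm_smul, hne, Real.norm_eq_abs, abs_of_pos hp1]; simpa)).2]
    simp
  have hswap : IntegrableOn (fun p : ℝ × ℝ => fderiv ℝ φ (p.2 • e p.1) (e p.1))
      (Ioo (-Real.pi) Real.pi ×ˢ Ioi (0 : ℝ)) (volume.prod volume) := hint.swap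
  rw [Measure.volume_eq_prod,
    ← setIntegral_prod_swap (Ioi (0 : ℝ)) (Ioo (-Real.pi) Real.pi)]
  simp only [Prod.swap]
  rw [setIntegral_prod _ hswap]
  have hinner (θ : ℝ) : ∫ r in Ioi (0 : ℝ), fderiv ℝ φ (r • e θ) (e θ) = -φ 0 := by
    have hderiv (r : ℝ) : HasDerivAt (fun r : ℝ => φ (r • e θ)) (fderiv ℝ φ (r • e θ) (e θ)) r := by
      have h3 : HasDerivAt (fun r : ℝ => r • e θ) (e θ) r := by
        simpa using (hasDerivAt_id r).smul_const (e θ)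
      exact ((hφ.differentiable (by norm_num) _).hasFDerivAt).comp_hasDerivAt r h3
    have hint' : IntegrableOn (fun r : ℝ => fderiv ℝ φ (r • e θ) (e θ)) (Ioi 0) := by
      have h4 : Continuous fun r : ℝ => fderiv ℝ φ (r • e θ) (e θ) :=
        hcont.comp (by fun_prop : Continuous fun r : ℝ => (r, θ))
      refine (h4.continuousOn.integrableOn_compact (isCompact_Icc (a := 0) (b := R))
        ).of_forall_sdiff_eq_zero measurableSet_Ioi fun r hr => ?_
      have hr1 : 0 < r := hr.1
      have : R ≤ r := by
        by_contra h
        exact hr.2 ⟨hr1.le, (not_le.1 h).le⟩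
      rw [(hR (r • e θ) (by rw [norm_smul, hne, Real.norm_eq_abs, abs_of_pos hr1]; simpa)).2]
      simp
    have htend : Filter.Tendsto (fun r : ℝ => φ (r • e θ)) Filter.atTop (nhds 0) := by
      refine tendsto_const_nhds.congr' ?_
      filter_upwards [Filter.eventually_ge_atTop R] with r hr
      rw [(hR (r • e θ) (by
        rw [norm_smul, hne, Real.norm_eq_abs, abs_of_pos (hR0.trans_le hr)]; simpa)).1]
    have := integral_Ioi_of_hasDerivAt_of_tendsto' (fun r _ => hderiv r) hint' htend
    simpa using this
  simp_rw [hinner]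
  rw [setIntegral_const, Real.volume_real_Ioo_of_le (by linarith [Real.pi_pos]), smul_eq_mul]
  ring

/-- `(2π)⁻¹ ln |z|` is a fundamental solution of the Laplacian. -/
theorem integral_log_norm_mul_laplacian {φ : ℂ → ℝ} (hφ : ContDiff ℝ ∞ φ)
    (hc : HasCompactSupport φ) :
    ∫ z : ℂ, Real.log ‖z‖ * Laplacian.laplacian φ z = 2 * Real.pi * φ 0 := by
  have hφ1 : ContDiff ℝ 1 φ := contDiff_infty.1 hφ 1
  have hΔ : Continuous (Laplacian.laplacian φ) := continuous_laplacian (contDiff_infty.1 hφ 2)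
  set ε : ℕ → ℝ := fun n => 1 / ((n : ℝ) + 1) with hε
  have hε0 (n : ℕ) : 0 < ε n := by simp only [hε]; positivity
  have hε1 (n : ℕ) : ε n ≤ 1 := by
    simp only [hε]; rw [div_le_one (by positivity)]; linarith [Nat.cast_nonneg (α := ℝ) n]
  have hεt : Filter.Tendsto ε Filter.atTop (nhds 0) := tendsto_one_div_add_atTop_nhds_zero_nat
  -- A smooth regularisation of `ln|z|` with gradient `z / (|z|² + ε²)`. Green's identity is applied
  -- to it, and both sides pass to the limit by dominated convergence.
  set f : ℕ → ℂ → ℝ := fun n z => 1 / 2 * Real.log (‖z‖ ^ 2 + ε n ^ 2) with hf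
  have hpos (n : ℕ) (z : ℂ) : 0 < ‖z‖ ^ 2 + ε n ^ 2 := by have := hε0 n; positivity
  have hfs (n : ℕ) : ContDiff ℝ 1 (f n) :=
    contDiff_const.mul (((contDiff_norm_sq ℝ).add contDiff_const).log fun z => (hpos n z).ne')
  have hfd (n : ℕ) (z v : ℂ) : fderiv ℝ (f n) z v = ⟪z, v⟫_ℝ / (‖z‖ ^ 2 + ε n ^ 2) := by
    have h1 : HasFDerivAt (fun z : ℂ => ‖z‖ ^ 2 + ε n ^ 2) (2 • innerSL ℝ z) z :=
      (hasStrictFDerivAt_norm_sq z).hasFDerivAt.add_const _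
    have h2 := (h1.log (hpos n z).ne').const_mul (1 / 2)
    rw [h2.fderiv]
    simp
    field_simp
  have hgrad (n : ℕ) (z : ℂ) : fderiv ℝ (f n) z 1 * fderiv ℝ φ z 1
      + fderiv ℝ (f n) z Complex.I * fderiv ℝ φ z Complex.I
      = fderiv ℝ φ z z / (‖z‖ ^ 2 + ε n ^ 2) := by
    have h1 : fderiv ℝ φ z z = z.re * fderiv ℝ φ z 1 + z.im * fderiv ℝ φ z Complex.I := by
      rw [← smul_eq_mul, ← smul_eq_mul, ← map_smul, ← map_smul, ← map_add]
      congr 1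
      apply Complex.ext <;> simp
    rw [hfd, hfd, h1]
    simp only [Complex.inner]
    simp
    ring
  have hA (n : ℕ) := integral_mul_laplacian (hfs n) hφ hc
  simp_rw [hgrad] at hA
  have hlim1 : Filter.Tendsto (fun n => ∫ z, f n z * Laplacian.laplacian φ z) Filter.atTop
      (nhds (∫ z : ℂ, Real.log ‖z‖ * Laplacian.laplacian φ z)) := by
    refine tendsto_integral_of_dominated_convergence
      (fun z => ‖((|Real.log ‖z‖| + ‖z‖ ^ 2) * Laplacian.laplacian φ z : ℝ)‖)
      (fun n => ((hfs n).continuous.mul hΔ).aestronglyMeasurable)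
      ?_ (fun n => ?_) ?_
    · refine (integrable_mul_of_hasCompactSupport (f := fun z : ℂ => |Real.log ‖z‖| + ‖z‖ ^ 2)
        (LocallyIntegrable.add ?_ ?_) hΔ (hasCompactSupport_laplacian hc)).norm
      · exact fun x => (locallyIntegrable_log_norm x).norm
      · exact (continuous_norm.pow 2).locallyIntegrable
    · filter_upwards [compl_mem_ae_iff.2 (measure_singleton (0 : ℂ))] with z hz
      have hz0 : 0 < ‖z‖ := norm_pos_iff.2 hz
      suffices h : ‖f n z‖ ≤ ‖|Real.log ‖z‖| + ‖z‖ ^ 2‖ by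
        simpa only [norm_mul] using
          mul_le_mul_of_nonneg_right h (norm_nonneg (Laplacian.laplacian φ z))
      rw [Real.norm_eq_abs, Real.norm_of_nonneg (by positivity), abs_le]
      -- The regularisation lies between `ln|z|` and `|z|²`; the upper bound uses `ε ≤ 1`.
      have hl : Real.log ‖z‖ ≤ f n z := by
        have : Real.log (‖z‖ ^ 2) ≤ Real.log (‖z‖ ^ 2 + ε n ^ 2) :=
          Real.log_le_log (by positivity) (by nlinarith [hε0 n])
        rw [Real.log_pow] at this
        simp only [hf]; push_cast at this; linarith
      have hu : f n z ≤ ‖z‖ ^ 2 := by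
        have := Real.log_le_sub_one_of_pos (hpos n z)
        have h3 : ε n ^ 2 ≤ 1 := pow_le_one₀ (hε0 n).le (hε1 n)
        simp only [hf]; nlinarith
      constructor
      · linarith [neg_abs_le (Real.log ‖z‖), sq_nonneg ‖z‖]
      · linarith [abs_nonneg (Real.log ‖z‖)]
    · filter_upwards [compl_mem_ae_iff.2 (measure_singleton (0 : ℂ))] with z hz
      have hz0 : 0 < ‖z‖ := norm_pos_iff.2 hz
      refine Filter.Tendsto.mul_const _ ?_
      have h4 : Filter.Tendsto (fun n => ‖z‖ ^ 2 + ε n ^ 2) Filter.atTop (nhds (‖z‖ ^ 2)) := by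
        simpa using (hεt.pow 2).const_add (‖z‖ ^ 2)
      have h5 := (h4.log (by positivity)).const_mul (1 / 2)
      rw [Real.log_pow] at h5
      convert h5 using 2
      push_cast; ring
  have hlim2 : Filter.Tendsto (fun n => -∫ z, fderiv ℝ φ z z / (‖z‖ ^ 2 + ε n ^ 2)) Filter.atTop
      (nhds (-∫ z : ℂ, fderiv ℝ φ z z / ‖z‖ ^ 2)) := by
    have hD : Continuous (fderiv ℝ φ) := hφ1.continuous_fderiv (by norm_num)
    refine (tendsto_integral_of_dominated_convergence
      (fun z => ‖z‖ ^ (-(1 : ℝ)) * ‖fderiv ℝ φ z‖)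
      (fun n => ((hD.clm_apply continuous_id).div (by fun_prop)
        fun z => (hpos n z).ne').aestronglyMeasurable) ?_ (fun n => ?_) ?_).neg
    · exact integrable_mul_of_hasCompactSupport (locallyIntegrable_norm_rpow (by norm_num))
        hD.norm (hc.fderiv (𝕜 := ℝ)).norm
    · filter_upwards [compl_mem_ae_iff.2 (measure_singleton (0 : ℂ))] with z hz
      have hz0 : 0 < ‖z‖ := norm_pos_iff.2 hz
      rw [Pi.div_apply, Real.rpow_neg_one, norm_div, Real.norm_of_nonneg (hpos n z).le,
        div_le_iff₀ (hpos n z)]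
      have h6 := (fderiv ℝ φ z).le_opNorm z
      have h7 : ‖z‖ ≤ ‖z‖⁻¹ * (‖z‖ ^ 2 + ε n ^ 2) := by
        rw [inv_mul_eq_div, le_div_iff₀ hz0]; nlinarith [sq_nonneg (ε n)]
      calc ‖fderiv ℝ φ z z‖ ≤ ‖fderiv ℝ φ z‖ * ‖z‖ := h6
        _ ≤ ‖fderiv ℝ φ z‖ * (‖z‖⁻¹ * (‖z‖ ^ 2 + ε n ^ 2)) := by gcongr
        _ = _ := by ring
    · filter_upwards [compl_mem_ae_iff.2 (measure_singleton (0 : ℂ))] with z hz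
      have hz0 : 0 < ‖z‖ := norm_pos_iff.2 hz
      have h4 : Filter.Tendsto (fun n => ‖z‖ ^ 2 + ε n ^ 2) Filter.atTop (nhds (‖z‖ ^ 2)) := by
        simpa using (hεt.pow 2).const_add (‖z‖ ^ 2)
      exact tendsto_const_nhds.div h4 (by positivity)
  have := tendsto_nhds_unique (hlim1.congr hA) hlim2
  rw [this, integral_fderiv_self_div_sq hφ1 hc]
  ring

theorem integral_log_norm_sub_mul_laplacian {φ : ℂ → ℝ} (hφ : ContDiff ℝ ∞ φ)
    (hc : HasCompactSupport φ) (w : ℂ) :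
    ∫ z : ℂ, Real.log ‖z - w‖ * Laplacian.laplacian φ z = 2 * Real.pi * φ w := by
  have h1 := integral_log_norm_mul_laplacian (φ := fun x => φ (x + w))
    (hφ.comp (contDiff_id.add contDiff_const)) (hc.comp_homeomorph (Homeomorph.addRight w))
  simp_rw [laplacian_comp_add_right, zero_add] at h1
  rw [← h1, ← integral_sub_right_eq_self (fun z => Real.log ‖z‖ * Laplacian.laplacian φ (z + w)) w]
  simp

/-! ### Mollification and Weyl's lemma. -/

open scoped Convolution in
/-- The convolution of a locally integrable function with a test function. -/
def mollify (h g : ℂ → ℝ) : ℂ → ℝ := h ⋆[ContinuousLinearMap.mul ℝ ℝ] g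

theorem mollify_apply (h g : ℂ → ℝ) (z : ℂ) : mollify h g z = ∫ w, h w * g (z - w) := rfl

theorem contDiff_mollify {h g : ℂ → ℝ} (hh : LocallyIntegrable h) (hg : ContDiff ℝ ∞ g)
    (hc : HasCompactSupport g) : ContDiff ℝ ∞ (mollify h g) :=
  hc.contDiff_convolution_right (ContinuousLinearMap.mul ℝ ℝ) hh hg

theorem fderiv_mollify {h g : ℂ → ℝ} (hh : LocallyIntegrable h) (hg : ContDiff ℝ 1 g)
    (hc : HasCompactSupport g) (z v : ℂ) :
    fderiv ℝ (mollify h g) z v = mollify h (fun w => fderiv ℝ g w v) z := by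
  rw [mollify, (hc.hasFDerivAt_convolution_right (ContinuousLinearMap.mul ℝ ℝ) hh hg z).fderiv,
    convolution_precompR_apply _ hh (hc.fderiv (𝕜 := ℝ)) (hg.continuous_fderiv (by norm_num))]
  rfl

theorem laplacian_mollify {h g : ℂ → ℝ} (hh : LocallyIntegrable h) (hg : ContDiff ℝ ∞ g)
    (hc : HasCompactSupport g) (z : ℂ) :
    Laplacian.laplacian (mollify h g) z = ∫ w, h w * Laplacian.laplacian g (z - w) := by
  have hg1 : ContDiff ℝ 1 g := contDiff_infty.1 hg 1
  have hg2 : ContDiff ℝ 2 g := contDiff_infty.1 hg 2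
  have h1 (v : ℂ) : ContDiff ℝ 1 (fun w => fderiv ℝ g w v) :=
    (hg2.fderiv_right (m := 1) (by norm_num)).clm_apply contDiff_const
  have h1c (v : ℂ) : HasCompactSupport (fun w => fderiv ℝ g w v) := hc.fderiv_apply (𝕜 := ℝ) v
  have h2 (v : ℂ) : Continuous (fun z => fderiv ℝ (fun w => fderiv ℝ g w v) z v) :=
    ((h1 v).continuous_fderiv (by norm_num)).clm_apply continuous_const
  have hi (v : ℂ) : Integrable fun w => h w * fderiv ℝ (fun x => fderiv ℝ g x v) (z - w) v :=
    integrable_mul_of_hasCompactSupport hh ((h2 v).comp (continuous_const.sub continuous_id))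
      (((h1c v).fderiv_apply (𝕜 := ℝ) v).comp_homeomorph (Homeomorph.subLeft z))
  rw [laplacian_eq_fderiv_fderiv (contDiff_infty.1 (contDiff_mollify hh hg hc) 2)]
  simp_rw [fderiv_mollify hh hg1 hc]
  have h3 (v : ℂ) : fderiv ℝ (fun w => mollify h (fun w => fderiv ℝ g w v) w) z v
      = mollify h (fun w => fderiv ℝ (fun x => fderiv ℝ g x v) w v) z :=
    fderiv_mollify hh (h1 v) (h1c v) z v
  rw [h3, h3, mollify_apply, mollify_apply, ← integral_add (hi 1) (hi _)]
  congr 1; ext w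
  rw [laplacian_eq_fderiv_fderiv hg2]; ring

theorem laplacian_comp_sub_left {g : ℂ → ℝ} (hg : ContDiff ℝ 2 g) (z w : ℂ) :
    Laplacian.laplacian (fun x => g (z - x)) w = Laplacian.laplacian g (z - w) := by
  have hs : ContDiff ℝ 2 fun x : ℂ => z - x := contDiff_const.sub contDiff_id
  have key {f : ℂ → ℝ} (hf : Differentiable ℝ f) (x v : ℂ) :
      fderiv ℝ (fun x => f (z - x)) x v = -fderiv ℝ f (z - x) v := by
    have h1 : HasFDerivAt (fun x : ℂ => z - x) (-ContinuousLinearMap.id ℝ ℂ) x :=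
      (hasFDerivAt_id x).const_sub z
    have h2 := (hf (z - x)).hasFDerivAt.comp x h1
    change fderiv ℝ (f ∘ fun x => z - x) x v = _
    rw [h2.fderiv]; simp
  have hd (v : ℂ) : Differentiable ℝ (fun w => fderiv ℝ g w v) :=
    ((hg.fderiv_right (m := 1) (by norm_num)).clm_apply contDiff_const).differentiable (by norm_num)
  rw [laplacian_eq_fderiv_fderiv hg,
    laplacian_eq_fderiv_fderiv (φ := fun x => g (z - x)) (hg.comp hs)]
  simp_rw [key (hg.differentiable (by norm_num))]
  have h3 (v : ℂ) : fderiv ℝ (fun x => -fderiv ℝ g (z - x) v) w v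
      = fderiv ℝ (fun w => fderiv ℝ g w v) (z - w) v := by
    rw [fderiv_fun_neg, _root_.neg_apply, key (hd v), neg_neg]
  rw [h3, h3]

/-- `h` is harmonic on `U` in the sense of distributions. -/
def WeaklyHarmonicOn (h : ℂ → ℝ) (U : Set ℂ) : Prop :=
  ∀ φ : ℂ → ℝ, ContDiff ℝ ∞ φ → HasCompactSupport φ → tsupport φ ⊆ U →
    ∫ z, h z * Laplacian.laplacian φ z = 0

/-- The Laplacian of the convolution at `z` is `h` tested against the Laplacian of `x ↦ g (z - x)`,
a test function supported within `ε` of `z`. -/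
theorem WeaklyHarmonicOn.harmonicOnNhd_mollify {h g : ℂ → ℝ} (hh : LocallyIntegrable h)
    (hg : ContDiff ℝ ∞ g) {z₀ : ℂ} {ρ ε : ℝ} (hs : tsupport g ⊆ closedBall 0 ε)
    (hw : WeaklyHarmonicOn h (ball z₀ ρ)) :
    InnerProductSpace.HarmonicOnNhd (mollify h g) (ball z₀ (ρ - ε)) := by
  have hc : HasCompactSupport g :=
    (isCompact_closedBall 0 ε).of_isClosed_subset (isClosed_tsupport g) hs
  have hz (z : ℂ) (hz : z ∈ ball z₀ (ρ - ε)) : Laplacian.laplacian (mollify h g) z = 0 := by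
    rw [laplacian_mollify hh hg hc]
    simp_rw [← laplacian_comp_sub_left (contDiff_infty.1 hg 2)]
    refine hw _ (hg.comp (contDiff_const.sub contDiff_id))
      (hc.comp_homeomorph (Homeomorph.subLeft z)) ?_
    have h1 : tsupport (fun x => g (z - x)) ⊆ (fun x => z - x) ⁻¹' tsupport g :=
      closure_minimal (fun x hx => subset_tsupport g hx)
        ((isClosed_tsupport g).preimage (by fun_prop))
    intro x hx
    have h2 := hs (h1 hx)
    rw [mem_closedBall_zero_iff] at h2
    rw [mem_ball] at hz ⊢
    have h3 : dist x z ≤ ε := by rw [dist_comm, dist_eq_norm]; exact h2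
    linarith [dist_triangle x z z₀]
  intro z hzb
  refine ⟨((contDiff_infty.1 (contDiff_mollify hh hg hc) 2)).contDiffAt, ?_⟩
  filter_upwards [isOpen_ball.mem_nhds hzb] with y hy using hz y hy

/-- By associativity both sides are the convolution of `h` with `g * k = k * g`. -/
theorem mollify_mollify_comm {h g k : ℂ → ℝ} (hh : LocallyIntegrable h)
    (hg : Continuous g) (hgc : HasCompactSupport g) (hk : Continuous k)
    (hkc : HasCompactSupport k) (z : ℂ) :
    mollify (mollify h g) k z = mollify (mollify h k) g z := by
  have key {g k : ℂ → ℝ} (hg : Continuous g) (hgc : HasCompactSupport g) (hk : Continuous k)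
      (hkc : HasCompactSupport k) : mollify (mollify h g) k z = mollify h (mollify g k) z := by
    refine convolution_assoc _ _ _ _ (fun x y z => by simp [mul_assoc]) hh.aestronglyMeasurable
      hg.aestronglyMeasurable hk.aestronglyMeasurable (Filter.Eventually.of_forall fun y => ?_)
      (Filter.Eventually.of_forall fun y => ?_) ?_
    · exact hgc.convolutionExists_right _ hh hg y
    · exact hkc.norm.convolutionExists_right _ hg.norm.locallyIntegrable hk.norm y
    · have h1 : Continuous (convolution (fun x => ‖g x‖) (fun x => ‖k x‖)
          (ContinuousLinearMap.mul ℝ ℝ) volume) :=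
        hkc.norm.continuous_convolution_right _ hg.norm.locallyIntegrable hk.norm
      exact (hgc.norm.convolution _ hkc.norm).convolutionExists_right _
        (fun x => (hh x).norm) h1 z
  rw [key hg hgc hk hkc, key hk hkc hg hgc]
  congr 1
  ext x
  rw [mollify_apply, mollify_apply, ← integral_sub_left_eq_self _ volume x]
  simp [mul_comm]

/-- The mean value property on each circle, integrated against the radial weight; circles of radius
beyond `ε`, where `f` need not be harmonic, carry weight zero. -/
theorem integral_radial_mul {f : ℂ → ℝ} {z : ℂ} {ε : ℝ} {η : ℝ → ℝ}
    (hf : InnerProductSpace.HarmonicOnNhd f (closedBall z ε)) (hfc : Continuous f)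
    (hηc : Continuous η) (hη : ∀ x, ε < x → η x = 0) :
    ∫ w : ℂ, f (z + w) * η ‖w‖ = f z * ∫ w : ℂ, η ‖w‖ := by
  have hpc : Continuous fun p : ℝ × ℝ => f (z + Complex.polarCoord.symm p) * (p.1 * η |p.1|) := by
    simp only [Complex.polarCoord_symm_apply]; fun_prop
  have key (g : ℂ → ℝ) (hgc : Continuous g)
      (hgm : ∀ r : ℝ, 0 < r → r ≤ ε → Real.circleAverage g 0 r = g 0) :
      ∫ w : ℂ, g w * η ‖w‖ = (2 * Real.pi * g 0) * ∫ r in Ioi (0 : ℝ), r * η r := by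
    rw [← Complex.integral_comp_polarCoord_symm]
    have h1 : ∫ p in polarCoord.target, p.1 • (g (Complex.polarCoord.symm p)
        * η ‖Complex.polarCoord.symm p‖)
        = ∫ p in Ioi (0 : ℝ) ×ˢ Ioo (-Real.pi) Real.pi,
          g (circleMap 0 p.1 p.2) * (p.1 * η p.1) := by
      rw [polarCoord_target]
      refine setIntegral_congr_fun (measurableSet_Ioi.prod measurableSet_Ioo) fun p hp => ?_
      have hp1 : 0 < p.1 := hp.1
      have h2 : Complex.polarCoord.symm p = circleMap 0 p.1 p.2 := by
        rw [Complex.polarCoord_symm_apply, circleMap_zero, Complex.exp_mul_I]; simp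
      simp only [h2, norm_circleMap_zero, abs_of_pos hp1, smul_eq_mul]
      ring
    rw [h1]
    have hcm : Continuous fun p : ℝ × ℝ => g (circleMap 0 p.1 p.2) * (p.1 * η p.1) := by
      simp only [circleMap]; fun_prop
    have hint : IntegrableOn (fun p : ℝ × ℝ => g (circleMap 0 p.1 p.2) * (p.1 * η p.1))
        (Ioi (0 : ℝ) ×ˢ Ioo (-Real.pi) Real.pi) (volume.prod volume) := by
      have h2 : IntegrableOn (fun p : ℝ × ℝ => g (circleMap 0 p.1 p.2) * (p.1 * η p.1))
          (Icc (0 : ℝ) ε ×ˢ Icc (-Real.pi) Real.pi) (volume.prod volume) :=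
        hcm.continuousOn.integrableOn_compact (isCompact_Icc.prod isCompact_Icc)
      refine h2.of_forall_sdiff_eq_zero (measurableSet_Ioi.prod measurableSet_Ioo) fun p hp => ?_
      have hp1 : 0 < p.1 := hp.1.1
      have : ε < p.1 := by
        by_contra h
        exact hp.2 ⟨⟨hp1.le, not_lt.1 h⟩, hp.1.2.1.le, hp.1.2.2.le⟩
      rw [hη _ this]; simp
    rw [Measure.volume_eq_prod, setIntegral_prod _ hint, ← integral_const_mul]
    refine setIntegral_congr_fun measurableSet_Ioi fun r hr => ?_
    have hr0 : 0 < r := hr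
    change ∫ θ in Ioo (-Real.pi) Real.pi, g (circleMap 0 r θ) * (r * η r) = _
    rw [integral_mul_const]
    rcases le_or_gt r ε with h | h
    · have h3 : ∫ θ in Ioo (-Real.pi) Real.pi, g (circleMap 0 r θ)
          = 2 * Real.pi * Real.circleAverage g 0 r := by
        rw [← integral_Ioc_eq_integral_Ioo,
          ← intervalIntegral.integral_of_le (by linarith [Real.pi_pos]), Real.circleAverage]
        have hper : Function.Periodic (fun θ => g (circleMap 0 r θ)) (2 * Real.pi) :=
          (periodic_circleMap 0 r).comp g
        have := hper.intervalIntegral_add_eq (-Real.pi) 0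
        rw [show -Real.pi + 2 * Real.pi = Real.pi by ring, zero_add] at this
        rw [this, smul_eq_mul]
        field_simp
      rw [h3, hgm r hr0 h]
    · rw [hη _ h]; simp
  have hA := key (fun w => f (z + w)) (by fun_prop) fun r hr hrε => by
    have h4 : InnerProductSpace.HarmonicOnNhd f (closedBall z |r|) :=
      hf.mono (closedBall_subset_closedBall (by rwa [abs_of_pos hr]))
    have h5 := h4.circleAverage_eq
    rw [add_zero, ← h5]
    simp [Real.circleAverage, circleMap]
  have hB := key (fun _ => 1) continuous_const fun r hr hrε =>
    Real.circleAverage_const _ _ _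
  simp only [add_zero] at hA
  simp only [one_mul] at hB
  rw [hA, hB]; ring

/-- The profile of a radial mollifier supported in the disc of radius `ε`. -/
def radialProfile (ε : ℝ) (x : ℝ) : ℝ := Real.smoothTransition (1 - x ^ 2 / ε ^ 2)

/-- A radial mollifier supported in the disc of radius `ε`. -/
def radialBump (ε : ℝ) (z : ℂ) : ℝ :=
  (∫ w : ℂ, radialProfile ε ‖w‖)⁻¹ * radialProfile ε ‖z‖

theorem contDiff_radialBump (ε : ℝ) : ContDiff ℝ ∞ (radialBump ε) :=
  contDiff_const.mul (Real.smoothTransition.contDiff.comp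
    (contDiff_const.sub ((contDiff_norm_sq ℝ).div_const _)))

theorem radialProfile_eq_zero {ε x : ℝ} (hε : 0 < ε) (hx : ε < x) : radialProfile ε x = 0 := by
  refine Real.smoothTransition.zero_of_nonpos ?_
  rw [sub_nonpos, le_div_iff₀ (by positivity), one_mul]
  gcongr

theorem tsupport_radialBump_subset {ε : ℝ} (hε : 0 < ε) :
    tsupport (radialBump ε) ⊆ closedBall 0 ε := by
  refine closure_minimal (fun z hz => ?_) isClosed_closedBall
  by_contra h
  rw [mem_closedBall_zero_iff, not_le] at h
  exact hz (by simp [radialBump, radialProfile_eq_zero hε h])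

theorem hasCompactSupport_radialBump {ε : ℝ} (hε : 0 < ε) : HasCompactSupport (radialBump ε) :=
  (isCompact_closedBall 0 ε).of_isClosed_subset (isClosed_tsupport _)
    (tsupport_radialBump_subset hε)

theorem integral_radialProfile_pos {ε : ℝ} (hε : 0 < ε) : 0 < ∫ w : ℂ, radialProfile ε ‖w‖ := by
  have hcont : Continuous fun w : ℂ => radialProfile ε ‖w‖ := by
    unfold radialProfile
    exact Real.smoothTransition.continuous.comp (by fun_prop)
  have hcs : HasCompactSupport fun w : ℂ => radialProfile ε ‖w‖ := by
    refine HasCompactSupport.intro (isCompact_closedBall 0 ε) fun z hz => ?_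
    rw [mem_closedBall_zero_iff, not_le] at hz
    exact radialProfile_eq_zero hε hz
  refine hcont.integral_pos_of_hasCompactSupport_nonneg_nonzero hcs
    (fun w => Real.smoothTransition.nonneg _) (x := 0) ?_
  simp [radialProfile]

theorem mollify_radialBump {f : ℂ → ℝ} {z : ℂ} {ε : ℝ} (hε : 0 < ε)
    (hf : InnerProductSpace.HarmonicOnNhd f (closedBall z ε)) (hfc : Continuous f) :
    mollify f (radialBump ε) z = f z := by
  have hηc : Continuous (radialProfile ε) := by
    unfold radialProfile
    exact Real.smoothTransition.continuous.comp (by fun_prop)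
  have h1 := integral_radial_mul hf hfc hηc fun x hx => radialProfile_eq_zero hε hx
  have h2 : mollify f (radialBump ε) z
      = (∫ w : ℂ, radialProfile ε ‖w‖)⁻¹ * ∫ w : ℂ, f (z + w) * radialProfile ε ‖w‖ := by
    rw [mollify_apply, ← integral_add_left_eq_self _ z, ← integral_const_mul]
    congr 1; ext w
    simp [radialBump]; ring
  rw [h2, h1]
  have := (integral_radialProfile_pos hε).ne'
  field_simp

theorem convolution_lsmul_eq_mollify (g h : ℂ → ℝ) (z : ℂ) :
    convolution g h (ContinuousLinearMap.lsmul ℝ ℝ) volume z = mollify h g z := by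
  rw [convolution_eq_swap, mollify_apply]
  exact integral_congr_ae (Filter.Eventually.of_forall fun w => mul_comm _ _)

/-- **Weyl's lemma** on a disc. -/
theorem WeaklyHarmonicOn.ae_eq_mollify {h : ℂ → ℝ} (hh : LocallyIntegrable h) {z₀ : ℂ} {ρ ε : ℝ}
    (hε : 0 < ε) (hw : WeaklyHarmonicOn h (ball z₀ ρ)) :
    ∀ᵐ z, z ∈ ball z₀ (ρ - 2 * ε) → h z = mollify h (radialBump ε) z := by
  let b : ℕ → ContDiffBump (0 : ℂ) := fun n =>
    { rIn := ε / (2 * (n + 1))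
      rOut := ε / (n + 1)
      rIn_pos := by positivity
      rIn_lt_rOut := by
        rw [div_lt_div_iff₀ (by positivity) (by positivity)]
        have : (0 : ℝ) ≤ n := Nat.cast_nonneg n
        nlinarith }
  have hbε (n : ℕ) : (b n).rOut ≤ ε :=
    div_le_self hε.le (by linarith [Nat.cast_nonneg (α := ℝ) n])
  have hb0 : Filter.Tendsto (fun n => (b n).rOut) Filter.atTop (nhds 0) := by
    have := (tendsto_one_div_add_atTop_nhds_zero_nat (𝕜 := ℝ)).const_mul ε
    simpa [b, div_eq_mul_inv] using this
  have hbK (n : ℕ) : (b n).rOut ≤ 2 * (b n).rIn := by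
    simp only [b]; apply le_of_eq; field_simp
  have hae := ContDiffBump.ae_convolution_tendsto_right_of_locallyIntegrable (μ := volume) hb0
    (Filter.Eventually.of_forall hbK) hh
  filter_upwards [hae] with z hz hzb
  set g : ℕ → ℂ → ℝ := fun n => (b n).normed volume with hg
  have hgs (n : ℕ) : ContDiff ℝ ∞ (g n) := (b n).contDiff_normed
  have hgc (n : ℕ) : HasCompactSupport (g n) := (b n).hasCompactSupport_normed
  have hgt (n : ℕ) : tsupport (g n) ⊆ closedBall 0 ε := by
    rw [hg, (b n).tsupport_normed_eq]; exact closedBall_subset_closedBall (hbε n)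
  -- After the mollifiers are exchanged, `h * g n` is smooth and harmonic near `z`, so the radial
  -- mollifier fixes it. As `n → ∞` the right side tends to `h z` for almost every `z`, the left
  -- side to the continuous mollification.
  have h2 (n : ℕ) : mollify (mollify h (radialBump ε)) (g n) z = mollify h (g n) z := by
    rw [mollify_mollify_comm hh (contDiff_radialBump ε).continuous (hasCompactSupport_radialBump hε)
      (hgs n).continuous (hgc n)]
    refine mollify_radialBump hε ((hw.harmonicOnNhd_mollify hh (hgs n) (hgt n)).mono ?_)
      (contDiff_mollify hh (hgs n) (hgc n)).continuous
    refine closedBall_subset_ball' ?_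
    rw [mem_ball] at hzb; linarith
  have hH : Continuous (mollify h (radialBump ε)) :=
    (contDiff_mollify hh (contDiff_radialBump ε) (hasCompactSupport_radialBump hε)).continuous
  have h3 := ContDiffBump.convolution_tendsto_right_of_continuous (μ := volume) hb0 hH z
  refine tendsto_nhds_unique hz (h3.congr fun n => ?_)
  rw [convolution_lsmul_eq_mollify, convolution_lsmul_eq_mollify]
  exact h2 n

/-- **Weyl's lemma** on the plane: a weakly harmonic function is the real part of an entire one. -/
theorem WeaklyHarmonicOn.exists_re_eq {h : ℂ → ℝ} (hh : LocallyIntegrable h)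
    (hw : WeaklyHarmonicOn h univ) :
    ∃ F : ℂ → ℂ, Differentiable ℂ F ∧ h =ᵐ[volume] fun z => (F z).re := by
  have hw' (ρ : ℝ) : WeaklyHarmonicOn h (ball 0 ρ) := fun φ h1 h2 _ => hw φ h1 h2 (subset_univ _)
  -- The single radius `1` serves on every disc, so this one smooth representative is harmonic on
  -- the whole plane and is the real part of an entire function.
  have hH : InnerProductSpace.HarmonicOnNhd (mollify h (radialBump 1)) univ := fun z _ =>
    (hw' (‖z‖ + 2)).harmonicOnNhd_mollify hh (contDiff_radialBump 1)
      (tsupport_radialBump_subset one_pos) z (by rw [mem_ball_zero_iff]; linarith)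
  obtain ⟨F, hF, hFe⟩ := hH.exists_analyticOnNhd_univ_re_eq
  refine ⟨F, fun z => (hF z (mem_univ z)).differentiableAt, ?_⟩
  have h1 : ∀ n : ℕ, ∀ᵐ z, z ∈ ball (0 : ℂ) (n - 2 * 1) → h z = mollify h (radialBump 1) z :=
    fun n => (hw' n).ae_eq_mollify hh one_pos
  filter_upwards [ae_all_iff.2 h1] with z hz
  obtain ⟨n, hn⟩ := exists_nat_gt (‖z‖ + 2)
  rw [hz n (by rw [mem_ball_zero_iff]; linarith), ← hFe]

/-! ### Logarithmic potentials of finite measures and local integrability of `e^{-2V}`. -/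

/-- For `w` within `r` of `z₀`, translation by `w` carries the disc of radius `R` into the one of
radius `R + r` about `0`, so the inner integrals have a common bound. This licenses every use of
Fubini's theorem for potentials below. -/
theorem integrable_comp_sub_prod {k : ℂ → ℝ} (hk : LocallyIntegrable k) (hkm : Measurable k)
    {m : Measure ℂ} [IsFiniteMeasure m] {z₀ : ℂ} {r : ℝ} (hm : ∀ᵐ w ∂m, w ∈ closedBall z₀ r)
    (R : ℝ) :
    Integrable (fun p : ℂ × ℂ => k (p.1 - p.2))
      ((volume.restrict (closedBall z₀ R)).prod m) := by
  have hmeas : Measurable fun p : ℂ × ℂ => k (p.1 - p.2) :=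
    hkm.comp (measurable_fst.sub measurable_snd)
  have hloc (w : ℂ) : LocallyIntegrable fun z => k (z - w) := locallyIntegrable_comp_sub hk w
  rw [integrable_prod_iff' hmeas.aestronglyMeasurable]
  refine ⟨Filter.Eventually.of_forall fun w =>
    (hloc w).integrableOn_isCompact (isCompact_closedBall z₀ R), ?_⟩
  refine Integrable.of_bound (C := ∫ u in closedBall (0 : ℂ) (R + r), ‖k u‖)
    (hmeas.norm.stronglyMeasurable.integral_prod_left').aestronglyMeasurable ?_
  filter_upwards [hm] with w hw
  rw [Real.norm_of_nonneg (integral_nonneg fun _ => norm_nonneg _)]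
  change ∫ z in closedBall z₀ R, ‖k (z - w)‖ ≤ _
  have h2 : MeasurePreserving (fun z : ℂ => z - w) volume volume := measurePreserving_sub_right _ w
  have h3 := h2.setIntegral_preimage_emb (MeasurableEquiv.subRight w).measurableEmbedding
    (fun u => ‖k u‖) (closedBall (0 : ℂ) (R + r))
  rw [← h3]
  refine setIntegral_mono_set ?_ (Filter.Eventually.of_forall fun _ => norm_nonneg _)
    (Filter.Eventually.of_forall fun z hz => ?_)
  · exact (h2.integrableOn_comp_preimage (MeasurableEquiv.subRight w).measurableEmbedding
      (f := fun u => ‖k u‖)).2 (hk.integrableOn_isCompact (isCompact_closedBall _ _)).norm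
  · have hz' : dist z z₀ ≤ R := hz
    have hw' : dist w z₀ ≤ r := hw
    change z - w ∈ closedBall (0 : ℂ) (R + r)
    rw [mem_closedBall_zero_iff, ← dist_eq_norm]
    linarith [dist_triangle_right z w z₀]

theorem locallyIntegrable_of_forall_closedBall {f : ℂ → ℝ} {z₀ : ℂ}
    (h : ∀ R : ℝ, IntegrableOn f (closedBall z₀ R)) : LocallyIntegrable f := by
  refine (locallyIntegrable_iff).2 fun K hK => ?_
  obtain ⟨R, hR⟩ := hK.isBounded.subset_closedBall z₀
  exact (h R).mono_set hR

theorem locallyIntegrable_integral_comp_sub {k : ℂ → ℝ} (hk : LocallyIntegrable k)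
    (hkm : Measurable k) {m : Measure ℂ} [IsFiniteMeasure m] {z₀ : ℂ} {r : ℝ}
    (hm : ∀ᵐ w ∂m, w ∈ closedBall z₀ r) : LocallyIntegrable fun z => ∫ w, k (z - w) ∂m :=
  locallyIntegrable_of_forall_closedBall fun R =>
    (integrable_comp_sub_prod hk hkm hm R).integral_prod_left

theorem ae_integrable_comp_sub {k : ℂ → ℝ} (hk : LocallyIntegrable k)
    (hkm : Measurable k) {m : Measure ℂ} [IsFiniteMeasure m] {z₀ : ℂ} {r : ℝ}
    (hm : ∀ᵐ w ∂m, w ∈ closedBall z₀ r) :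
    ∀ᵐ z, Integrable (fun w => k (z - w)) m := by
  have h1 (n : ℕ) : ∀ᵐ z, z ∈ closedBall z₀ n → Integrable (fun w => k (z - w)) m :=
    (ae_restrict_iff' isClosed_closedBall.measurableSet).1
      (integrable_comp_sub_prod hk hkm hm n).prod_right_ae
  filter_upwards [ae_all_iff.2 h1] with z hz
  obtain ⟨n, hn⟩ := exists_nat_ge (dist z z₀)
  exact hz n hn

/-- The logarithmic potential of a finite measure. -/
def logPotential (m : Measure ℂ) (z : ℂ) : ℝ := (2 * Real.pi)⁻¹ * ∫ w, Real.log ‖z - w‖ ∂m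

theorem measurable_log_norm : Measurable fun z : ℂ => Real.log ‖z‖ :=
  Real.measurable_log.comp measurable_norm

theorem locallyIntegrable_logPotential {m : Measure ℂ} [IsFiniteMeasure m] {z₀ : ℂ} {r : ℝ}
    (hm : ∀ᵐ w ∂m, w ∈ closedBall z₀ r) : LocallyIntegrable (logPotential m) :=
  (locallyIntegrable_integral_comp_sub locallyIntegrable_log_norm measurable_log_norm hm).smul
    (2 * Real.pi)⁻¹

/-- Fubini's theorem reduces this to the fundamental solution centred at each `w`. -/
theorem integral_logPotential_mul_laplacian {m : Measure ℂ} [IsFiniteMeasure m] {z₀ : ℂ} {r : ℝ}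
    (hm : ∀ᵐ w ∂m, w ∈ closedBall z₀ r) {φ : ℂ → ℝ} (hφ : ContDiff ℝ ∞ φ)
    (hc : HasCompactSupport φ) :
    ∫ z, logPotential m z * Laplacian.laplacian φ z = ∫ w, φ w ∂m := by
  obtain ⟨R, hR⟩ := (hasCompactSupport_laplacian hc).isBounded.subset_closedBall z₀
  have hΔ : Continuous (Laplacian.laplacian φ) := continuous_laplacian (contDiff_infty.1 hφ 2)
  obtain ⟨C, hC⟩ := (hasCompactSupport_laplacian hc).exists_bound_of_continuous hΔ
  have h0 (z : ℂ) (hz : z ∉ closedBall z₀ R) : Laplacian.laplacian φ z = 0 :=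
    image_eq_zero_of_notMem_tsupport fun h => hz (hR h)
  have hint : Integrable (fun p : ℂ × ℂ => Real.log ‖p.1 - p.2‖ * Laplacian.laplacian φ p.1)
      ((volume.restrict (closedBall z₀ R)).prod m) :=
    (integrable_comp_sub_prod locallyIntegrable_log_norm measurable_log_norm hm R).mul_bdd (c := C)
      (hΔ.comp continuous_fst).aestronglyMeasurable (Filter.Eventually.of_forall fun p => hC p.1)
  have hw (w : ℂ) : ∫ z in closedBall z₀ R, Real.log ‖z - w‖ * Laplacian.laplacian φ z
      = 2 * Real.pi * φ w := by
    rw [setIntegral_eq_integral_of_forall_compl_eq_zero fun z hz => by rw [h0 z hz, mul_zero],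
      integral_log_norm_sub_mul_laplacian hφ hc]
  have h1 := integral_integral_swap (f := fun z w => Real.log ‖z - w‖ * Laplacian.laplacian φ z)
    hint
  simp_rw [hw, integral_mul_const] at h1
  rw [← setIntegral_eq_integral_of_forall_compl_eq_zero (s := closedBall z₀ R)
    fun z hz => by rw [h0 z hz, mul_zero]]
  simp_rw [logPotential, mul_assoc]
  rw [integral_const_mul, h1, integral_const_mul]
  have := Real.pi_pos
  field_simp

/-- If `m` has mass less than `2π`, then `e^{-2P}` is locally integrable for its logarithmic
potential `P`. -/
theorem locallyIntegrable_exp_logPotential {m : Measure ℂ} [IsFiniteMeasure m] {z₀ : ℂ} {r : ℝ}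
    (hm : ∀ᵐ w ∂m, w ∈ closedBall z₀ r) (hmass : m.real univ < 2 * Real.pi) :
    LocallyIntegrable fun z => Real.exp (-2 * logPotential m z) := by
  have hpi := Real.pi_pos
  rcases eq_or_ne m 0 with rfl | hm0
  · simpa [logPotential] using locallyIntegrable_const (1 : ℝ)
  have : NeZero m := ⟨hm0⟩
  set M := m.real univ with hM
  have hMpos : 0 < M := by
    rw [hM, measureReal_def]
    exact ENNReal.toReal_pos (by simpa using hm0) (measure_ne_top m _)
  have hs : M / Real.pi < 2 := by rw [div_lt_iff₀ hpi]; linarith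
  have hk := locallyIntegrable_norm_rpow hs
  have hkm : Measurable fun z : ℂ => ‖z‖ ^ (-(M / Real.pi)) := by fun_prop
  have h1 := (locallyIntegrable_integral_comp_sub hk hkm hm).smul M⁻¹
  refine h1.mono ?_ ?_
  · exact (Real.continuous_exp.comp_aestronglyMeasurable
      ((locallyIntegrable_logPotential hm).aestronglyMeasurable.const_mul _))
  -- The kernel `‖z - w‖ ^ (-M/π)` is the exponential of `-(M/π) ln‖z - w‖` only for `w ≠ z`, so
  -- atoms `z` of `m` must be avoided; there are countably many.
  · have hatom : ∀ᵐ z : ℂ, m {z} = 0 := by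
      have hcount : {z : ℂ | 0 < m {z}}.Countable :=
        Measure.countable_meas_pos_of_disjoint_iUnion (fun z => measurableSet_singleton z)
          (fun a b hab => by simpa using hab)
      refine Filter.mem_of_superset (compl_mem_ae_iff.2 (hcount.measure_zero volume)) fun z hz => ?_
      have hz' : ¬ 0 < m {z} := hz
      simpa using hz'
    filter_upwards [ae_integrable_comp_sub hk hkm hm, ae_integrable_comp_sub
      locallyIntegrable_log_norm measurable_log_norm hm, hatom] with z hz1 hz2 hz3
    have hne : ∀ᵐ w ∂m, w ≠ z := compl_mem_ae_iff.2 hz3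
    have hexp : (fun w => ‖z - w‖ ^ (-(M / Real.pi)))
        =ᵐ[m] fun w => Real.exp (-(M / Real.pi) * Real.log ‖z - w‖) := by
      filter_upwards [hne] with w hw
      rw [Real.rpow_def_of_pos (norm_pos_iff.2 (sub_ne_zero.2 hw.symm)), mul_comm]
    -- Jensen's inequality for the probability measure `m / M`: `e^{-2P(z)}` is at most the average
    -- of `‖z - w‖ ^ (-M/π)`, whose exponent satisfies `M/π < 2`. Almost everywhere integrability in
    -- `w` is essential, since a non-integrable function has integral `0` by convention.
    have hJ := convexOn_exp.map_average_le (μ := m) Real.continuous_exp.continuousOn isClosed_univ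
      (Filter.Eventually.of_forall fun _ => mem_univ _) (hz2.const_mul (-(M / Real.pi)))
      (hz1.congr hexp)
    rw [average_eq, average_eq, integral_const_mul] at hJ
    rw [← integral_congr_ae hexp] at hJ
    simp only [smul_eq_mul, ← hM] at hJ
    have h2 : -2 * logPotential m z
        = M⁻¹ * (-(M / Real.pi) * ∫ w, Real.log ‖z - w‖ ∂m) := by
      rw [logPotential]; field_simp
    rw [Real.norm_of_nonneg (Real.exp_pos _).le, h2]
    exact hJ.trans (le_abs_self _)

theorem MagneticField.integral_eq_of_tsupport_subset {ν : MagneticField} {z₀ : ℂ} {U : Set ℂ}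
    (hU : ∀ z ∈ U, ν.intensity z ≠ 0 → z = z₀) {φ : ℂ → ℝ} (hφ : tsupport φ ⊆ U) :
    ν.integral φ = (∫ z, φ z ∂ν.contPos) - (∫ z, φ z ∂ν.contNeg)
      + 2 * Real.pi * (ν.intensity z₀ * φ z₀) := by
  rw [MagneticField.integral, finsum_eq_single _ z₀ fun z hz => ?_]
  by_cases h1 : φ z = 0
  · rw [h1, mul_zero]
  · have h2 : z ∈ U := hφ (subset_tsupport φ h1)
    have h3 : ν.intensity z = 0 := by
      by_contra h
      exact hz (hU z h2 h)
    rw [h3, zero_mul]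

/-- Near `z₀` the field is the difference of two finite measures, the first of mass less
than `2π`. -/
theorem MagneticField.exists_local_decomposition (ν : MagneticField) (z₀ : ℂ)
    (h1 : ν.intensity z₀ < 1) :
    ∃ δ : ℝ, 0 < δ ∧ δ ≤ 1 / 3 ∧ ∃ m m' : Measure ℂ, IsFiniteMeasure m ∧ IsFiniteMeasure m' ∧
      (∀ᵐ w ∂m, w ∈ closedBall z₀ (2 * δ)) ∧ (∀ᵐ w ∂m', w ∈ closedBall z₀ (2 * δ)) ∧
      m.real univ < 2 * Real.pi ∧
      ∀ φ : ℂ → ℝ, ContDiff ℝ ∞ φ → HasCompactSupport φ → tsupport φ ⊆ ball z₀ (2 * δ) →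
        ν.integral φ = (∫ z, φ z ∂m) - ∫ z, φ z ∂m' := by
  have hpi := Real.pi_pos
  have := ν.isLocallyFinite_contPos
  have := ν.isLocallyFinite_contNeg
  have := ν.noAtoms_contPos
  set α := ν.intensity z₀ with hα
  -- The continuous part has no atom at `z₀`, so a small neighbourhood has mass below `2π(1 - max α
  -- 0)`. This leaves room for the solenoid's own positive mass `2π max α 0` within the total `2π`.
  obtain ⟨U, hUs, hUo, hUm⟩ := Set.exists_isOpen_lt_of_lt ({z₀} : Set ℂ) (μ := ν.contPos)
    (ENNReal.ofReal (2 * Real.pi * (1 - max α 0))) (by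
      rw [measure_singleton, ENNReal.ofReal_pos]
      have : max α 0 < 1 := max_lt h1 one_pos
      have : 0 < 1 - max α 0 := by linarith
      positivity)
  obtain ⟨δ₁, hδ₁, hδU⟩ := Metric.isOpen_iff.1 hUo z₀ (hUs rfl)
  obtain ⟨δ₂, hδ₂, hδS⟩ : ∃ δ₂ : ℝ, 0 < δ₂ ∧ ∀ z ∈ ball z₀ δ₂, ν.intensity z ≠ 0 → z = z₀ := by
    have hfin := (ν.finite_solenoids (‖z₀‖ + 1)).subset
      (sdiff_subset : _ \ {z₀} ⊆ {z | ν.intensity z ≠ 0} ∩ closedBall 0 (‖z₀‖ + 1))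
    have hopen := hfin.isClosed.isOpen_compl.mem_nhds
      (show z₀ ∈ _ from fun h => h.2 rfl)
    obtain ⟨δ, hδ, hδs⟩ := Metric.mem_nhds_iff.1 hopen
    refine ⟨min δ 1, lt_min hδ one_pos, fun z hz hne => ?_⟩
    by_contra hzz
    refine hδs (ball_subset_ball (min_le_left _ _) hz) ⟨⟨hne, ?_⟩, hzz⟩
    have hz' := ball_subset_ball (min_le_right δ 1) hz
    rw [mem_ball, dist_eq_norm] at hz'
    rw [mem_closedBall_zero_iff]
    linarith [norm_le_norm_add_norm_sub' z z₀]
  set δ := min (min (δ₁ / 2) (δ₂ / 2)) (1 / 3) with hδ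
  have hδ1 : 2 * δ ≤ δ₁ := by
    have : δ ≤ δ₁ / 2 := (min_le_left _ _).trans (min_le_left _ _)
    linarith
  have hδ2 : 2 * δ ≤ δ₂ := by
    have : δ ≤ δ₂ / 2 := (min_le_left _ _).trans (min_le_right _ _)
    linarith
  have hδ0 : 0 < δ := by positivity
  set B := ball z₀ (2 * δ) with hB
  have hz₀B : z₀ ∈ B := mem_ball_self (by positivity)
  have hBm : MeasurableSet B := isOpen_ball.measurableSet
  have hBf : ν.contPos B < ENNReal.ofReal (2 * Real.pi * (1 - max α 0)) :=
    (measure_mono ((ball_subset_ball hδ1).trans hδU)).trans_lt hUm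
  have hBf' : ν.contNeg B ≠ ⊤ :=
    ((measure_mono ball_subset_closedBall).trans_lt
      (isCompact_closedBall z₀ (2 * δ)).measure_lt_top).ne
  have hfin : IsFiniteMeasure (ν.contPos.restrict B) := isFiniteMeasure_restrict.2 hBf.ne_top
  have hfin' : IsFiniteMeasure (ν.contNeg.restrict B) := isFiniteMeasure_restrict.2 hBf'
  have hmem (κ : Measure ℂ) (c : ℝ) :
      ∀ᵐ w ∂(κ.restrict B + ENNReal.ofReal c • Measure.dirac z₀), w ∈ closedBall z₀ (2 * δ) := by
    rw [ae_add_measure_iff]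
    refine ⟨(ae_restrict_mem hBm).mono fun w hw => ball_subset_closedBall hw,
      Measure.ae_smul_measure ?_ _⟩
    rw [ae_dirac_eq]
    exact ball_subset_closedBall hz₀B
  have hfs (c : ℝ) : IsFiniteMeasure (ENNReal.ofReal c • Measure.dirac z₀) :=
    ⟨by simp⟩
  have hint (κ : Measure ℂ) (hκ : IsFiniteMeasure (κ.restrict B)) (c : ℝ) (hc : 0 ≤ c) (φ : ℂ → ℝ)
      (hφ : Continuous φ) (hφc : HasCompactSupport φ) (hφB : tsupport φ ⊆ B) :
      ∫ z, φ z ∂(κ.restrict B + ENNReal.ofReal c • Measure.dirac z₀)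
        = (∫ z, φ z ∂κ) + c * φ z₀ := by
    have := hfs c
    rw [integral_add_measure (hφ.integrable_of_hasCompactSupport hφc)
      (hφ.integrable_of_hasCompactSupport hφc), integral_smul_measure, integral_dirac,
      setIntegral_eq_integral_of_forall_compl_eq_zero fun z hz =>
        image_eq_zero_of_notMem_tsupport fun h => hz (hφB h), ENNReal.toReal_ofReal hc, smul_eq_mul]
  refine ⟨δ, hδ0, min_le_right _ _,
    ν.contPos.restrict B + ENNReal.ofReal (2 * Real.pi * max α 0) • Measure.dirac z₀,
    ν.contNeg.restrict B + ENNReal.ofReal (2 * Real.pi * max (-α) 0) • Measure.dirac z₀,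
    by have := hfs (2 * Real.pi * max α 0); infer_instance,
    by have := hfs (2 * Real.pi * max (-α) 0); infer_instance,
    hmem _ _, hmem _ _, ?_, fun φ hφ hφc hφB => ?_⟩
  · have h2 : (ν.contPos B).toReal < 2 * Real.pi * (1 - max α 0) :=
      ENNReal.toReal_lt_of_lt_ofReal hBf
    rw [measureReal_def, Measure.add_apply, Measure.restrict_apply_univ, Measure.smul_apply,
      measure_univ, smul_eq_mul, mul_one, ENNReal.toReal_add hBf.ne_top ENNReal.ofReal_ne_top,
      ENNReal.toReal_ofReal (by positivity)]
    linarith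
  · rw [ν.integral_eq_of_tsupport_subset
      (fun z hz => hδS z (ball_subset_ball hδ2 hz)) hφB,
      hint _ hfin _ (by positivity) φ hφ.continuous hφc hφB,
      hint _ hfin' _ (by positivity) φ hφ.continuous hφc hφB]
    have : α = max α 0 - max (-α) 0 := by
      rcases le_total α 0 with h | h <;> simp [h]
    rw [← hα]
    nth_rewrite 1 [this]
    ring

/-- If all intensities are less than `1`, then `e^{-2V}` is locally integrable. -/
theorem IsPotential.locallyIntegrable_exp {ν : MagneticField} {V : ℂ → ℝ} (hV : IsPotential ν V)
    (h1 : ∀ z, ν.intensity z < 1) : LocallyIntegrable fun z => Real.exp (-2 * V z) := by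
  intro z₀
  obtain ⟨δ, hδ0, hδ3, m, m', hf, hf', hm, hm', hmass, hint⟩ :=
    ν.exists_local_decomposition z₀ (h1 z₀)
  have hP := locallyIntegrable_logPotential hm
  have hP' := locallyIntegrable_logPotential hm'
  -- Locally `V` is the difference of the two potentials up to a weakly harmonic remainder, which by
  -- Weyl's lemma is a.e. equal to a bounded function on the smaller disc.
  set h : ℂ → ℝ := V - logPotential m + logPotential m' with hh
  have hV1 : LocallyIntegrable V := hV.1
  have hloc : LocallyIntegrable h := (hV1.sub hP).add hP'
  have hw : WeaklyHarmonicOn h (ball z₀ (2 * δ)) := by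
    intro φ hφ hc hs
    have hΔ : Continuous (Laplacian.laplacian φ) := continuous_laplacian (contDiff_infty.1 hφ 2)
    have hΔc := hasCompactSupport_laplacian hc
    have i1 : Integrable (fun z => V z * Laplacian.laplacian φ z) :=
      integrable_mul_of_hasCompactSupport hV1 hΔ hΔc
    have i2 : Integrable (fun z => logPotential m z * Laplacian.laplacian φ z) :=
      integrable_mul_of_hasCompactSupport hP hΔ hΔc
    have i3 : Integrable (fun z => logPotential m' z * Laplacian.laplacian φ z) :=
      integrable_mul_of_hasCompactSupport hP' hΔ hΔc
    have e : ∫ z, h z * Laplacian.laplacian φ z = ∫ z, ((V z * Laplacian.laplacian φ z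
        - logPotential m z * Laplacian.laplacian φ z)
        + logPotential m' z * Laplacian.laplacian φ z) := by
      congr 1; ext z
      simp only [hh, Pi.add_apply, Pi.sub_apply]; ring
    have e1 := integral_sub i1 i2
    have e2 := integral_add (i1.sub i2) i3
    simp only [Pi.sub_apply] at e2
    rw [e, e2, e1,
      hV.2 φ hφ hc, integral_logPotential_mul_laplacian hm hφ hc,
      integral_logPotential_mul_laplacian hm' hφ hc, hint φ hφ hc hs]
    ring
  have hε : 0 < δ / 2 := by positivity
  have hae := hw.ae_eq_mollify hloc hε
  rw [show 2 * δ - 2 * (δ / 2) = δ by ring] at hae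
  have hH : Continuous (mollify h (radialBump (δ / 2))) :=
    (contDiff_mollify hloc (contDiff_radialBump _) (hasCompactSupport_radialBump hε)).continuous
  obtain ⟨C, hC⟩ := (isCompact_closedBall z₀ δ).exists_bound_of_continuousOn hH.continuousOn
  refine ⟨ball z₀ δ, ball_mem_nhds z₀ hδ0, ?_⟩
  have h2 : IntegrableOn (fun z => Real.exp (2 * C) * Real.exp (-2 * logPotential m z))
      (ball z₀ δ) :=
    (((locallyIntegrable_exp_logPotential hm hmass).integrableOn_isCompact
      (isCompact_closedBall z₀ δ)).mono_set ball_subset_closedBall).const_mul _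
  refine Integrable.mono' h2 (Real.continuous_exp.comp_aestronglyMeasurable
      (hV.1.aestronglyMeasurable.const_mul _)).restrict ?_
  rw [ae_restrict_iff' isOpen_ball.measurableSet]
  filter_upwards [hae] with z hz hzb
  rw [Real.norm_of_nonneg (Real.exp_pos _).le, ← Real.exp_add, Real.exp_le_exp]
  have h3 := hz hzb
  simp only [hh, Pi.add_apply, Pi.sub_apply] at h3
  have h4 := hC z (ball_subset_closedBall hzb)
  rw [Real.norm_eq_abs, ← h3] at h4
  -- The bound `δ ≤ 1/3` is used here: `|z - w| ≤ δ + 2δ ≤ 1`, so the logarithms are nonpositive and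
  -- the negative part of the field can only help.
  have h5 : logPotential m' z ≤ 0 := by
    refine mul_nonpos_of_nonneg_of_nonpos (by positivity) (integral_nonpos_of_ae ?_)
    filter_upwards [hm'] with w hw
    refine Real.log_nonpos (norm_nonneg _) ?_
    rw [← dist_eq_norm]
    rw [mem_ball] at hzb
    rw [mem_closedBall] at hw
    linarith [dist_triangle_right z w z₀]
  linarith [neg_abs_le (V z - logPotential m z + logPotential m' z)]

/-! ### Sums over separated sets and estimates of a single shift term. -/

/-- The points of `D` have mutual distances at least `2c`. -/
def IsSeparated (D : Set ℂ) (c : ℝ) : Prop := ∀ x ∈ D, ∀ y ∈ D, x ≠ y → 2 * c ≤ dist x y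

/-- The discs of radius `c` about the points are disjoint, so the sum compares with an integral over
their union. -/
theorem IsSeparated.sum_mul_le_integral {D : Set ℂ} {c : ℝ} (h : IsSeparated D c) {f : ℂ → ℝ}
    {G : ℂ → ℝ} (hG : Integrable G) (hG0 : ∀ z, 0 ≤ G z)
    (hfG : ∀ l ∈ D, ∀ w ∈ ball l c, f l ≤ G w) (s : Finset D) :
    (∑ l ∈ s, f l) * volume.real (ball (0 : ℂ) c) ≤ ∫ z, G z := by
  have h1 (l : D) : f l * volume.real (ball (0 : ℂ) c) ≤ ∫ z in ball (l : ℂ) c, G z := by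
    have h2 : volume.real (ball (l : ℂ) c) = volume.real (ball (0 : ℂ) c) := by
      simp only [measureReal_def, Measure.addHaar_ball_center]
    have h3 : f l * volume.real (ball (l : ℂ) c) = ∫ _ in ball (l : ℂ) c, f l := by
      rw [setIntegral_const, smul_eq_mul, mul_comm]
    rw [← h2, h3]
    exact setIntegral_mono_on (integrableOn_const measure_ball_lt_top.ne) hG.integrableOn
      isOpen_ball.measurableSet fun w hw => hfG l l.2 w hw
  rw [Finset.sum_mul]
  refine (Finset.sum_le_sum fun l _ => h1 l).trans ?_
  rw [← integral_biUnion_finset s (fun l _ => isOpen_ball.measurableSet) ?_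
    (fun l _ => hG.integrableOn)]
  · exact setIntegral_le_integral hG (Filter.Eventually.of_forall hG0)
  · intro x _ y _ hxy
    refine ball_disjoint_ball ?_
    have := h x x.2 y y.2 fun he => hxy (Subtype.ext he)
    linarith

/-- The bound is uniform in `z` because the comparison integral is translation invariant. The factor
`(1 + c)^p` pays for replacing `l` by a point `w` of its disc. -/
theorem IsSeparated.exists_tsum_le {D : Set ℂ} {c : ℝ} (hc : 0 < c) (h : IsSeparated D c) {p : ℝ}
    (hp : 2 < p) : ∃ S : ℝ, 0 ≤ S ∧ ∀ z : ℂ, Summable (fun l : D => (1 + ‖z - l‖) ^ (-p)) ∧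
      ∑' l : D, (1 + ‖z - l‖) ^ (-p) ≤ S := by
  have hint : Integrable fun w : ℂ => (1 + ‖w‖) ^ (-p) :=
    integrable_one_add_norm (by rw [Complex.finrank_real_complex]; exact_mod_cast hp)
  have hv : 0 < volume.real (ball (0 : ℂ) c) :=
    ENNReal.toReal_pos (measure_ball_pos _ _ hc).ne' measure_ball_lt_top.ne
  refine ⟨(1 + c) ^ p * (∫ w : ℂ, (1 + ‖w‖) ^ (-p)) / volume.real (ball (0 : ℂ) c), ?_, ?_⟩
  · have : 0 ≤ ∫ w : ℂ, (1 + ‖w‖) ^ (-p) := integral_nonneg fun w => by positivity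
    positivity
  intro z
  have h0 (l : D) : 0 ≤ (1 + ‖z - l‖) ^ (-p) := by positivity
  have key (s : Finset D) : ∑ l ∈ s, (1 + ‖z - l‖) ^ (-p)
      ≤ (1 + c) ^ p * (∫ w : ℂ, (1 + ‖w‖) ^ (-p)) / volume.real (ball (0 : ℂ) c) := by
    rw [le_div_iff₀ hv]
    have h1 := h.sum_mul_le_integral (f := fun l => (1 + ‖z - l‖) ^ (-p))
      (G := fun w => (1 + c) ^ p * (1 + ‖z - w‖) ^ (-p))
      ((hint.comp_sub_left z).const_mul _) (fun w => by positivity) (fun l _ w hw => ?_) s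
    · refine h1.trans (le_of_eq ?_)
      rw [integral_const_mul, integral_sub_left_eq_self (fun w : ℂ => (1 + ‖w‖) ^ (-p))]
    · rw [Real.rpow_neg (by positivity), Real.rpow_neg (by positivity), ← div_eq_mul_inv,
        ← Real.div_rpow (by positivity) (by positivity), ← Real.inv_rpow (by positivity)]
      refine Real.rpow_le_rpow (by positivity) ?_ (by linarith)
      rw [inv_eq_one_div, div_le_div_iff₀ (by positivity) (by positivity), one_mul]
      have h2 : ‖l - w‖ < c := by rw [← dist_eq_norm, dist_comm]; exact hw
      have h3 : ‖z - w‖ ≤ ‖z - l‖ + ‖l - w‖ := norm_sub_le_norm_sub_add_norm_sub z l w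
      nlinarith [norm_nonneg (z - l)]
  have hs := summable_of_sum_le h0 key
  exact ⟨hs, hs.tsum_le_of_sum_le key⟩

/-- Mean value inequality for `log(1 - w) + w`: its derivative `-w/(1 - w)` vanishes at `0`, hence
the extra factor `s`. -/
theorem abs_log_one_sub_add_re_sub_le {s : ℝ} (hs : s ≤ 1 / 2) {u v : ℂ} (hu : ‖u‖ ≤ s)
    (hv : ‖v‖ ≤ s) :
    |(Real.log ‖1 - u‖ + u.re) - (Real.log ‖1 - v‖ + v.re)| ≤ 2 * s * ‖u - v‖ := by
  have hs0 : 0 ≤ s := (norm_nonneg u).trans hu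
  have hder (w : ℂ) (hw : w ∈ closedBall (0 : ℂ) s) :
      HasDerivWithinAt (fun w : ℂ => Complex.log (1 - w) + w) (-1 / (1 - w) + 1)
        (closedBall 0 s) w := by
    rw [mem_closedBall_zero_iff] at hw
    have hre : 0 < (1 - w).re := by
      have := Complex.re_le_norm w
      simp; linarith
    have h1 : HasDerivAt (fun w : ℂ => 1 - w) (-1) w := by
      simpa using (hasDerivAt_id w).const_sub 1
    exact ((h1.clog (Or.inl hre)).add (hasDerivAt_id w)).hasDerivWithinAt
  have hbd (w : ℂ) (hw : w ∈ closedBall (0 : ℂ) s) : ‖-1 / (1 - w) + 1‖ ≤ 2 * s := by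
    rw [mem_closedBall_zero_iff] at hw
    have h1 : 1 / 2 ≤ ‖1 - w‖ := by
      have := norm_sub_norm_le (1 : ℂ) w
      rw [norm_one] at this; linarith
    have hne : (1 - w) ≠ 0 := by
      intro h; rw [h, norm_zero] at h1; linarith
    have h2 : -1 / (1 - w) + 1 = -w / (1 - w) := by field_simp; ring
    rw [h2, norm_div, norm_neg, div_le_iff₀ (by linarith)]
    nlinarith
  have := (convex_closedBall (0 : ℂ) s).norm_image_sub_le_of_norm_hasDerivWithin_le hder hbd
    (mem_closedBall_zero_iff.2 hv) (mem_closedBall_zero_iff.2 hu)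
  refine le_trans ?_ this
  refine le_trans (le_of_eq ?_) (Complex.abs_re_le_norm _)
  simp [Complex.log_re]

theorem abs_log_sub_log_le {x y m : ℝ} (hm : 0 < m) (hx : m ≤ x) (hy : m ≤ y) :
    |Real.log x - Real.log y| ≤ |x - y| / m := by
  have key {x y : ℝ} (hx : m ≤ x) (hy : m ≤ y) : Real.log x - Real.log y ≤ |x - y| / m := by
    have hx0 := hm.trans_le hx
    have hy0 := hm.trans_le hy
    rw [← Real.log_div hx0.ne' hy0.ne']
    refine (Real.log_le_sub_one_of_pos (by positivity)).trans ?_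
    rw [div_sub_one hy0.ne', div_le_div_iff₀ hy0 hm]
    nlinarith [le_abs_self (x - y), abs_nonneg (x - y)]
  rw [abs_le]
  constructor
  · have := key hy hx
    rw [abs_sub_comm] at this; linarith
  · exact key hx hy

/-- `Φ` moves the points of `Λ` by at most `A (1 + |l|) ^ t`, which is at most `|l| / 2` for
`|l| ≥ R₀`. -/
structure IsShift (Λ : Set ℂ) (Φ : ℂ → ℂ) (A t R₀ : ℝ) : Prop where
  t_pos : 0 < t
  t_lt : t < 1
  one_le_A : 1 ≤ A
  one_le_R : 1 ≤ R₀
  dist_le : ∀ l ∈ Λ, ‖Φ l - l‖ ≤ A * (1 + ‖l‖) ^ t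
  half : ∀ x, R₀ ≤ x → A * (1 + x) ^ t ≤ x / 2

/-- The affine correction added to `ln |z - Φ l| - ln |z - l|`. -/
def shiftCorrection (Φ : ℂ → ℂ) (R₀ : ℝ) (l z : ℂ) : ℝ :=
  if R₀ ≤ ‖l‖ then Real.log ‖l‖ - Real.log ‖Φ l‖ + (z * ((Φ l)⁻¹ - l⁻¹)).re else 0

/-- The term of the perturbed potential that belongs to `l`. -/
def shiftTerm (Φ : ℂ → ℂ) (R₀ : ℝ) (l z : ℂ) : ℝ :=
  Real.log ‖z - Φ l‖ - Real.log ‖z - l‖ + shiftCorrection Φ R₀ l z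

/-- The logarithm truncated near zero. -/
def truncLog (c x : ℝ) : ℝ := Real.log (max x c)

/-- The term of the perturbed potential that belongs to `l`, with truncated logarithms. -/
def truncShiftTerm (Φ : ℂ → ℂ) (R₀ c : ℝ) (l z : ℂ) : ℝ :=
  truncLog c ‖z - Φ l‖ - truncLog c ‖z - l‖ + shiftCorrection Φ R₀ l z

namespace IsShift

variable {Λ : Set ℂ} {Φ : ℂ → ℂ} {A t R₀ : ℝ}

theorem dist_le_half (h : IsShift Λ Φ A t R₀) {l : ℂ} (hl : l ∈ Λ) (hR : R₀ ≤ ‖l‖) :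
    ‖Φ l - l‖ ≤ ‖l‖ / 2 := (h.dist_le l hl).trans (h.half _ hR)

theorem half_le_norm (h : IsShift Λ Φ A t R₀) {l : ℂ} (hl : l ∈ Λ) (hR : R₀ ≤ ‖l‖) :
    ‖l‖ / 2 ≤ ‖Φ l‖ := by
  have h1 := h.dist_le_half hl hR
  have h2 := norm_sub_norm_le l (Φ l)
  rw [norm_sub_rev] at h2
  linarith

theorem norm_inv_sub_inv_le (h : IsShift Λ Φ A t R₀) {l : ℂ} (hl : l ∈ Λ) (hR : R₀ ≤ ‖l‖) :
    ‖(Φ l)⁻¹ - l⁻¹‖ ≤ 8 * A * (1 + ‖l‖) ^ (t - 2) := by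
  have hl1 : 1 ≤ ‖l‖ := h.one_le_R.trans hR
  have h1 := h.half_le_norm hl hR
  have hl0 : l ≠ 0 := norm_pos_iff.1 (by linarith)
  have hΦ0 : Φ l ≠ 0 := norm_pos_iff.1 (by linarith)
  rw [inv_sub_inv hΦ0 hl0, norm_div, norm_mul, norm_sub_rev, Real.rpow_sub (by linarith)]
  have h2 : ‖Φ l - l‖ / (‖Φ l‖ * ‖l‖) ≤ A * (1 + ‖l‖) ^ t / ((1 + ‖l‖) ^ 2 / 8) := by
    have hA := h.one_le_A
    -- From `‖Φ l‖ ≥ ‖l‖ / 2` and `‖l‖ ≥ (1 + ‖l‖) / 2`.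
    have : (1 + ‖l‖) ^ 2 / 8 ≤ ‖Φ l‖ * ‖l‖ := by nlinarith
    gcongr
    exact h.dist_le l hl
  refine h2.trans (le_of_eq ?_)
  rw [show (2 : ℝ) = ((2 : ℕ) : ℝ) by norm_num, Real.rpow_natCast]
  field_simp

/-- The affine correction is chosen so that the term equals `f(z/Φ l) - f(z/l)` with `f(w) = ln|1 -
w| + Re w`. The Lipschitz constant of `f` is `O(|z|/|l|)` there, and the arguments differ by `O(|z|
|l|^{t-2})`. -/
theorem abs_shiftTerm_le (h : IsShift Λ Φ A t R₀) {l z : ℂ} (hl : l ∈ Λ) (hR : R₀ ≤ ‖l‖)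
    (hz : 4 * (1 + ‖z‖) ≤ ‖l‖) :
    |shiftTerm Φ R₀ l z| ≤ 64 * A * (1 + ‖z‖) ^ 2 * (1 + ‖l‖) ^ (t - 3) := by
  have hl1 : 1 ≤ ‖l‖ := h.one_le_R.trans hR
  have h1 := h.half_le_norm hl hR
  have hl0 : l ≠ 0 := norm_pos_iff.1 (by linarith)
  have hΦ0 : Φ l ≠ 0 := norm_pos_iff.1 (by linarith)
  have hnl : 0 < ‖l‖ := by linarith
  have hnΦ : 0 < ‖Φ l‖ := by linarith
  have hlog {w : ℂ} (hw : w ≠ 0) (hzw : ‖z‖ < ‖w‖) :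
      Real.log ‖1 - z * w⁻¹‖ = Real.log ‖z - w‖ - Real.log ‖w‖ := by
    have hne : z - w ≠ 0 := by
      intro h0
      rw [sub_eq_zero.1 h0] at hzw
      exact lt_irrefl _ hzw
    rw [← Real.log_div (norm_ne_zero_iff.2 hne) (norm_ne_zero_iff.2 hw), ← norm_div,
      ← norm_neg]
    congr 2
    field_simp
    ring
  set s := 2 * ‖z‖ / ‖l‖ with hs
  have hs2 : s ≤ 1 / 2 := by
    rw [hs, div_le_iff₀ hnl]; linarith
  have hu : ‖z * (Φ l)⁻¹‖ ≤ s := by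
    rw [norm_mul, norm_inv, ← div_eq_mul_inv, hs, div_le_div_iff₀ hnΦ hnl]
    nlinarith [norm_nonneg z]
  have hv : ‖z * l⁻¹‖ ≤ s := by
    rw [norm_mul, norm_inv, ← div_eq_mul_inv, hs]
    gcongr; linarith [norm_nonneg z]
  have h2 := abs_log_one_sub_add_re_sub_le hs2 hu hv
  rw [hlog hΦ0 (by linarith [norm_nonneg z]), hlog hl0 (by linarith [norm_nonneg z]),
    ← mul_sub, norm_mul] at h2
  have h3 : shiftTerm Φ R₀ l z = Real.log ‖z - Φ l‖ - Real.log ‖Φ l‖ + (z * (Φ l)⁻¹).re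
      - (Real.log ‖z - l‖ - Real.log ‖l‖ + (z * l⁻¹).re) := by
    rw [shiftTerm, shiftCorrection, if_pos hR, mul_sub, Complex.sub_re]; ring
  rw [h3]
  refine h2.trans ?_
  have h4 := h.norm_inv_sub_inv_le hl hR
  have hA := h.one_le_A
  have h5 : s ≤ 4 * (1 + ‖z‖) / (1 + ‖l‖) := by
    rw [hs, div_le_div_iff₀ hnl (by linarith)]
    nlinarith [norm_nonneg z]
  calc 2 * s * (‖z‖ * ‖(Φ l)⁻¹ - l⁻¹‖)
      ≤ 2 * (4 * (1 + ‖z‖) / (1 + ‖l‖)) * ((1 + ‖z‖) * (8 * A * (1 + ‖l‖) ^ (t - 2))) := by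
        gcongr
        linarith
    _ = 64 * A * (1 + ‖z‖) ^ 2 * (1 + ‖l‖) ^ (t - 3) := by
        rw [show t - 3 = (t - 2) - 1 by ring, Real.rpow_sub_one (by positivity)]
        field_simp; ring

end IsShift

theorem truncLog_of_le {c x : ℝ} (h : c ≤ x) : truncLog c x = Real.log x := by
  rw [truncLog, max_eq_left h]

theorem abs_truncLog_le_rpow {c κ B x : ℝ} (hc : 0 < c) (hκ : 0 < κ) (hB : 1 ≤ B) (hcB : c ≤ B)
    (hx : x ≤ B) : |truncLog c x| ≤ (1 / κ + 1 / c) * B ^ κ := by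
  have hv : c ≤ max x c := le_max_right _ _
  have hv0 : 0 < max x c := hc.trans_le hv
  have hvB : max x c ≤ B := max_le hx hcB
  have hBκ : 1 ≤ B ^ κ := Real.one_le_rpow hB hκ.le
  have h1 : Real.log (max x c) ≤ B ^ κ / κ :=
    (Real.log_le_rpow_div hv0.le hκ).trans (by gcongr)
  have h2 : -Real.log (max x c) ≤ 1 / c := by
    rw [← Real.log_inv]
    refine (Real.log_le_sub_one_of_pos (inv_pos.2 hv0)).trans ?_
    have : (max x c)⁻¹ ≤ 1 / c := by
      rw [inv_eq_one_div]; gcongr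
    linarith
  have h3 : 0 < 1 / c := by positivity
  have h4 : 0 < B ^ κ / κ := by positivity
  have h5 : (1 / κ + 1 / c) * B ^ κ = B ^ κ / κ + 1 / c * B ^ κ := by ring
  rw [truncLog, abs_le, h5]
  constructor <;> nlinarith

/-- With `x = |z - l|`, `y = |z - Φ l|` and `Z = 1 + |z|`, this handles points that are not far away
compared with `z`. The exponent `2 + (1 - t)/4` makes the sum over `l` converge; the exponent of `Z`
is `1 + t` plus the same `(1 - t)/4`, still below `2`. -/
theorem exists_abs_truncLog_sub_le {c A t : ℝ} (hc : 0 < c) (hc1 : c ≤ 1) (hA : 1 ≤ A)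
    (ht0 : 0 < t) (ht1 : t < 1) :
    ∃ C : ℝ, 0 ≤ C ∧ ∀ x y Z : ℝ, 0 ≤ x → 1 ≤ Z → |x - y| ≤ 5 * A * Z ^ t →
      1 + x ≤ 5 * Z → |truncLog c x - truncLog c y|
        ≤ C * Z ^ (2 - 3 * (1 - t) / 4) * (1 + x) ^ (-(2 + (1 - t) / 4)) := by
  set p := 2 + (1 - t) / 4 with hp
  set q := 2 - 3 * (1 - t) / 4 with hq
  set κ := (1 - t) / 4 with hκ
  have hκ0 : 0 < κ := by rw [hκ]; linarith
  refine ⟨20 * A * 5 ^ (p - 1) + 2 * (1 / κ + 1 / c) * (15 * A) ^ (κ + p), by positivity,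
    fun x y Z hx hZ hxy hxZ => ?_⟩
  set E := 5 * A * Z ^ t with hE
  have hZt : 1 ≤ Z ^ t := Real.one_le_rpow hZ ht0.le
  have hE5 : 5 ≤ E := by rw [hE]; nlinarith
  have hZ0 : 0 < Z := by linarith
  have hxp : 0 < (1 + x) ^ (-p) := by positivity
  have hZq : 0 < Z ^ q := by positivity
  have hxyl := abs_le.1 hxy
  -- `E` bounds the displacement. Beyond `2E` the logarithms differ by at most a multiple of `E /
  -- x`. Within `2E` each is at most a multiple of `E^κ`, and the decaying factor costs at most
  -- `(3E)^p`; this is affordable since `t(κ + p) ≤ q`.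
  rcases le_or_gt (2 * E) x with h | h
  · rw [truncLog_of_le (by linarith), truncLog_of_le (by linarith)]
    have h1 : |Real.log x - Real.log y| ≤ |x - y| / (x / 2) :=
      abs_log_sub_log_le (by linarith) (by linarith) (by linarith)
    have h2 : |x - y| / (x / 2) ≤ 4 * E / (1 + x) := by
      rw [div_le_div_iff₀ (by linarith) (by linarith)]
      nlinarith [abs_nonneg (x - y)]
    have h3 : 4 * E / (1 + x) = 4 * E * (1 + x) ^ (p - 1) * (1 + x) ^ (-p) := by
      rw [mul_assoc, ← Real.rpow_add (by linarith), show p - 1 + -p = -1 by ring, Real.rpow_neg_one]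
      rfl
    have h4 : (1 + x) ^ (p - 1) ≤ 5 ^ (p - 1) * Z ^ (p - 1) := by
      rw [← Real.mul_rpow (by norm_num) hZ0.le]
      exact Real.rpow_le_rpow (by linarith) hxZ (by rw [hp]; linarith)
    calc |Real.log x - Real.log y| ≤ 4 * E * (1 + x) ^ (p - 1) * (1 + x) ^ (-p) := by
          rw [← h3]; exact h1.trans h2
      _ ≤ 4 * E * (5 ^ (p - 1) * Z ^ (p - 1)) * (1 + x) ^ (-p) := by gcongr
      _ = 20 * A * 5 ^ (p - 1) * Z ^ q * (1 + x) ^ (-p) := by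
          rw [show q = t + (p - 1) by rw [hq, hp]; ring, Real.rpow_add hZ0, hE]; ring
      _ ≤ _ := by
          gcongr
          have : 0 ≤ 2 * (1 / κ + 1 / c) * (15 * A) ^ (κ + p) := by positivity
          linarith
  · have hx' := abs_truncLog_le_rpow (B := 3 * E) (x := x) hc hκ0 (by linarith) (by linarith)
      (by linarith)
    have hy' := abs_truncLog_le_rpow (B := 3 * E) (x := y) hc hκ0 (by linarith) (by linarith)
      (by linarith)
    have h1 : 1 ≤ (3 * E) ^ p * (1 + x) ^ (-p) := by
      rw [Real.rpow_neg (by linarith), ← div_eq_mul_inv, one_le_div (by positivity)]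
      exact Real.rpow_le_rpow (by linarith) (by linarith) (by rw [hp]; linarith)
    have h2 : (3 * E) ^ (κ + p) ≤ (15 * A) ^ (κ + p) * Z ^ q := by
      rw [show 3 * E = (15 * A) * Z ^ t by rw [hE]; ring,
        Real.mul_rpow (by positivity) (by positivity), ← Real.rpow_mul hZ0.le]
      gcongr
      rw [hp, hq, hκ]; nlinarith
    calc |truncLog c x - truncLog c y| ≤ |truncLog c x| + |truncLog c y| := abs_sub _ _
      _ ≤ 2 * (1 / κ + 1 / c) * (3 * E) ^ κ := by linarith
      _ ≤ 2 * (1 / κ + 1 / c) * (3 * E) ^ κ * ((3 * E) ^ p * (1 + x) ^ (-p)) :=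
          le_mul_of_one_le_right (by positivity) h1
      _ = 2 * (1 / κ + 1 / c) * (3 * E) ^ (κ + p) * (1 + x) ^ (-p) := by
          have h6 := Real.rpow_add (by linarith : 0 < 3 * E) κ p
          clear_value p q κ E
          rw [h6]; ring
      _ ≤ 2 * (1 / κ + 1 / c) * ((15 * A) ^ (κ + p) * Z ^ q) * (1 + x) ^ (-p) := by gcongr
      _ = 2 * (1 / κ + 1 / c) * (15 * A) ^ (κ + p) * Z ^ q * (1 + x) ^ (-p) := by ring
      _ ≤ _ := by
          gcongr
          have : 0 ≤ 20 * A * 5 ^ (p - 1) := by positivity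
          linarith

namespace IsShift

variable {Λ : Set ℂ} {Φ : ℂ → ℂ} {A t R₀ : ℝ}

theorem abs_shiftCorrection_le (h : IsShift Λ Φ A t R₀) {l z : ℂ} (hl : l ∈ Λ)
    (hz : 1 + ‖l‖ ≤ 5 * (1 + ‖z‖)) :
    |shiftCorrection Φ R₀ l z| ≤ 200 * A * (1 + ‖z‖) ^ (2 - 3 * (1 - t) / 4)
      * (1 + ‖l‖) ^ (-(2 + (1 - t) / 4)) := by
  have hA := h.one_le_A
  have ht0 := h.t_pos
  have ht1 := h.t_lt
  set p := 2 + (1 - t) / 4 with hp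
  set q := 2 - 3 * (1 - t) / 4 with hq
  set Z := 1 + ‖z‖ with hZ
  set L := 1 + ‖l‖ with hL
  have hZ0 : 1 ≤ Z := by rw [hZ]; linarith [norm_nonneg z]
  have hL0 : 1 ≤ L := by rw [hL]; linarith [norm_nonneg l]
  by_cases hR : R₀ ≤ ‖l‖
  · have hl1 : 1 ≤ ‖l‖ := h.one_le_R.trans hR
    have h1 : |Real.log ‖l‖ - Real.log ‖Φ l‖| ≤ 4 * A * L ^ (t - 1) := by
      refine (abs_log_sub_log_le (m := ‖l‖ / 2) (by linarith) (by linarith)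
        (h.half_le_norm hl hR)).trans ?_
      have h2 : |‖l‖ - ‖Φ l‖| ≤ A * L ^ t :=
        (abs_norm_sub_norm_le _ _).trans (by rw [norm_sub_rev]; exact h.dist_le l hl)
      rw [Real.rpow_sub_one (by positivity), div_le_iff₀ (by linarith)]
      refine h2.trans ?_
      have h3 : 4 * A * (L ^ t / L) * (‖l‖ / 2) = A * L ^ t * (2 * ‖l‖ / L) := by
        field_simp; ring
      rw [h3]
      refine le_mul_of_one_le_right (by positivity) ?_
      rw [one_le_div (by positivity)]; linarith
    have h4 : |(z * ((Φ l)⁻¹ - l⁻¹)).re| ≤ Z * (8 * A * L ^ (t - 2)) := by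
      refine (Complex.abs_re_le_norm _).trans ?_
      rw [norm_mul]
      gcongr
      · rw [hZ]; linarith
      · exact h.norm_inv_sub_inv_le hl hR
    -- The exponents satisfy `q - p = t - 1`; the surplus `L^q` is traded for `Z^q` using `L ≤ 5Z`.
    have h5 : L ^ (t - 1) ≤ 25 * Z ^ q * L ^ (-p) := by
      rw [show t - 1 = q + -p by rw [hq, hp]; ring, Real.rpow_add (by positivity)]
      gcongr
      calc L ^ q ≤ (5 * Z) ^ q := Real.rpow_le_rpow (by linarith) hz (by rw [hq]; linarith)
        _ = 5 ^ q * Z ^ q := Real.mul_rpow (by norm_num) (by linarith)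
        _ ≤ 5 ^ (2 : ℝ) * Z ^ q := by
          gcongr
          · norm_num
          · rw [hq]; linarith
        _ = 25 * Z ^ q := by norm_num
    have h6 : L ^ (t - 2) ≤ 5 * Z ^ (q - 1) * L ^ (-p) := by
      rw [show t - 2 = (q - 1) + -p by rw [hq, hp]; ring, Real.rpow_add (by positivity)]
      gcongr
      calc L ^ (q - 1) ≤ (5 * Z) ^ (q - 1) :=
            Real.rpow_le_rpow (by linarith) hz (by rw [hq]; linarith)
        _ = 5 ^ (q - 1) * Z ^ (q - 1) := Real.mul_rpow (by norm_num) (by linarith)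
        _ ≤ 5 ^ (1 : ℝ) * Z ^ (q - 1) := by
          gcongr
          · norm_num
          · rw [hq]; linarith
        _ = 5 * Z ^ (q - 1) := by norm_num
    have h7 : Z * Z ^ (q - 1) = Z ^ q := by
      rw [Real.rpow_sub_one (by positivity)]; field_simp
    rw [shiftCorrection, if_pos hR]
    calc _ ≤ |Real.log ‖l‖ - Real.log ‖Φ l‖| + |(z * ((Φ l)⁻¹ - l⁻¹)).re| := abs_add_le _ _
      _ ≤ 4 * A * (25 * Z ^ q * L ^ (-p)) + Z * (8 * A * (5 * Z ^ (q - 1) * L ^ (-p))) := by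
        refine add_le_add (h1.trans (by gcongr)) (h4.trans (by gcongr))
      _ = 140 * A * Z ^ q * L ^ (-p) := by rw [← h7]; ring
      _ ≤ _ := by gcongr; norm_num
  · rw [shiftCorrection, if_neg hR, abs_zero]
    positivity

theorem truncShiftTerm_eq (h : IsShift Λ Φ A t R₀) {c : ℝ} (hc1 : c ≤ 1) {l z : ℂ} (hl : l ∈ Λ)
    (hR : R₀ ≤ ‖l‖) (hz : 4 * (1 + ‖z‖) ≤ ‖l‖) :
    truncShiftTerm Φ R₀ c l z = shiftTerm Φ R₀ l z := by
  have h1 := h.half_le_norm hl hR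
  have h2 := norm_sub_norm_le (Φ l) z
  have h3 := norm_sub_norm_le l z
  rw [norm_sub_rev] at h2 h3
  rw [truncShiftTerm, shiftTerm, truncLog_of_le (by linarith [norm_nonneg z]),
    truncLog_of_le (by linarith [norm_nonneg z])]

/-- For `|l| ≥ 4(1 + |z|)` the truncation is inactive and the genus-one estimate applies. For closer
`l` the logarithms and the correction are estimated separately, giving decay in `|z - l|` and in
`|l|` respectively. -/
theorem exists_abs_truncShiftTerm_le (h : IsShift Λ Φ A t R₀) {c : ℝ} (hc : 0 < c) (hc1 : c ≤ 1) :
    ∃ C : ℝ, 0 ≤ C ∧ ∀ z : ℂ, R₀ ≤ ‖z‖ → ∀ l ∈ Λ, |truncShiftTerm Φ R₀ c l z|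
      ≤ C * (1 + ‖z‖) ^ (2 - 3 * (1 - t) / 4)
        * ((1 + ‖l‖) ^ (-(2 + (1 - t) / 4)) + (1 + ‖z - l‖) ^ (-(2 + (1 - t) / 4))) := by
  have hA := h.one_le_A
  have ht0 := h.t_pos
  have ht1 := h.t_lt
  obtain ⟨C, hC0, hC⟩ := exists_abs_truncLog_sub_le hc hc1 hA ht0 ht1
  set p := 2 + (1 - t) / 4 with hp
  set q := 2 - 3 * (1 - t) / 4 with hq
  refine ⟨200 * A + C, by positivity, fun z hz l hl => ?_⟩
  have hZ0 : 1 ≤ 1 + ‖z‖ := by linarith [norm_nonneg z]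
  have hL0 : 1 ≤ 1 + ‖l‖ := by linarith [norm_nonneg l]
  have hLp : 0 < (1 + ‖l‖) ^ (-p) := by positivity
  have hxp : 0 < (1 + ‖z - l‖) ^ (-p) := by positivity
  have hZq : 0 < (1 + ‖z‖) ^ q := by positivity
  rcases le_or_gt (4 * (1 + ‖z‖)) ‖l‖ with hlz | hlz
  · have hR : R₀ ≤ ‖l‖ := by linarith [norm_nonneg z]
    rw [h.truncShiftTerm_eq hc1 hl hR hlz]
    refine (h.abs_shiftTerm_le hl hR hlz).trans ?_
    have h1 : (1 + ‖l‖) ^ (t - 3) ≤ (1 + ‖z‖) ^ (q - 2) * (1 + ‖l‖) ^ (-p) := by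
      rw [show t - 3 = (q - 2) + -p by rw [hq, hp]; ring, Real.rpow_add (by positivity)]
      gcongr ?_ * _
      exact Real.rpow_le_rpow_of_nonpos (by positivity) (by linarith [norm_nonneg z])
        (by rw [hq]; linarith)
    have h2 : (1 + ‖z‖) ^ 2 * (1 + ‖z‖) ^ (q - 2) = (1 + ‖z‖) ^ q := by
      rw [Real.rpow_sub (by positivity), show (2 : ℝ) = ((2 : ℕ) : ℝ) by norm_num,
        Real.rpow_natCast]
      field_simp
    calc 64 * A * (1 + ‖z‖) ^ 2 * (1 + ‖l‖) ^ (t - 3)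
        ≤ 64 * A * (1 + ‖z‖) ^ 2 * ((1 + ‖z‖) ^ (q - 2) * (1 + ‖l‖) ^ (-p)) := by gcongr
      _ = 64 * A * (1 + ‖z‖) ^ q * (1 + ‖l‖) ^ (-p) := by rw [← h2]; ring
      _ ≤ (200 * A + C) * (1 + ‖z‖) ^ q * ((1 + ‖l‖) ^ (-p) + (1 + ‖z - l‖) ^ (-p)) := by
        gcongr
        · linarith
        · linarith
  · have hLZ : 1 + ‖l‖ ≤ 5 * (1 + ‖z‖) := by linarith
    have h1 := h.abs_shiftCorrection_le hl hLZ
    have hdist : |‖z - l‖ - ‖z - Φ l‖| ≤ 5 * A * (1 + ‖z‖) ^ t := by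
      refine (abs_norm_sub_norm_le _ _).trans ?_
      rw [sub_sub_sub_cancel_left]
      refine (h.dist_le l hl).trans ?_
      have h2 : (1 + ‖l‖) ^ t ≤ 5 * (1 + ‖z‖) ^ t := by
        calc (1 + ‖l‖) ^ t ≤ (5 * (1 + ‖z‖)) ^ t :=
              Real.rpow_le_rpow (by positivity) hLZ ht0.le
          _ = 5 ^ t * (1 + ‖z‖) ^ t := Real.mul_rpow (by norm_num) (by positivity)
          _ ≤ 5 ^ (1 : ℝ) * (1 + ‖z‖) ^ t := by
            gcongr
            norm_num
          _ = _ := by norm_num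
      nlinarith
    have h3 := hC ‖z - l‖ ‖z - Φ l‖ (1 + ‖z‖) (norm_nonneg _) hZ0 hdist
      (by linarith [norm_sub_le z l])
    rw [abs_sub_comm] at h3
    rw [truncShiftTerm]
    refine (abs_add_le _ _).trans ((add_le_add h3 h1).trans ?_)
    have h4 : 0 ≤ C * (1 + ‖z‖) ^ q * (1 + ‖l‖) ^ (-p) := by positivity
    have h5 : 0 ≤ 200 * A * (1 + ‖z‖) ^ q * (1 + ‖z - l‖) ^ (-p) := by positivity
    linarith

end IsShift

/-! ### The series of shift terms and its distributional Laplacian. -/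

theorem integrable_tsum {ι : Type*} [Countable ι] {κ : Measure ℂ} {F : ι → ℂ → ℝ}
    (hm : ∀ i, Measurable (F i)) (hF : ∀ i, Integrable (F i) κ)
    (hs : Summable fun i => ∫ z, ‖F i z‖ ∂κ) : Integrable (fun z => ∑' i, F i z) κ := by
  refine ⟨(Measurable.tsum hm).aestronglyMeasurable, ?_⟩
  rw [hasFiniteIntegral_iff_enorm]
  calc ∫⁻ z, ‖∑' i, F i z‖ₑ ∂κ ≤ ∫⁻ z, ∑' i, ‖F i z‖ₑ ∂κ :=
        lintegral_mono fun z => enorm_tsum_le_tsum_enorm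
    _ = ∑' i, ∫⁻ z, ‖F i z‖ₑ ∂κ := lintegral_tsum fun i => (hm i).enorm.aemeasurable
    _ = ∑' i, ENNReal.ofReal (∫ z, ‖F i z‖ ∂κ) := by
        simp_rw [ofReal_integral_norm_eq_lintegral_enorm (hF _)]
    _ < ⊤ := hs.tsum_ofReal_lt_top

theorem UniformlyDiscrete.countable {Λ : Set ℂ} (h : UniformlyDiscrete Λ) : Λ.Countable := by
  have h1 : Λ = ⋃ n : ℕ, Λ ∩ closedBall 0 n := by
    ext z
    simp only [mem_iUnion, mem_inter_iff, mem_closedBall_zero_iff]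
    constructor
    · intro hz
      obtain ⟨n, hn⟩ := exists_nat_ge ‖z‖
      exact ⟨n, hz, hn⟩
    · rintro ⟨n, hz, -⟩; exact hz
  rw [h1]
  exact countable_iUnion fun n => (h.finite_inter_closedBall n).countable

theorem IsSeparated.uniformlyDiscrete {Λ : Set ℂ} {c : ℝ} (hc : 0 < c) (h : IsSeparated Λ c) :
    UniformlyDiscrete Λ := ⟨2 * c, by positivity, h⟩

theorem UniformlyDiscrete.eventually_norm_ge {Λ : Set ℂ} (h : UniformlyDiscrete Λ) (R : ℝ) :
    ∀ᶠ l : Λ in Filter.cofinite, R ≤ ‖(l : ℂ)‖ := by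
  rw [Filter.eventually_cofinite]
  refine ((h.finite_inter_closedBall R).preimage Subtype.val_injective.injOn).subset fun l hl => ?_
  refine ⟨l.2, ?_⟩
  rw [mem_closedBall_zero_iff]
  exact (not_le.1 hl).le

theorem UniformlyDiscrete.exists_isSeparated {Λ : Set ℂ} (h : UniformlyDiscrete Λ) :
    ∃ c : ℝ, 0 < c ∧ c ≤ 1 ∧ IsSeparated Λ c := by
  obtain ⟨r, hr, hΛ⟩ := h
  refine ⟨min (r / 2) 1, by positivity, min_le_right _ _, fun x hx y hy hxy => ?_⟩
  have := hΛ x hx y hy hxy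
  linarith [min_le_left (r / 2) 1]

theorem UniformlyDiscrete.summable {Λ : Set ℂ} (h : UniformlyDiscrete Λ) {p : ℝ} (hp : 2 < p) :
    Summable fun l : Λ => (1 + ‖(l : ℂ)‖) ^ (-p) := by
  obtain ⟨c, hc, -, hs⟩ := h.exists_isSeparated
  obtain ⟨S, -, hS⟩ := hs.exists_tsum_le hc hp
  simpa using (hS 0).1

theorem measurable_shiftTerm (Φ : ℂ → ℂ) (R₀ : ℝ) (l : ℂ) : Measurable (shiftTerm Φ R₀ l) := by
  have h1 (w : ℂ) : Measurable fun z : ℂ => Real.log ‖z - w‖ :=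
    measurable_log_norm.comp (measurable_id.sub_const w)
  refine ((h1 _).sub (h1 _)).add ?_
  unfold shiftCorrection
  split_ifs <;> fun_prop

theorem locallyIntegrable_shiftTerm (Φ : ℂ → ℂ) (R₀ : ℝ) (l : ℂ) :
    LocallyIntegrable (shiftTerm Φ R₀ l) := by
  refine ((locallyIntegrable_log_norm_sub _).sub (locallyIntegrable_log_norm_sub _)).add ?_
  refine Continuous.locallyIntegrable ?_
  unfold shiftCorrection
  split_ifs <;> fun_prop

theorem integral_shiftTerm_mul_laplacian (Φ : ℂ → ℂ) (R₀ : ℝ) (l : ℂ) {φ : ℂ → ℝ}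
    (hφ : ContDiff ℝ ∞ φ) (hc : HasCompactSupport φ) :
    ∫ z, shiftTerm Φ R₀ l z * Laplacian.laplacian φ z = 2 * Real.pi * (φ (Φ l) - φ l) := by
  have hΔ : Continuous (Laplacian.laplacian φ) := continuous_laplacian (contDiff_infty.1 hφ 2)
  have hΔc := hasCompactSupport_laplacian hc
  have hcont : Continuous (shiftCorrection Φ R₀ l) := by
    unfold shiftCorrection
    split_ifs <;> fun_prop
  have h0 : ∫ z, shiftCorrection Φ R₀ l z * Laplacian.laplacian φ z = 0 := by
    unfold shiftCorrection
    split_ifs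
    · exact integral_affine_mul_laplacian _ _ hφ hc
    · simp
  have i1 (w : ℂ) : Integrable fun z => Real.log ‖z - w‖ * Laplacian.laplacian φ z :=
    integrable_mul_of_hasCompactSupport (locallyIntegrable_log_norm_sub w) hΔ hΔc
  have i2 : Integrable fun z => shiftCorrection Φ R₀ l z * Laplacian.laplacian φ z :=
    integrable_mul_of_hasCompactSupport hcont.locallyIntegrable hΔ hΔc
  have e : ∫ z, shiftTerm Φ R₀ l z * Laplacian.laplacian φ z
      = ∫ z, ((Real.log ‖z - Φ l‖ * Laplacian.laplacian φ z
        - Real.log ‖z - l‖ * Laplacian.laplacian φ z)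
        + shiftCorrection Φ R₀ l z * Laplacian.laplacian φ z) := by
    congr 1; ext z; rw [shiftTerm]; ring
  have e1 := integral_add ((i1 (Φ l)).sub (i1 l)) i2
  have e2 := integral_sub (i1 (Φ l)) (i1 l)
  simp only [Pi.sub_apply] at e1
  rw [e, e1, e2, h0, integral_log_norm_sub_mul_laplacian hφ hc,
    integral_log_norm_sub_mul_laplacian hφ hc]
  ring

/-- The potential of the field `2π ∑ α_l (δ_{Φ l} - δ_l)`. -/
def shiftPotential (Λ : Set ℂ) (α : ℂ → ℝ) (Φ : ℂ → ℂ) (R₀ : ℝ) (z : ℂ) : ℝ :=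
  ∑' l : Λ, α l * shiftTerm Φ R₀ l z

namespace IsShift

variable {Λ : Set ℂ} {Φ : ℂ → ℂ} {A t R₀ : ℝ}

/-- Since `‖Φ l‖ ≥ ‖l‖ / 2` for large `l`, the map is proper on `Λ`; in particular its fibres are
finite, so the moved intensities are genuine sums. -/
theorem finite_preimage (h : IsShift Λ Φ A t R₀) (hΛ : UniformlyDiscrete Λ) (R : ℝ) :
    {l : Λ | Φ l ∈ closedBall 0 R}.Finite := by
  refine ((hΛ.finite_inter_closedBall (max R₀ (2 * R))).preimage
    Subtype.val_injective.injOn).subset fun l hl => ⟨l.2, ?_⟩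
  rw [mem_closedBall_zero_iff]
  have h1 : ‖Φ l‖ ≤ R := mem_closedBall_zero_iff.1 hl
  rcases le_or_gt R₀ ‖(l : ℂ)‖ with h2 | h2
  · have := h.half_le_norm l.2 h2
    exact le_max_of_le_right (by linarith)
  · exact le_max_of_le_left h2.le

open Classical in
theorem hasSum_movedIntensity (h : IsShift Λ Φ A t R₀) (hΛ : UniformlyDiscrete Λ) (α : ℂ → ℝ)
    (l' : ℂ) :
    HasSum (fun l : Λ => if Φ l = l' then α l else 0) (movedIntensity Λ α Φ l') := by
  have hfin : Function.HasFiniteSupport fun l : Λ => if Φ l = l' then α l else 0 := by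
    refine (h.finite_preimage hΛ ‖l'‖).subset fun l hl => ?_
    have : Φ l = l' := by
      by_contra hne
      exact hl (by simp [hne])
    change Φ l ∈ closedBall 0 ‖l'‖
    rw [this, mem_closedBall_zero_iff]
  have h1 : movedIntensity Λ α Φ l' = ∑' l : Λ, if Φ l = l' then α l else 0 := by
    rw [tsum_eq_finsum hfin,
      finsum_set_coe_eq_finsum_mem (f := fun l => if Φ l = l' then α l else 0) Λ,
      movedIntensity, finsum_mem_def, finsum_mem_def]
    congr 1; ext l
    by_cases h2 : l ∈ Λ <;> by_cases h3 : Φ l = l' <;> simp [indicator, h2, h3]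
  rw [h1]
  exact (summable_of_hasFiniteSupport hfin).hasSum

theorem movedIntensity_eq_zero {α : ℂ → ℝ} {l' : ℂ} (hl' : l' ∉ Φ '' Λ) :
    movedIntensity Λ α Φ l' = 0 := by
  have : {l | l ∈ Λ ∧ Φ l = l'} = ∅ := by
    ext l
    simp only [mem_ofPred_eq, mem_empty_iff_false, iff_false]
    rintro ⟨h1, h2⟩
    exact hl' ⟨l, h1, h2⟩
  rw [movedIntensity, this, finsum_mem_empty]

/-- A finite sum rearranged along the fibres of `Φ`, which need not be injective. -/
theorem hasSum_comp (h : IsShift Λ Φ A t R₀) (hΛ : UniformlyDiscrete Λ) (α : ℂ → ℝ) {φ : ℂ → ℝ}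
    (hφ : HasCompactSupport φ) :
    HasSum (fun l : Λ => α l * φ (Φ l)) (∑ᶠ l', movedIntensity Λ α Φ l' * φ l') := by
  classical
  obtain ⟨R, hR⟩ := hφ.isBounded.subset_closedBall (0 : ℂ)
  have hmem {w : ℂ} (hw : φ w ≠ 0) : w ∈ closedBall (0 : ℂ) R := hR (subset_tsupport φ hw)
  set s : Finset Λ := (h.finite_preimage hΛ R).toFinset with hs
  have hmems {l : Λ} (hl : φ (Φ l) ≠ 0) : l ∈ s := by
    rw [hs, Finite.mem_toFinset]; exact hmem hl
  have hmoved (l' : ℂ) (hl' : φ l' ≠ 0) :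
      movedIntensity Λ α Φ l' = ∑ l ∈ s, if Φ l = l' then α l else 0 := by
    rw [← (h.hasSum_movedIntensity hΛ α l').tsum_eq]
    refine tsum_eq_sum fun l hl => if_neg fun he => hl (hmems ?_)
    rwa [he]
  have hval : ∑ᶠ l', movedIntensity Λ α Φ l' * φ l' = ∑ l ∈ s, α l * φ (Φ l) := by
    rw [finsum_eq_sum_of_support_subset (s := s.image fun l : Λ => Φ l) _ fun l' hl' => ?_]
    · have h1 (l' : ℂ) : movedIntensity Λ α Φ l' * φ l'
          = ∑ l ∈ s, if Φ l = l' then α l * φ l' else 0 := by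
        by_cases h2 : φ l' = 0
        · simp [h2]
        · rw [hmoved l' h2, Finset.sum_mul]
          simp only [ite_mul, zero_mul]
      simp_rw [h1]
      rw [Finset.sum_comm]
      refine Finset.sum_congr rfl fun l hl => ?_
      rw [Finset.sum_ite_eq, if_pos (Finset.mem_image_of_mem _ hl)]
    · have h2 : φ l' ≠ 0 := fun h0 => hl' (by simp [h0])
      have h3 : l' ∈ Φ '' Λ := by
        by_contra h0
        exact hl' (by simp [movedIntensity_eq_zero h0])
      obtain ⟨l, hl, rfl⟩ := h3
      exact Finset.mem_coe.2 (Finset.mem_image.2 ⟨⟨l, hl⟩, hmems h2, rfl⟩)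
  rw [hval]
  refine hasSum_sum_of_ne_finset_zero fun l hl => ?_
  have : φ (Φ l) = 0 := by
    by_contra h0
    exact hl (hmems h0)
  rw [this, mul_zero]

theorem _root_.AharonovBohm.UniformlyDiscrete.hasSum_mul (hΛ : UniformlyDiscrete Λ) (α : ℂ → ℝ)
    {φ : ℂ → ℝ} (hφ : HasCompactSupport φ) [DecidablePred (· ∈ Λ)] :
    HasSum (fun l : Λ => α l * φ l) (∑ᶠ l, (if l ∈ Λ then α l else 0) * φ l) := by
  obtain ⟨R, hR⟩ := hφ.isBounded.subset_closedBall (0 : ℂ)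
  have hfin : Function.HasFiniteSupport fun l : Λ => α l * φ l := by
    refine ((hΛ.finite_inter_closedBall R).preimage
      Subtype.val_injective.injOn).subset fun l hl => ⟨l.2, hR (subset_tsupport φ fun h0 => hl ?_)⟩
    simp [h0]
  have h1 : ∑ᶠ l, (if l ∈ Λ then α l else 0) * φ l = ∑' l : Λ, α l * φ l := by
    rw [tsum_eq_finsum hfin, finsum_set_coe_eq_finsum_mem (f := fun l => α l * φ l) Λ,
      finsum_mem_def]
    congr 1; ext l
    by_cases h2 : l ∈ Λ <;> simp [indicator, h2]
  rw [h1]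
  exact (summable_of_hasFiniteSupport hfin).hasSum

/-- All but finitely many `l` are far from the disc, where the terms are `O(|l|^{-(3-t)})` with `3 -
t > 2`. This justifies exchanging sum and integral. -/
theorem summable_integral_norm (h : IsShift Λ Φ A t R₀) (hΛ : UniformlyDiscrete Λ) {α : ℂ → ℝ}
    (hα : ∀ l ∈ Λ, |α l| ≤ 1) (R : ℝ) :
    Summable fun l : Λ => ∫ z in closedBall (0 : ℂ) R, ‖α l * shiftTerm Φ R₀ l z‖ := by
  have hsum := (hΛ.summable (p := 3 - t) (by linarith [h.t_lt])).mul_left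
    (64 * A * (1 + R) ^ 2 * volume.real (closedBall (0 : ℂ) R))
  refine hsum.of_norm_bounded_eventually ?_
  filter_upwards [hΛ.eventually_norm_ge R₀, hΛ.eventually_norm_ge (4 * (1 + R))] with l h1 h2
  have hA := h.one_le_A
  have hb : ∀ z ∈ closedBall (0 : ℂ) R,
      ‖‖α l * shiftTerm Φ R₀ l z‖‖ ≤ 64 * A * (1 + R) ^ 2 * (1 + ‖(l : ℂ)‖) ^ (-(3 - t)) := by
    intro z hz
    rw [mem_closedBall_zero_iff] at hz
    rw [norm_norm, norm_mul, Real.norm_eq_abs, Real.norm_eq_abs, neg_sub]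
    have h3 := h.abs_shiftTerm_le (z := z) l.2 h1 (by linarith)
    calc |α l| * |shiftTerm Φ R₀ l z| ≤ 1 * |shiftTerm Φ R₀ l z| := by
          gcongr; exact hα l l.2
      _ ≤ 64 * A * (1 + ‖z‖) ^ 2 * (1 + ‖(l : ℂ)‖) ^ (t - 3) := by rw [one_mul]; exact h3
      _ ≤ _ := by gcongr
  refine (norm_setIntegral_le_of_norm_le_const (isCompact_closedBall _ _).measure_lt_top
    hb).trans (le_of_eq (by ring))

theorem locallyIntegrable_and_integral_shiftPotential_mul_laplacian (h : IsShift Λ Φ A t R₀) (hΛ : UniformlyDiscrete Λ) {α : ℂ → ℝ}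
    (hα : ∀ l ∈ Λ, |α l| ≤ 1) [DecidablePred (· ∈ Λ)] :
    LocallyIntegrable (shiftPotential Λ α Φ R₀) ∧
      ∀ φ : ℂ → ℝ, ContDiff ℝ ∞ φ → HasCompactSupport φ →
        ∫ z, shiftPotential Λ α Φ R₀ z * Laplacian.laplacian φ z
          = 2 * Real.pi * (∑ᶠ l', movedIntensity Λ α Φ l' * φ l')
            - 2 * Real.pi * ∑ᶠ l, (if l ∈ Λ then α l else 0) * φ l := by
  have : Countable Λ := hΛ.countable.to_subtype
  have hloc (l : Λ) : LocallyIntegrable fun z => α l * shiftTerm Φ R₀ l z :=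
    (locallyIntegrable_shiftTerm Φ R₀ l).smul (α l)
  have hm (l : Λ) : Measurable fun z => α l * shiftTerm Φ R₀ l z :=
    (measurable_shiftTerm Φ R₀ l).const_mul _
  refine ⟨locallyIntegrable_of_forall_closedBall (z₀ := 0) fun R => integrable_tsum hm
    (fun l => (hloc l).integrableOn_isCompact (isCompact_closedBall 0 R))
    (h.summable_integral_norm hΛ hα R), fun φ hφ hc => ?_⟩
  have hΔ : Continuous (Laplacian.laplacian φ) := continuous_laplacian (contDiff_infty.1 hφ 2)
  have hΔc := hasCompactSupport_laplacian hc
  obtain ⟨R, hR⟩ := hΔc.isBounded.subset_closedBall (0 : ℂ)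
  obtain ⟨C, hC⟩ := hΔc.exists_bound_of_continuous hΔ
  have h0 (z : ℂ) (hz : z ∉ closedBall (0 : ℂ) R) : Laplacian.laplacian φ z = 0 :=
    image_eq_zero_of_notMem_tsupport fun h => hz (hR h)
  have hi (l : Λ) : Integrable fun z => α l * shiftTerm Φ R₀ l z * Laplacian.laplacian φ z :=
    integrable_mul_of_hasCompactSupport (hloc l) hΔ hΔc
  have hs : Summable fun l : Λ => ∫ z in closedBall (0 : ℂ) R,
      ‖α l * shiftTerm Φ R₀ l z * Laplacian.laplacian φ z‖ := by
    refine ((h.summable_integral_norm hΛ hα R).mul_right C).of_nonneg_of_le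
      (fun l => integral_nonneg fun z => norm_nonneg _) fun l => ?_
    rw [← integral_mul_const]
    refine integral_mono (hi l).integrableOn.norm
      (((hloc l).integrableOn_isCompact (isCompact_closedBall 0 R)).norm.mul_const C) fun z => ?_
    simp only [norm_mul (α l * shiftTerm Φ R₀ l z)]
    gcongr
    exact hC z
  have hsum := hasSum_integral_of_summable_integral_norm
    (fun l : Λ => (hi l).integrableOn (s := closedBall (0 : ℂ) R)) hs
  have e1 : ∫ z in closedBall (0 : ℂ) R, ∑' l : Λ, α l * shiftTerm Φ R₀ l z
      * Laplacian.laplacian φ z = ∫ z, shiftPotential Λ α Φ R₀ z * Laplacian.laplacian φ z := by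
    simp_rw [tsum_mul_right]
    exact setIntegral_eq_integral_of_forall_compl_eq_zero fun z hz => by rw [h0 z hz, mul_zero]
  have e2 (l : Λ) : ∫ z in closedBall (0 : ℂ) R, α l * shiftTerm Φ R₀ l z
      * Laplacian.laplacian φ z = 2 * Real.pi * (α l * φ (Φ l)) - 2 * Real.pi * (α l * φ l) := by
    rw [setIntegral_eq_integral_of_forall_compl_eq_zero fun z hz => by rw [h0 z hz, mul_zero]]
    simp_rw [mul_assoc]
    rw [integral_const_mul, integral_shiftTerm_mul_laplacian Φ R₀ l hφ hc]
    ring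
  rw [e1] at hsum
  simp_rw [e2] at hsum
  exact hsum.unique (((h.hasSum_comp hΛ α hc).mul_left _).sub ((hΛ.hasSum_mul α hc).mul_left _))

end IsShift

/-! ### Subquadratic growth of the perturbation potential. -/

theorem IsNearestPoint.le_norm_sub {Λ : Set ℂ} {n : ℂ → ℂ} {c : ℝ} (hn : IsNearestPoint Λ n)
    (hs : IsSeparated Λ c) {z l : ℂ} (hl : l ∈ Λ) (hne : l ≠ n z) : c ≤ ‖z - l‖ := by
  obtain ⟨h1, h2⟩ := hn ⟨l, hl⟩ z
  have h3 := hs l hl (n z) h1 hne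
  have h4 := h2 l hl
  rw [← dist_eq_norm]
  linarith [dist_triangle_left l (n z) z]

theorem IsNearestPoint.norm_sub_le {Λ : Set ℂ} {n : ℂ → ℂ} (hn : IsNearestPoint Λ n) {l : ℂ}
    (hl : l ∈ Λ) (z : ℂ) : ‖z - n z‖ ≤ ‖z‖ + ‖l‖ := by
  have h2 := (hn ⟨l, hl⟩ z).2 l hl
  rw [dist_eq_norm, dist_eq_norm] at h2
  exact h2.trans (_root_.norm_sub_le z l)

theorem abs_truncLog_le {c x : ℝ} (hc : 0 < c) (hc1 : c ≤ 1) (hx : 0 ≤ x) :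
    |truncLog c x| ≤ x + 1 + 1 / c := by
  have hv : c ≤ max x c := le_max_right _ _
  have hv0 : 0 < max x c := hc.trans_le hv
  have h1 : max x c ≤ x + 1 := max_le (by linarith) (by linarith)
  have h2 : (max x c)⁻¹ ≤ 1 / c := by rw [inv_eq_one_div]; gcongr
  exact (abs_log_le_add_inv hv0.le).trans (by linarith)

namespace IsShift

variable {Λ : Set ℂ} {Φ : ℂ → ℂ} {A t R₀ : ℝ}

/-- The exponent is raised to be positive and `A` absorbs the finitely many points without a
displacement bound. For `x ≥ (4A)^{1/(1-t)}` one has `A(1 + x)^t ≤ 2A x^t ≤ x/2`, which dictates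
`R₀`. -/
theorem exists_of_forall_norm_sub_le {a : ℝ} (hΛ : UniformlyDiscrete Λ) {s : ℝ}
    (hs : s < 1) (hΦ : ∃ R : ℝ, ∀ l ∈ Λ, R ≤ ‖l‖ → ‖Φ l - l‖ ≤ a * ‖l‖ ^ s) :
    ∃ A t R₀ : ℝ, IsShift Λ Φ A t R₀ := by
  obtain ⟨R, hR⟩ := hΦ
  set t := max s (1 / 2) with ht
  have ht1 : t < 1 := max_lt hs (by norm_num)
  have ht0 : 0 < t := lt_max_of_lt_right (by norm_num)
  obtain ⟨M, hM⟩ := ((hΛ.finite_inter_closedBall (max R 1)).image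
    fun l => ‖Φ l - l‖).bddAbove
  set A := max (max a M) 1 with hA
  have hA1 : 1 ≤ A := le_max_right _ _
  refine ⟨A, t, max 1 ((4 * A) ^ (1 - t)⁻¹), ht0, ht1, hA1, le_max_left _ _, fun l hl => ?_,
    fun x hx => ?_⟩
  · have h1 : 1 ≤ (1 + ‖l‖) ^ t := Real.one_le_rpow (by linarith [norm_nonneg l]) ht0.le
    rcases le_or_gt ‖l‖ (max R 1) with h | h
    · have h2 : ‖Φ l - l‖ ≤ M := hM ⟨l, ⟨hl, mem_closedBall_zero_iff.2 h⟩, rfl⟩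
      have h3 : M ≤ A := (le_max_right a M).trans (le_max_left _ _)
      nlinarith
    · have hl1 : 1 ≤ ‖l‖ := (le_max_right _ _).trans h.le
      calc ‖Φ l - l‖ ≤ a * ‖l‖ ^ s := hR l hl ((le_max_left _ _).trans h.le)
        _ ≤ A * (1 + ‖l‖) ^ t := by
          have h3 : a ≤ A := (le_max_left a M).trans (le_max_left _ _)
          refine mul_le_mul h3 ?_ (by positivity) (by positivity)
          calc ‖l‖ ^ s ≤ ‖l‖ ^ t := Real.rpow_le_rpow_of_exponent_le hl1 (le_max_left _ _)
            _ ≤ (1 + ‖l‖) ^ t := Real.rpow_le_rpow (by positivity) (by linarith) ht0.le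
  · have hx1 : 1 ≤ x := (le_max_left _ _).trans hx
    have hx0 : 0 < x := by linarith
    have h1 : 4 * A ≤ x ^ (1 - t) := by
      calc 4 * A = ((4 * A) ^ (1 - t)⁻¹) ^ (1 - t) := by
            rw [← Real.rpow_mul (by positivity), inv_mul_cancel₀ (by linarith), Real.rpow_one]
        _ ≤ x ^ (1 - t) :=
            Real.rpow_le_rpow (by positivity) ((le_max_right _ _).trans hx) (by linarith)
    have h2 : (1 + x) ^ t ≤ 2 * x ^ t := by
      calc (1 + x) ^ t ≤ (2 * x) ^ t := Real.rpow_le_rpow (by linarith) (by linarith) ht0.le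
        _ = 2 ^ t * x ^ t := Real.mul_rpow (by norm_num) hx0.le
        _ ≤ 2 ^ (1 : ℝ) * x ^ t := by gcongr; norm_num
        _ = _ := by norm_num
    have h3 : x ^ (1 - t) * x ^ t = x := by
      rw [← Real.rpow_add hx0, sub_add_cancel, Real.rpow_one]
    have h4 : 0 < x ^ t := by positivity
    nlinarith

/-- The growth of the potential of the perturbation, after removal of its nearest logarithmic
singularities. -/
theorem exists_abs_shiftPotential_sub_le (h : IsShift Λ Φ A t R₀) (hne : Λ.Nonempty) {c : ℝ}
    (hc : 0 < c) (hc1 : c ≤ 1) (hs : IsSeparated Λ c) (hs' : IsSeparated (Φ '' Λ) c) {α : ℂ → ℝ}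
    (hα : ∀ l ∈ Λ, |α l| ≤ 1) (hα' : ∀ l' ∈ Φ '' Λ, |movedIntensity Λ α Φ l'| ≤ 1) {n n' : ℂ → ℂ}
    (hn : IsNearestPoint Λ n) (hn' : IsNearestPoint (Φ '' Λ) n') :
    ∃ C : ℝ, ∀ z : ℂ, R₀ ≤ ‖z‖ →
      |shiftPotential Λ α Φ R₀ z - movedIntensity Λ α Φ (n' z) * Real.log ‖z - n' z‖
        + α (n z) * Real.log ‖z - n z‖| ≤ C * (1 + ‖z‖) ^ (2 - 3 * (1 - t) / 4) := by
  classical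
  have hΛ := hs.uniformlyDiscrete hc
  have ht0 := h.t_pos
  have ht1 := h.t_lt
  obtain ⟨C, hC0, hC⟩ := h.exists_abs_truncShiftTerm_le hc hc1
  set p := 2 + (1 - t) / 4 with hp
  set q := 2 - 3 * (1 - t) / 4 with hq
  obtain ⟨S, hS0, hS⟩ := hs.exists_tsum_le hc (p := p) (by rw [hp]; linarith)
  obtain ⟨l₀, hl₀⟩ := hne
  refine ⟨C * (2 * S) + ((‖Φ l₀‖ + 1 + 1 / c) + (‖l₀‖ + 1 + 1 / c)), fun z hz => ?_⟩
  have hZ0 : 1 ≤ 1 + ‖z‖ := by linarith [norm_nonneg z]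
  have hbd : Summable fun l : Λ => C * (1 + ‖z‖) ^ q
      * ((1 + ‖(l : ℂ)‖) ^ (-p) + (1 + ‖z - l‖) ^ (-p)) := by
    refine Summable.mul_left _ (Summable.add ?_ (hS z).1)
    simpa using (hS 0).1
  have hle (l : Λ) : ‖α l * truncShiftTerm Φ R₀ c l z‖ ≤ C * (1 + ‖z‖) ^ q
      * ((1 + ‖(l : ℂ)‖) ^ (-p) + (1 + ‖z - l‖) ^ (-p)) := by
    rw [norm_mul, Real.norm_eq_abs, Real.norm_eq_abs]
    calc |α l| * |truncShiftTerm Φ R₀ c l z| ≤ 1 * |truncShiftTerm Φ R₀ c l z| := by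
          gcongr; exact hα l l.2
      _ ≤ _ := by rw [one_mul]; exact hC z hz l l.2
  have h1 : Summable fun l : Λ => α l * truncShiftTerm Φ R₀ c l z := hbd.of_norm_bounded hle
  have h1b : |∑' l : Λ, α l * truncShiftTerm Φ R₀ c l z| ≤ C * (1 + ‖z‖) ^ q * (2 * S) := by
    refine (tsum_of_norm_bounded hbd.hasSum hle).trans ?_
    rw [tsum_mul_left, Summable.tsum_add (by simpa using (hS 0).1) (hS z).1]
    have h2 := (hS 0).2
    simp only [zero_sub, norm_neg] at h2
    gcongr
    linarith [(hS z).2]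
  -- The error of truncation lives on `x < c`. By separation only the nearest point of each set can
  -- be that close, so the series of errors collapses to two terms; over the fibre of `n' z` the
  -- coefficients add up to the moved intensity.
  set g : ℝ → ℝ := fun x => Real.log x - truncLog c x with hg
  have hg0 {x : ℝ} (hx : c ≤ x) : g x = 0 := by
    simp only [hg, truncLog_of_le hx, sub_self]
  have hnz := (hn ⟨l₀, hl₀⟩ z).1
  have h2 : HasSum (fun l : Λ => α l * g ‖z - l‖) (α (n z) * g ‖z - n z‖) :=
    hasSum_single (f := fun l : Λ => α l * g ‖z - l‖) ⟨n z, hnz⟩ fun l hl => by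
      rw [hg0 (hn.le_norm_sub hs l.2 fun he => hl (Subtype.ext he)), mul_zero]
  have h3 : HasSum (fun l : Λ => α l * g ‖z - Φ l‖)
      (movedIntensity Λ α Φ (n' z) * g ‖z - n' z‖) := by
    have h4 := (h.hasSum_movedIntensity hΛ α (n' z)).mul_right (g ‖z - n' z‖)
    refine h4.congr_fun fun l => ?_
    by_cases he : Φ l = n' z
    · rw [if_pos he, he]
    · rw [if_neg he, zero_mul, hg0 (hn'.le_norm_sub hs' (mem_image_of_mem Φ l.2) he), mul_zero]
  have hW : shiftPotential Λ α Φ R₀ z = (∑' l : Λ, α l * truncShiftTerm Φ R₀ c l z)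
      + movedIntensity Λ α Φ (n' z) * g ‖z - n' z‖ - α (n z) * g ‖z - n z‖ := by
    refine (((h1.hasSum.add h3).sub h2).congr_fun fun l => ?_).tsum_eq
    simp only [hg, shiftTerm, truncShiftTerm]
    ring
  have h5 : |truncLog c ‖z - n z‖| ≤ (‖l₀‖ + 1 + 1 / c) * (1 + ‖z‖) := by
    refine (abs_truncLog_le hc hc1 (norm_nonneg _)).trans ?_
    have := hn.norm_sub_le hl₀ z
    have h6 : 0 < 1 / c := by positivity
    nlinarith [norm_nonneg z, norm_nonneg l₀]
  have h6 : |truncLog c ‖z - n' z‖| ≤ (‖Φ l₀‖ + 1 + 1 / c) * (1 + ‖z‖) := by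
    refine (abs_truncLog_le hc hc1 (norm_nonneg _)).trans ?_
    have := hn'.norm_sub_le (mem_image_of_mem Φ hl₀) z
    have h6 : 0 < 1 / c := by positivity
    nlinarith [norm_nonneg z, norm_nonneg (Φ l₀)]
  have h7 := hα (n z) hnz
  have h8 := hα' (n' z) (hn' ⟨_, mem_image_of_mem Φ hl₀⟩ z).1
  have hZq : 1 + ‖z‖ ≤ (1 + ‖z‖) ^ q := by
    conv_lhs => rw [← Real.rpow_one (1 + ‖z‖)]
    exact Real.rpow_le_rpow_of_exponent_le hZ0 (by rw [hq]; linarith)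
  -- Removing the nearest logarithms leaves only their truncated versions, of at most linear growth.
  have hfinal : shiftPotential Λ α Φ R₀ z - movedIntensity Λ α Φ (n' z) * Real.log ‖z - n' z‖
      + α (n z) * Real.log ‖z - n z‖ = (∑' l : Λ, α l * truncShiftTerm Φ R₀ c l z)
      - movedIntensity Λ α Φ (n' z) * truncLog c ‖z - n' z‖
      + α (n z) * truncLog c ‖z - n z‖ := by
    rw [hW]; simp only [hg]; ring
  rw [hfinal]
  have h9 : |α (n z) * truncLog c ‖z - n z‖| ≤ (‖l₀‖ + 1 + 1 / c) * (1 + ‖z‖) ^ q := by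
    rw [abs_mul]
    calc _ ≤ 1 * ((‖l₀‖ + 1 + 1 / c) * (1 + ‖z‖)) := by gcongr
      _ ≤ _ := by rw [one_mul]; gcongr
  have h10 : |movedIntensity Λ α Φ (n' z) * truncLog c ‖z - n' z‖|
      ≤ (‖Φ l₀‖ + 1 + 1 / c) * (1 + ‖z‖) ^ q := by
    rw [abs_mul]
    calc _ ≤ 1 * ((‖Φ l₀‖ + 1 + 1 / c) * (1 + ‖z‖)) := by gcongr
      _ ≤ _ := by rw [one_mul]; gcongr
  rw [abs_le] at h1b h9 h10 ⊢
  constructor <;> linarith [h1b.1, h1b.2, h9.1, h9.2, h10.1, h10.2]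

end IsShift

/-! ### Zero modes from antiholomorphic functions. -/

/-- An antiholomorphic function satisfies `∂u = 0` weakly, outside of any set. -/
theorem isWeakHolDeriv_conj {g : ℂ → ℂ} (hg : Differentiable ℂ g) (S : Set ℂ) :
    IsWeakHolDeriv S (fun z => starRingEnd ℂ (g z)) (fun _ => 0) := by
  set u : ℂ → ℂ := fun z => starRingEnd ℂ (g z) with hu
  have hus : ContDiff ℝ 1 u :=
    Complex.conjCLE.contDiff.comp ((hg.contDiff (n := 1)).restrict_scalars ℝ)
  have huf (z v : ℂ) : fderiv ℝ u z v = starRingEnd ℂ (deriv g z * v) := by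
    have h1 : HasFDerivAt g ((ContinuousLinearMap.toSpanSingleton ℂ (deriv g z)).restrictScalars ℝ) z :=
      ((hg z).hasDerivAt.hasFDerivAt).restrictScalars ℝ
    have h2 := (Complex.conjCLE : ℂ →L[ℝ] ℂ).hasFDerivAt.comp z h1
    change fderiv ℝ ((Complex.conjCLE : ℂ →L[ℝ] ℂ) ∘ g) z v = _
    rw [h2.fderiv]
    simp [mul_comm]
  have hcont (v : ℂ) : Continuous fun z => fderiv ℝ u z v :=
    (hus.continuous_fderiv (by norm_num)).clm_apply continuous_const
  refine ⟨hus.continuous.locallyIntegrable.locallyIntegrableOn _, locallyIntegrableOn_zero,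
    fun φ hφ hc _ => ?_⟩
  have hφ1 : ContDiff ℝ 1 φ := contDiff_infty.1 hφ 1
  have hφv (v : ℂ) : Continuous fun z => fderiv ℝ φ z v :=
    (hφ1.continuous_fderiv (by norm_num)).clm_apply continuous_const
  have i1 (v : ℂ) : Integrable fun z => u z * fderiv ℝ φ z v :=
    (hus.continuous.mul (hφv v)).integrable_of_hasCompactSupport (hc.fderiv_apply (𝕜 := ℝ) v).mul_left
  have i2 (v : ℂ) : Integrable fun z => fderiv ℝ u z v * φ z :=
    ((hcont v).mul hφ.continuous).integrable_of_hasCompactSupport hc.mul_left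
  have key (v : ℂ) : ∫ z, u z * fderiv ℝ φ z v = -∫ z, fderiv ℝ u z v * φ z :=
    integral_mul_fderiv_eq_neg_fderiv_mul_of_integrable (i2 v) (i1 v)
      ((hus.continuous.mul hφ.continuous).integrable_of_hasCompactSupport hc.mul_left)
      (fun x _ => hus.differentiable (by norm_num) x)
      (fun x _ => hφ1.differentiable (by norm_num) x)
  have e1 : ∫ z, u z * holDeriv φ z
      = ((∫ z, u z * fderiv ℝ φ z 1) - Complex.I * ∫ z, u z * fderiv ℝ φ z Complex.I) / 2 := by
    rw [← integral_const_mul, ← integral_sub (i1 1) ((i1 _).const_mul _), ← integral_div]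
    congr 1; ext z
    rw [holDeriv]; ring
  have e2 : ∫ z, fderiv ℝ u z 1 * φ z = Complex.I * ∫ z, fderiv ℝ u z Complex.I * φ z := by
    rw [← integral_const_mul]
    congr 1; ext z
    rw [huf, huf]
    simp only [map_mul, map_one, Complex.conj_I]
    linear_combination ((starRingEnd ℂ) (deriv g z) * φ z) * Complex.I_mul_I
  rw [e1, key, key, e2]
  simp

theorem conj_eval_map_conj (P : Polynomial ℂ) (z : ℂ) :
    starRingEnd ℂ ((P.map (starRingEnd ℂ)).eval z) = P.eval (starRingEnd ℂ z) := by
  rw [Polynomial.eval_map, Polynomial.hom_eval₂]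
  have : (starRingEnd ℂ).comp (starRingEnd ℂ) = RingHom.id ℂ := by
    ext z; simp
  rw [this]; rfl

/-- Passing from `U` to `V = U + Re F` is a gauge change: multiplying by `conj(e^F)` keeps
antiholomorphy and turns `e^{-V}` into `e^{-U}` in modulus. Polynomials thus embed linearly into the
null space. -/
theorem not_finiteDimensional_zeroModes {ν : MagneticField} {U V : ℂ → ℝ} (hU : IsPotential ν U)
    (hV : IsPotential ν V) (S : Set ℂ)
    (hint : ∀ P : Polynomial ℂ,
      Integrable fun z => Real.exp (-2 * U z) * ‖P.eval (starRingEnd ℂ z)‖ ^ 2) :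
    ¬ FiniteDimensional ℂ (zeroModes (spinDownGraph V S)) := by
  have hUl : LocallyIntegrable U := hU.1
  have hVl : LocallyIntegrable V := hV.1
  have hw : WeaklyHarmonicOn (V - U) univ := by
    intro φ hφ hc _
    have hΔ : Continuous (Laplacian.laplacian φ) := continuous_laplacian (contDiff_infty.1 hφ 2)
    have hΔc := hasCompactSupport_laplacian hc
    simp only [Pi.sub_apply, sub_mul]
    rw [integral_sub (integrable_mul_of_hasCompactSupport hVl hΔ hΔc)
      (integrable_mul_of_hasCompactSupport hUl hΔ hΔc), hV.2 φ hφ hc, hU.2 φ hφ hc, sub_self]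
  obtain ⟨F, hF, hFe⟩ := hw.exists_re_eq (hVl.sub hUl)
  set u : Polynomial ℂ → ℂ → ℂ :=
    fun P z => starRingEnd ℂ (Complex.exp (F z)) * P.eval (starRingEnd ℂ z) with hu
  have hug (P : Polynomial ℂ) : u P = fun z => starRingEnd ℂ
      (Complex.exp (F z) * (P.map (starRingEnd ℂ)).eval z) := by
    ext z; simp only [hu, map_mul, conj_eval_map_conj]
  have hgd (P : Polynomial ℂ) : Differentiable ℂ fun z =>
      Complex.exp (F z) * (P.map (starRingEnd ℂ)).eval z :=
    hF.cexp.mul (Polynomial.differentiable _)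
  have huc (P : Polynomial ℂ) : Continuous (u P) := by
    rw [hug]; exact Complex.continuous_conj.comp (hgd P).continuous
  have hexpm : AEStronglyMeasurable (fun z => (Real.exp (-V z) : ℂ)) volume :=
    (Complex.continuous_ofReal.comp Real.continuous_exp).comp_aestronglyMeasurable
      hVl.aestronglyMeasurable.neg
  have hmem (P : Polynomial ℂ) : MemLp (fun z => (Real.exp (-V z) : ℂ) * u P z) 2 volume := by
    refine (memLp_two_iff_integrable_sq_norm (f := fun z => (Real.exp (-V z) : ℂ) * u P z)
      (hexpm.mul (huc P).aestronglyMeasurable)).2 ?_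
    refine (hint P).congr ?_
    filter_upwards [hFe] with z hz
    have h1 : V z = U z + (F z).re := by
      rw [← hz, Pi.sub_apply]; ring
    simp only [hu]
    rw [norm_mul, norm_mul, RCLike.norm_conj, Complex.norm_exp, Complex.norm_real,
      Real.norm_of_nonneg (Real.exp_pos _).le, ← mul_assoc, ← Real.exp_add, mul_pow,
      ← Real.exp_nat_mul, h1]
    congr 2
    push_cast; ring
  let T : Polynomial ℂ →ₗ[ℂ] L2 :=
    { toFun := fun P => (hmem P).toLp _
      map_add' := fun P Q => by
        rw [← MemLp.toLp_add]
        refine MemLp.toLp_congr _ _ (Filter.Eventually.of_forall fun z => ?_)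
        simp only [hu, Pi.add_apply, Polynomial.eval_add]; ring
      map_smul' := fun k P => by
        rw [RingHom.id_apply, ← MemLp.toLp_const_smul]
        refine MemLp.toLp_congr _ _ (Filter.Eventually.of_forall fun z => ?_)
        simp only [hu, Pi.smul_apply, Polynomial.eval_smul, smul_eq_mul]; ring }
  have hT (P : Polynomial ℂ) : T P =ᵐ[volume] fun z => (Real.exp (-V z) : ℂ) * u P z :=
    (hmem P).coeFn_toLp
  have hTz (P : Polynomial ℂ) : T P ∈ zeroModes (spinDownGraph V S) := by
    -- The weak derivative of `e^V ψ` is `0`, so the form pairs `ψ` to zero with its whole domain.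
    refine ⟨0, ?_, fun q _ => by simp⟩
    change IsWeakHolDeriv S _ _
    have h1 := isWeakHolDeriv_conj (hgd P) S
    rw [← hug] at h1
    refine h1.congr ?_ ?_
    · filter_upwards [hT P] with z hz
      change _ = (Real.exp (V z) : ℂ) * T P z
      rw [hz, ← mul_assoc, ← Complex.ofReal_mul, ← Real.exp_add]
      simp
    · filter_upwards [Lp.coeFn_zero ℂ 2 (volume : Measure ℂ)] with z hz
      rw [hz]; simp
  have hinj : Function.Injective T := by
    rw [injective_iff_map_eq_zero]
    intro P hP
    have h1 := hT P
    rw [hP] at h1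
    have h2 : u P =ᵐ[volume] fun _ => 0 := by
      filter_upwards [h1, Lp.coeFn_zero ℂ 2 (volume : Measure ℂ)] with z hz hz0
      rw [hz0, Pi.zero_apply] at hz
      have h3 : (Real.exp (-V z) : ℂ) ≠ 0 := by exact_mod_cast (Real.exp_pos _).ne'
      exact (mul_eq_zero.1 hz.symm).resolve_left h3
    -- Continuity upgrades a.e. vanishing to vanishing everywhere; the exponential factor has no
    -- zeros, so `P` vanishes identically.
    have h3 : u P = fun _ => 0 := (huc P).ae_eq_iff_eq volume continuous_const |>.1 h2
    refine Polynomial.funext fun w => ?_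
    have h4 := congrFun h3 (starRingEnd ℂ w)
    simp only [hu, Complex.conj_conj] at h4
    rw [Polynomial.eval_zero]
    refine (mul_eq_zero.1 h4).resolve_left ?_
    exact fun h0 => Complex.exp_ne_zero _ ((map_eq_zero _).1 h0)
  intro hfd
  have hfin : Module.Finite ℂ (Polynomial ℂ) :=
    Module.Finite.of_injective (T.codRestrict _ hTz) (by
      intro P Q hPQ
      exact hinj (congrArg Subtype.val hPQ))
  exact Polynomial.not_finite hfin

/-! ### Sums of fields and the perturbed potential. -/

namespace MagneticField

theorem hasFiniteSupport_intensity_mul (μ : MagneticField) {φ : ℂ → ℝ} (hc : HasCompactSupport φ) :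
    (Function.support fun z => μ.intensity z * φ z).Finite := by
  obtain ⟨R, hR⟩ := hc.isCompact.isBounded.subset_closedBall 0
  refine (μ.finite_solenoids R).subset fun z hz => ?_
  exact ⟨left_ne_zero_of_mul hz, hR (subset_tsupport φ (right_ne_zero_of_mul hz))⟩

theorem integral_add {φ : ℂ → ℝ} (μ ν : MagneticField) (hφ : Continuous φ)
    (hc : HasCompactSupport φ) : (μ + ν).integral φ = μ.integral φ + ν.integral φ := by
  have := μ.isLocallyFinite_contPos
  have := μ.isLocallyFinite_contNeg
  have := ν.isLocallyFinite_contPos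
  have := ν.isLocallyFinite_contNeg
  have h1 : ∫ z, φ z ∂(μ + ν).contPos = (∫ z, φ z ∂μ.contPos) + ∫ z, φ z ∂ν.contPos :=
    integral_add_measure (hφ.integrable_of_hasCompactSupport hc)
      (hφ.integrable_of_hasCompactSupport hc)
  have h2 : ∫ z, φ z ∂(μ + ν).contNeg = (∫ z, φ z ∂μ.contNeg) + ∫ z, φ z ∂ν.contNeg :=
    integral_add_measure (hφ.integrable_of_hasCompactSupport hc)
      (hφ.integrable_of_hasCompactSupport hc)
  have h3 : ∑ᶠ z, (μ + ν).intensity z * φ z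
      = (∑ᶠ z, μ.intensity z * φ z) + ∑ᶠ z, ν.intensity z * φ z := by
    rw [← finsum_add_distrib (μ.hasFiniteSupport_intensity_mul hc)
      (ν.hasFiniteSupport_intensity_mul hc)]
    exact finsum_congr fun z => add_mul _ _ _
  rw [integral, h1, h2, h3, integral, integral]
  ring

theorem integral_neg (μ : MagneticField) (φ : ℂ → ℝ) : (-μ).integral φ = -μ.integral φ := by
  have h3 : ∑ᶠ z, (-μ).intensity z * φ z = -∑ᶠ z, μ.intensity z * φ z := by
    rw [← finsum_neg_distrib]
    exact finsum_congr fun z => neg_mul _ _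
  change (∫ z, φ z ∂μ.contNeg) - (∫ z, φ z ∂μ.contPos) + 2 * Real.pi * _ = _
  rw [h3, integral]
  ring

theorem integral_sub {φ : ℂ → ℝ} (μ ν : MagneticField) (hφ : Continuous φ)
    (hc : HasCompactSupport φ) : (μ - ν).integral φ = μ.integral φ - ν.integral φ := by
  change (μ + -ν).integral φ = _
  rw [integral_add μ (-ν) hφ hc, integral_neg, sub_eq_add_neg]

theorem integral_discrete {Λ : Set ℂ} (hΛ : UniformlyDiscrete Λ) (α : ℂ → ℝ) (φ : ℂ → ℝ) :
    (discrete Λ hΛ α).integral φ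
      = 2 * Real.pi * ∑ᶠ z, (discrete Λ hΛ α).intensity z * φ z := by
  rw [integral]
  simp [discrete]

theorem intensity_discrete_of_mem {Λ : Set ℂ} (hΛ : UniformlyDiscrete Λ) (α : ℂ → ℝ) {z : ℂ}
    (hz : z ∈ Λ) : (discrete Λ hΛ α).intensity z = α z := if_pos hz

theorem intensity_discrete_of_notMem {Λ : Set ℂ} (hΛ : UniformlyDiscrete Λ) (α : ℂ → ℝ) {z : ℂ}
    (hz : z ∉ Λ) : (discrete Λ hΛ α).intensity z = 0 := if_neg hz

theorem intensity_sub_add (μ₀ μ μ' : MagneticField) (z : ℂ) :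
    (μ₀ + μ' - μ).intensity z = μ₀.intensity z + μ'.intensity z - μ.intensity z := rfl

end MagneticField

theorem exists_perturbation {Λ : Set ℂ} {α : ℂ → ℝ} {Φ : ℂ → ℂ} (hΛ : UniformlyDiscrete Λ)
    (hΛ' : UniformlyDiscrete (Φ '' Λ)) (hα : ∀ l ∈ Λ, |α l| ≤ 1)
    (hα' : ∀ l' ∈ Φ '' Λ, |movedIntensity Λ α Φ l'| ≤ 1) {a t : ℝ} (ht : t < 1)
    (hΦ : ∃ R : ℝ, ∀ l ∈ Λ, R ≤ ‖l‖ → ‖Φ l - l‖ ≤ a * ‖l‖ ^ t)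
    {n n' : ℂ → ℂ} (hn : IsNearestPoint Λ n) (hn' : IsNearestPoint (Φ '' Λ) n') :
    ∃ (W : ℂ → ℝ) (C q R : ℝ), 0 ≤ C ∧ 0 ≤ q ∧ q < 2 ∧ LocallyIntegrable W volume ∧
      (∀ φ : ℂ → ℝ, ContDiff ℝ ∞ φ → HasCompactSupport φ →
        ∫ z, W z * Laplacian.laplacian φ z
          = (MagneticField.discrete (Φ '' Λ) hΛ' (movedIntensity Λ α Φ)).integral φ
            - (MagneticField.discrete Λ hΛ α).integral φ) ∧
      ∀ z, R ≤ ‖z‖ → |W z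
        - logTerm (MagneticField.discrete (Φ '' Λ) hΛ' (movedIntensity Λ α Φ)) n' z
        + logTerm (MagneticField.discrete Λ hΛ α) n z| ≤ C * (1 + ‖z‖) ^ q := by
  classical
  -- For empty `Λ` the nearest-point maps are arbitrary, but all intensities vanish and `W = 0`
  -- works.
  rcases Λ.eq_empty_or_nonempty with rfl | hne
  · refine ⟨fun _ => 0, 0, 0, 0, le_rfl, le_rfl, two_pos, locallyIntegrable_zero,
      fun φ _ _ => ?_, fun z _ => ?_⟩
    · rw [MagneticField.integral_discrete, MagneticField.integral_discrete]
      simp [MagneticField.discrete]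
    · simp [logTerm, MagneticField.discrete]
  · obtain ⟨A, t', R₀, h⟩ := IsShift.exists_of_forall_norm_sub_le hΛ ht hΦ
    obtain ⟨c₁, hc₁, hc₁1, hs⟩ := hΛ.exists_isSeparated
    obtain ⟨c₂, hc₂, hc₂1, hs'⟩ := hΛ'.exists_isSeparated
    obtain ⟨C, hC⟩ := h.exists_abs_shiftPotential_sub_le hne (c := min c₁ c₂) (lt_min hc₁ hc₂)
      ((min_le_left _ _).trans hc₁1)
      (fun x hx y hy hxy => le_trans (by linarith [min_le_left c₁ c₂]) (hs x hx y hy hxy))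
      (fun x hx y hy hxy => le_trans (by linarith [min_le_right c₁ c₂]) (hs' x hx y hy hxy))
      hα hα' hn hn'
    obtain ⟨hW, hWφ⟩ := h.locallyIntegrable_and_integral_shiftPotential_mul_laplacian hΛ hα
    refine ⟨shiftPotential Λ α Φ R₀, max C 0, max (2 - 3 * (1 - t') / 4) 0, R₀, le_max_right _ _,
      le_max_right _ _, ?_, hW, fun φ hφ hc => ?_, fun z hz => ?_⟩
    · have := h.2
      exact max_lt (by linarith [h.t_lt]) two_pos
    · rw [hWφ φ hφ hc, MagneticField.integral_discrete, MagneticField.integral_discrete]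
      congr 2
      refine finsum_congr fun z => ?_
      by_cases hz : z ∈ Φ '' Λ
      · rw [MagneticField.intensity_discrete_of_mem hΛ' _ hz]
      · rw [MagneticField.intensity_discrete_of_notMem hΛ' _ hz,
          IsShift.movedIntensity_eq_zero hz]
    · rw [logTerm, logTerm, MagneticField.intensity_discrete_of_mem hΛ' _ (hn' (hne.image Φ) z).1,
        MagneticField.intensity_discrete_of_mem hΛ _ (hn hne z).1]
      refine (hC z hz).trans ?_
      gcongr
      · exact le_max_left _ _
      · linarith [norm_nonneg z]
      · exact le_max_left _ _

theorem isPotential_add_perturbation {μ₀ μ μ' : MagneticField} {Ψ W : ℂ → ℝ}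
    (hΨ : IsPotential μ₀ Ψ) (hW : LocallyIntegrable W volume)
    (hWφ : ∀ φ : ℂ → ℝ, ContDiff ℝ ∞ φ → HasCompactSupport φ →
        ∫ z, W z * Laplacian.laplacian φ z = μ'.integral φ - μ.integral φ) :
    IsPotential (μ₀ + μ' - μ) (fun z => Ψ z + W z) := by
  have hΨl : LocallyIntegrable Ψ := hΨ.1
  refine ⟨hΨl.add hW, fun φ hφ hc => ?_⟩
  have hΔ : Continuous (Laplacian.laplacian φ) := continuous_laplacian (contDiff_infty.1 hφ 2)
  have hΔc := hasCompactSupport_laplacian hc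
  simp only [add_mul]
  rw [integral_add (integrable_mul_of_hasCompactSupport hΨl hΔ hΔc)
    (integrable_mul_of_hasCompactSupport hW hΔ hΔc), hΨ.2 φ hφ hc, hWφ φ hφ hc,
    MagneticField.integral_sub _ _ hφ.continuous hc,
    MagneticField.integral_add _ _ hφ.continuous hc]
  ring

/-! ### From quadratic growth to square integrability. -/

/-- A power `q < 2` is eventually dominated by the square. -/
theorem exists_forall_mul_one_add_rpow_le {C q ε : ℝ} (hC : 0 ≤ C) (hq : 0 ≤ q) (hq2 : q < 2)
    (hε : 0 < ε) : ∃ R : ℝ, ∀ x : ℝ, R ≤ x → C * (1 + x) ^ q ≤ ε * x ^ 2 := by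
  obtain ⟨R, hR⟩ := Filter.eventually_atTop.1
    ((tendsto_rpow_atTop (sub_pos.2 hq2)).eventually_ge_atTop (4 * C / ε))
  refine ⟨max R 1, fun x hx => ?_⟩
  have hx1 : 1 ≤ x := (le_max_right _ _).trans hx
  have h1 := hR x ((le_max_left _ _).trans hx)
  have h2 : (1 + x) ^ q ≤ 4 * x ^ q := by
    calc (1 + x) ^ q ≤ (2 * x) ^ q := by gcongr; linarith
      _ = 2 ^ q * x ^ q := Real.mul_rpow two_pos.le (by linarith)
      _ ≤ 2 ^ (2 : ℝ) * x ^ q := by gcongr; norm_num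
      _ = 4 * x ^ q := by norm_num
  have h3 : x ^ (2 - q) * x ^ q = x ^ 2 := by
    rw [← Real.rpow_add (by linarith), sub_add_cancel, Real.rpow_two]
  rw [div_le_iff₀ hε] at h1
  calc C * (1 + x) ^ q ≤ C * (4 * x ^ q) := by gcongr
    _ = 4 * C * x ^ q := by ring
    _ ≤ x ^ (2 - q) * ε * x ^ q := by gcongr
    _ = ε * x ^ 2 := by rw [← h3]; ring

/-- Away from `D`, and near a point of `D` once its own logarithm is removed, the logarithmic
term of a field with solenoids in `D` has at most linear growth. -/
theorem exists_abs_logTerm_le {κ : MagneticField} {D Λ : Set ℂ} {c : ℝ} (hc : 0 < c) (hc1 : c ≤ 1)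
    (hD : IsSeparated D c) (hΛ : Λ ⊆ D) (hsol : κ.solenoids ⊆ Λ)
    (h1 : ∀ z, |κ.intensity z| ≤ 1) {n : ℂ → ℂ} (hn : IsNearestPoint Λ n) :
    ∃ B : ℝ, 0 ≤ B ∧
      (∀ z, ∀ p ∈ D, ‖z - p‖ < c →
        |logTerm κ n z - κ.intensity p * Real.log ‖z - p‖| ≤ B * (1 + ‖z‖)) ∧
      ∀ z, (∀ p ∈ D, c ≤ ‖z - p‖) → |logTerm κ n z| ≤ B * (1 + ‖z‖) := by
  have hzero {z : ℂ} (hz : z ∉ Λ) : κ.intensity z = 0 := by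
    by_contra h
    exact hz (hsol h)
  rcases Λ.eq_empty_or_nonempty with rfl | ⟨l₀, hl₀⟩
  · refine ⟨0, le_rfl, fun z p _ _ => ?_, fun z _ => ?_⟩ <;>
    simp [logTerm, hzero (notMem_empty _)]
  have hfar (z : ℂ) (hz : c ≤ ‖z - n z‖) :
      |logTerm κ n z| ≤ (‖l₀‖ + 2 + 1 / c) * (1 + ‖z‖) := by
    have h2 := abs_truncLog_le hc hc1 (norm_nonneg (z - n z))
    rw [truncLog_of_le hz] at h2
    have h3 := hn.norm_sub_le hl₀ z
    rw [logTerm, abs_mul]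
    calc |κ.intensity (n z)| * |Real.log ‖z - n z‖| ≤ 1 * |Real.log ‖z - n z‖| := by
          gcongr; exact h1 _
      _ ≤ ‖z‖ + ‖l₀‖ + 1 + 1 / c := by linarith
      _ ≤ (‖l₀‖ + 2 + 1 / c) * (1 + ‖z‖) := by
          have : 0 < 1 / c := by positivity
          nlinarith [norm_nonneg z, norm_nonneg l₀, mul_nonneg (norm_nonneg z) (norm_nonneg l₀),
            mul_nonneg (norm_nonneg z) this.le]
  refine ⟨‖l₀‖ + 2 + 1 / c, by positivity, fun z p hp hzp => ?_,
    fun z hz => hfar z (hz _ (hΛ (hn ⟨l₀, hl₀⟩ z).1))⟩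
  by_cases hpn : n z = p
  · rw [logTerm, hpn, sub_self, abs_zero]; positivity
  · have hfar' : c ≤ ‖z - n z‖ := by
      have h2 := hD _ (hΛ (hn ⟨l₀, hl₀⟩ z).1) p hp hpn
      rw [dist_eq_norm] at h2
      have h3 : ‖n z - p‖ ≤ ‖n z - z‖ + ‖z - p‖ := norm_sub_le_norm_sub_add_norm_sub _ _ _
      rw [norm_sub_rev (n z) z] at h3
      linarith
    -- A point `p` of `Λ` with `‖z - p‖ < c` would be nearer than `n z`; hence `p` belongs to `D`
    -- only through another set and carries no intensity of this field.
    have hp0 : κ.intensity p = 0 := by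
      refine hzero fun hpΛ => ?_
      have h2 := (hn ⟨l₀, hl₀⟩ z).2 p hpΛ
      rw [dist_eq_norm, dist_eq_norm] at h2
      linarith
    rw [hp0, zero_mul, sub_zero]
    exact hfar z hfar'

theorem exists_norm_eval_le (P : Polynomial ℂ) :
    ∃ (M : ℝ) (m : ℕ), 0 ≤ M ∧ ∀ w : ℂ, ‖P.eval w‖ ≤ M * (1 + ‖w‖) ^ m := by
  refine ⟨∑ i ∈ Finset.range (P.natDegree + 1), ‖P.coeff i‖, P.natDegree,
    Finset.sum_nonneg fun i _ => norm_nonneg _, fun w => ?_⟩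
  rw [Polynomial.eval_eq_sum_range, Finset.sum_mul]
  refine (norm_sum_le _ _).trans (Finset.sum_le_sum fun i hi => ?_)
  rw [norm_mul, norm_pow]
  have h1 : ‖w‖ ^ i ≤ (1 + ‖w‖) ^ i := by gcongr; linarith
  have h2 : (1 + ‖w‖) ^ i ≤ (1 + ‖w‖) ^ P.natDegree :=
    pow_le_pow_right₀ (by linarith [norm_nonneg w]) (Nat.lt_succ_iff.1 (Finset.mem_range.1 hi))
  gcongr
  exact h1.trans h2

/-- A Gaussian factor beats an exponential and a power. -/
theorem exists_exp_mul_pow_le {κ B : ℝ} (hκ : 0 < κ) (N : ℕ) :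
    ∃ K : ℝ, 0 ≤ K ∧ ∀ x : ℝ, 0 ≤ x →
      Real.exp (-2 * (κ * x ^ 2 - B * (1 + x))) * (1 + x) ^ N ≤ K * (1 + x) ^ (-3 : ℝ) := by
  -- The factorial comes from `y^{N+3} ≤ (N+3)! e^y` with `y = 1 + x`; the exponent is the maximum
  -- over `x` of the resulting quadratic, found by completing the square.
  refine ⟨(N + 3).factorial * Real.exp ((2 * B + 1) + (2 * B + 1) ^ 2 / (8 * κ)), by positivity,
    fun x hx => ?_⟩
  have h1 : (1 + x) ^ (N + 3) ≤ (N + 3).factorial * Real.exp (1 + x) := by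
    have := Real.pow_div_factorial_le_exp (1 + x) (by linarith) (N + 3)
    rwa [div_le_iff₀ (by positivity), mul_comm] at this
  have h2 : -2 * (κ * x ^ 2 - B * (1 + x)) + (1 + x)
      ≤ (2 * B + 1) + (2 * B + 1) ^ 2 / (8 * κ) := by
    have h3 : (2 * B + 1) ^ 2 / (8 * κ) - (2 * B + 1) * x + 2 * κ * x ^ 2
        = (2 * B + 1 - 4 * κ * x) ^ 2 / (8 * κ) := by
      field_simp; ring
    have h4 : 0 ≤ (2 * B + 1 - 4 * κ * x) ^ 2 / (8 * κ) := by positivity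
    linarith
  have hx1 : 0 < 1 + x := by linarith
  rw [Real.rpow_neg hx1.le, ← div_eq_mul_inv, le_div_iff₀ (by positivity)]
  have h5 : (1 + x) ^ (3 : ℝ) = (1 + x) ^ 3 := by exact_mod_cast Real.rpow_natCast (1 + x) 3
  rw [h5, mul_assoc, ← pow_add]
  calc _ ≤ Real.exp (-2 * (κ * x ^ 2 - B * (1 + x))) * ((N + 3).factorial * Real.exp (1 + x)) := by
        gcongr
    _ = (N + 3).factorial * Real.exp (-2 * (κ * x ^ 2 - B * (1 + x)) + (1 + x)) := by
        rw [Real.exp_add (-2 * (κ * x ^ 2 - B * (1 + x)))]; ring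
    _ ≤ _ := by gcongr

/-- A sum over a separated set of decaying multiples of a translated local singularity. -/
theorem IsSeparated.integrable_tsum_indicator {D : Set ℂ} {c : ℝ} (hc : 0 < c)
    (hD : IsSeparated D c) {s : ℝ} (hs : s < 2) :
    Integrable fun z : ℂ => ∑' p : D, (1 + ‖(p : ℂ)‖) ^ (-3 : ℝ)
      * (ball (0 : ℂ) c).indicator (fun u => ‖u‖ ^ (-s)) (z - p) := by
  have hDu := hD.uniformlyDiscrete hc
  have : Countable D := hDu.countable
  set k : ℂ → ℝ := (ball (0 : ℂ) c).indicator fun u => ‖u‖ ^ (-s) with hk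
  have hki : Integrable k := by
    rw [hk, integrable_indicator_iff isOpen_ball.measurableSet]
    exact ((locallyIntegrable_norm_rpow hs).integrableOn_isCompact
      (isCompact_closedBall 0 c)).mono_set ball_subset_closedBall
  have hi (p : D) : Integrable fun z : ℂ => (1 + ‖(p : ℂ)‖) ^ (-3 : ℝ) * k (z - p) :=
    (hki.comp_sub_right (p : ℂ)).const_mul _
  have hsum : Summable fun p : D => ∫ z, ‖(1 + ‖(p : ℂ)‖) ^ (-3 : ℝ) * k (z - p)‖ := by
    have h1 (p : D) : ∫ z, ‖(1 + ‖(p : ℂ)‖) ^ (-3 : ℝ) * k (z - p)‖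
        = (1 + ‖(p : ℂ)‖) ^ (-3 : ℝ) * ∫ z, ‖k z‖ := by
      simp only [norm_mul]
      rw [integral_const_mul, integral_sub_right_eq_self (fun z => ‖k z‖),
        Real.norm_of_nonneg (by positivity)]
    simp only [h1]
    exact (hDu.summable (by norm_num)).mul_right _
  have hkm : Measurable k :=
    (measurable_norm.pow_const (-s)).indicator isOpen_ball.measurableSet
  exact integrable_tsum
    (fun p => (hkm.comp (measurable_id.sub_const (p : ℂ))).const_mul _) hi hsum

/-- On a disc local integrability suffices. Outside, the Gaussian reduces the integrand to `(1 +
|z|)^{-3}`, times `|z - p|^{-2θ}` near a point `p` of `D`; `2θ < 2` and the cubic decay make the sum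
over `D` integrable. -/
theorem integrable_exp_mul_norm_eval_sq {D : Set ℂ} {c : ℝ} (hc : 0 < c) (hc1 : c ≤ 1)
    (hD : IsSeparated D c) {U : ℂ → ℝ}
    (hU : LocallyIntegrable fun z => Real.exp (-2 * U z)) {κ B θ R : ℝ} (hκ : 0 < κ)
    (hθ1 : θ < 1)
    (hnear : ∀ z, R ≤ ‖z‖ → z ∉ D → ∀ p ∈ D, ‖z - p‖ < c →
      κ * ‖z‖ ^ 2 - B * (1 + ‖z‖) + θ * Real.log ‖z - p‖ ≤ U z)
    (hfar : ∀ z, R ≤ ‖z‖ → z ∉ D → (∀ p ∈ D, c ≤ ‖z - p‖) →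
      κ * ‖z‖ ^ 2 - B * (1 + ‖z‖) ≤ U z) (P : Polynomial ℂ) :
    Integrable fun z => Real.exp (-2 * U z) * ‖P.eval (starRingEnd ℂ z)‖ ^ 2 := by
  have hDu := hD.uniformlyDiscrete hc
  obtain ⟨M, m, hM, hP⟩ := exists_norm_eval_le P
  obtain ⟨K, hK, hKx⟩ := exists_exp_mul_pow_le (B := B) hκ (2 * m)
  have hPc : Continuous fun z : ℂ => ‖P.eval (starRingEnd ℂ z)‖ ^ 2 :=
    ((P.continuous.comp Complex.continuous_conj).norm).pow 2
  have hPz (z : ℂ) : ‖P.eval (starRingEnd ℂ z)‖ ^ 2 ≤ M ^ 2 * (1 + ‖z‖) ^ (2 * m) := by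
    have := hP (starRingEnd ℂ z)
    rw [RCLike.norm_conj] at this
    calc _ ≤ (M * (1 + ‖z‖) ^ m) ^ 2 := by gcongr
      _ = _ := by rw [mul_pow, ← pow_mul, mul_comm m]
  have hloc : IntegrableOn (fun z => Real.exp (-2 * U z) * ‖P.eval (starRingEnd ℂ z)‖ ^ 2)
      (closedBall 0 R) :=
    (hU.integrableOn_isCompact (isCompact_closedBall 0 R)).mul_continuousOn hPc.continuousOn
      (isCompact_closedBall 0 R)
  set g : ℂ → ℝ := fun z => ∑' p : D, (1 + ‖(p : ℂ)‖) ^ (-3 : ℝ)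
      * (ball (0 : ℂ) c).indicator (fun u => ‖u‖ ^ (-(2 * θ))) (z - p) with hg
  have hgi : Integrable g := hD.integrable_tsum_indicator hc (by linarith)
  have hg0 (z : ℂ) : 0 ≤ g z := tsum_nonneg fun p => mul_nonneg (by positivity)
    (indicator_nonneg (fun u _ => by positivity) _)
  have hdom : Integrable fun z : ℂ => M ^ 2 * K * ((1 + ‖z‖) ^ (-3 : ℝ) + 8 * g z) :=
    ((integrable_one_add_norm (by rw [Complex.finrank_real_complex]; norm_num)).add
      (hgi.const_mul 8)).const_mul _
  have hout : IntegrableOn (fun z => Real.exp (-2 * U z) * ‖P.eval (starRingEnd ℂ z)‖ ^ 2)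
      (closedBall 0 R)ᶜ := by
    refine hdom.integrableOn.mono'
      (hU.aestronglyMeasurable.mul hPc.aestronglyMeasurable).restrict ?_
    filter_upwards [ae_restrict_mem isClosed_closedBall.measurableSet.compl,
      ae_restrict_of_ae (hDu.countable.ae_notMem volume)] with z hz hzD
    have hzR : R ≤ ‖z‖ := by
      simp only [mem_compl_iff, mem_closedBall_zero_iff, not_le] at hz
      exact hz.le
    have h3 : 0 ≤ (1 + ‖z‖) ^ (-3 : ℝ) := by positivity
    have hgauss : Real.exp (-2 * (κ * ‖z‖ ^ 2 - B * (1 + ‖z‖)))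
        * (M ^ 2 * (1 + ‖z‖) ^ (2 * m)) ≤ M ^ 2 * K * (1 + ‖z‖) ^ (-3 : ℝ) := by
      have := mul_le_mul_of_nonneg_left (hKx ‖z‖ (norm_nonneg z)) (sq_nonneg M)
      linarith
    rw [Real.norm_of_nonneg (by positivity)]
    by_cases hn : ∃ p ∈ D, ‖z - p‖ < c
    · obtain ⟨p, hp, hpc⟩ := hn
      have hzp : 0 < ‖z - p‖ := norm_pos_iff.2 (sub_ne_zero.2 fun h => hzD (h ▸ hp))
      -- The discs of radius `c` are disjoint, so only `p` contributes at `z`.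
      have hgz : g z = (1 + ‖p‖) ^ (-3 : ℝ) * ‖z - p‖ ^ (-(2 * θ)) := by
        rw [hg]
        simp only
        rw [tsum_eq_single (⟨p, hp⟩ : D), indicator_of_mem (by simpa using hpc)]
        intro q hq
        rw [indicator_of_notMem, mul_zero]
        rw [mem_ball_zero_iff, not_lt]
        have h4 := hD q q.2 p hp fun h => hq (Subtype.ext h)
        rw [dist_eq_norm] at h4
        have h5 : ‖(q : ℂ) - p‖ ≤ ‖(q : ℂ) - z‖ + ‖z - p‖ := norm_sub_le_norm_sub_add_norm_sub _ _ _
        rw [norm_sub_rev (q : ℂ) z] at h5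
        linarith
      have h6 : (1 + ‖z‖) ^ (-3 : ℝ) ≤ 8 * (1 + ‖p‖) ^ (-3 : ℝ) := by
        have h7 : 1 + ‖p‖ ≤ 2 * (1 + ‖z‖) := by
          have : ‖p‖ ≤ ‖z‖ + ‖z - p‖ := norm_le_norm_add_norm_sub z p
          linarith [norm_nonneg z]
        have h8 : (2 * (1 + ‖z‖)) ^ (-3 : ℝ) ≤ (1 + ‖p‖) ^ (-3 : ℝ) :=
          Real.rpow_le_rpow_of_nonpos (by positivity) h7 (by norm_num)
        rw [Real.mul_rpow two_pos.le (by positivity)] at h8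
        have h9 : (2 : ℝ) ^ (-3 : ℝ) = 1 / 8 := by
          rw [Real.rpow_neg two_pos.le]; norm_num
        rw [h9] at h8
        linarith
      have h10 : Real.exp (-2 * U z) ≤ Real.exp (-2 * (κ * ‖z‖ ^ 2 - B * (1 + ‖z‖)))
          * ‖z - p‖ ^ (-(2 * θ)) := by
        rw [Real.rpow_def_of_pos hzp, ← Real.exp_add]
        refine Real.exp_le_exp.2 ?_
        have := hnear z hzR hzD p hp hpc
        linarith
      calc _ ≤ Real.exp (-2 * (κ * ‖z‖ ^ 2 - B * (1 + ‖z‖))) * ‖z - p‖ ^ (-(2 * θ))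
            * (M ^ 2 * (1 + ‖z‖) ^ (2 * m)) := by gcongr; exact hPz z
        _ = Real.exp (-2 * (κ * ‖z‖ ^ 2 - B * (1 + ‖z‖))) * (M ^ 2 * (1 + ‖z‖) ^ (2 * m))
            * ‖z - p‖ ^ (-(2 * θ)) := by ring
        _ ≤ M ^ 2 * K * (1 + ‖z‖) ^ (-3 : ℝ) * ‖z - p‖ ^ (-(2 * θ)) := by gcongr
        _ ≤ M ^ 2 * K * (8 * (1 + ‖p‖) ^ (-3 : ℝ)) * ‖z - p‖ ^ (-(2 * θ)) := by gcongr
        _ = M ^ 2 * K * (8 * g z) := by rw [hgz]; ring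
        _ ≤ _ := by gcongr; linarith
    · push Not at hn
      have h10 : Real.exp (-2 * U z) ≤ Real.exp (-2 * (κ * ‖z‖ ^ 2 - B * (1 + ‖z‖))) := by
        refine Real.exp_le_exp.2 ?_
        have := hfar z hzR hzD hn
        linarith
      calc _ ≤ Real.exp (-2 * (κ * ‖z‖ ^ 2 - B * (1 + ‖z‖))) * (M ^ 2 * (1 + ‖z‖) ^ (2 * m)) := by
            gcongr; exact hPz z
        _ ≤ _ := hgauss
        _ ≤ _ := by gcongr; linarith [hg0 z]
  rw [← integrableOn_univ, ← union_compl_self (closedBall (0 : ℂ) R)]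
  exact hloc.union hout

/-- The zero modes of a field `μ₀ + μ' - μ` with a potential `U` of quadratic growth. -/
theorem not_finiteDimensional_zeroModes_of_growth {μ₀ μ μ' : MagneticField} {Λ₀ Λ Λ' : Set ℂ}
    (hsol₀ : μ₀.solenoids ⊆ Λ₀) (hsol : μ.solenoids ⊆ Λ) (hsol' : μ'.solenoids ⊆ Λ')
    (hunion : UniformlyDiscrete (Λ₀ ∪ Λ ∪ Λ'))
    (h₀ : ∀ z, |μ₀.intensity z| ≤ 1) (h₁ : ∀ z, |μ.intensity z| ≤ 1)
    (h₁' : ∀ z, |μ'.intensity z| ≤ 1) {n₀ n n' : ℂ → ℂ} (hn₀ : IsNearestPoint Λ₀ n₀)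
    (hn : IsNearestPoint Λ n) (hn' : IsNearestPoint Λ' n') {U V : ℂ → ℝ}
    (hU : IsPotential (μ₀ + μ' - μ) U) (hV : IsPotential (μ₀ + μ' - μ) V) {κ : ℝ} (hκ : 0 < κ)
    (hgrowth : ∃ R : ℝ, ∀ z : ℂ, R ≤ ‖z‖ → z ∉ Λ₀ ∪ Λ ∪ Λ' →
      κ * ‖z‖ ^ 2 ≤ U z - logTerm μ₀ n₀ z - logTerm μ' n' z + logTerm μ n z)
    {θ : ℝ} (hθ1 : θ < 1) (hν : ∀ z, (μ₀ + μ' - μ).intensity z ≤ θ) (S : Set ℂ) :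
    ¬ FiniteDimensional ℂ (zeroModes (spinDownGraph V S)) := by
  obtain ⟨R, hR⟩ := hgrowth
  obtain ⟨c, hc, hc1, hD⟩ := hunion.exists_isSeparated
  obtain ⟨B₀, -, hB₀, hB₀'⟩ := exists_abs_logTerm_le hc hc1 hD
    (subset_union_left.trans subset_union_left) hsol₀ h₀ hn₀
  obtain ⟨B, -, hB, hB'⟩ := exists_abs_logTerm_le hc hc1 hD
    (subset_union_right.trans subset_union_left) hsol h₁ hn
  obtain ⟨B₁, -, hB₁, hB₁'⟩ := exists_abs_logTerm_le hc hc1 hD subset_union_right hsol' h₁' hn'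
  refine not_finiteDimensional_zeroModes hU hV S (integrable_exp_mul_norm_eval_sq hc hc1 hD
    (hU.locallyIntegrable_exp fun z => (hν z).trans_lt hθ1) (B := B₀ + B + B₁) (R := R) hκ hθ1
    (fun z hz hzD p hp hpc => ?_) fun z hz hzD hfar => ?_)
  -- Near `p` the three logarithmic terms combine to the total intensity at `p` times `ln|z - p|`,
  -- even if `p` lies in several of the sets. The logarithm is nonpositive, so an upper bound `θ`
  -- for the intensity gives the required lower bound for `U`.
  · have e := hR z hz hzD
    have e₀ := (abs_le.1 (hB₀ z p hp hpc)).1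
    have e₁ := (abs_le.1 (hB z p hp hpc)).2
    have e₂ := (abs_le.1 (hB₁ z p hp hpc)).1
    have hlog : Real.log ‖z - p‖ ≤ 0 :=
      Real.log_nonpos (norm_nonneg _) (hpc.le.trans hc1)
    have e₃ := mul_le_mul_of_nonpos_right (hν p) hlog
    rw [MagneticField.intensity_sub_add] at e₃
    linarith
  · have e := hR z hz hzD
    have e₀ := (abs_le.1 (hB₀' z hfar)).1
    have e₁ := (abs_le.1 (hB' z hfar)).2
    have e₂ := (abs_le.1 (hB₁' z hfar)).1
    linarith

theorem MagneticField.solenoids_discrete_subset {Λ : Set ℂ} (hΛ : UniformlyDiscrete Λ)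
    (α : ℂ → ℝ) : (discrete Λ hΛ α).solenoids ⊆ Λ := fun z hz => by
  by_contra h
  exact hz (intensity_discrete_of_notMem hΛ α h)

theorem MagneticField.abs_intensity_discrete_le {Λ : Set ℂ} (hΛ : UniformlyDiscrete Λ)
    {α : ℂ → ℝ} (hα : ∀ l ∈ Λ, |α l| ≤ 1) (z : ℂ) : |(discrete Λ hΛ α).intensity z| ≤ 1 := by
  by_cases hz : z ∈ Λ
  · rw [intensity_discrete_of_mem hΛ α hz]
    exact hα z hz
  · rw [intensity_discrete_of_notMem hΛ α hz]
    simp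

end AharonovBohm

end

/-! ### The main theorem. -/

theorem mainTheorem10
    -- the unperturbed field and its potential
    (μ₀ : AharonovBohm.MagneticField) (Ψ₀ : ℂ → ℝ) (hΨ₀ : AharonovBohm.IsPotential μ₀ Ψ₀)
    (γ θ₀ : ℝ) (hγ : 0 < γ) (hθ₀ : θ₀ < 1)
    (n₀ : ℂ → ℂ) (hn₀ : AharonovBohm.IsNearestPoint μ₀.solenoids n₀)
    (hgrowth : ∃ R : ℝ, ∀ z : ℂ, R ≤ ‖z‖ → z ∉ μ₀.solenoids →
      γ * ‖z‖ ^ 2 ≤ Ψ₀ z - AharonovBohm.logTerm μ₀ n₀ z)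
    -- the discrete configuration and the map that moves its points
    (Λ : Set ℂ) (α : ℂ → ℝ) (Φ : ℂ → ℂ)
    (hΛ : AharonovBohm.UniformlyDiscrete Λ) (hΛ' : AharonovBohm.UniformlyDiscrete (Φ '' Λ))
    (hα : ∀ l ∈ Λ, |α l| ≤ θ₀)
    (hα' : ∀ l' ∈ Φ '' Λ, |AharonovBohm.movedIntensity Λ α Φ l'| ≤ θ₀)
    (a t : ℝ) (ha : 0 ≤ a) (ht : t < 1)
    (hΦ : ∃ R : ℝ, ∀ l ∈ Λ, R ≤ ‖l‖ → ‖Φ l - l‖ ≤ a * ‖l‖ ^ t)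
    (hunion : AharonovBohm.UniformlyDiscrete (μ₀.solenoids ∪ Λ ∪ Φ '' Λ))
    (n n' : ℂ → ℂ) (hn : AharonovBohm.IsNearestPoint Λ n)
    (hn' : AharonovBohm.IsNearestPoint (Φ '' Λ) n')
    -- `μ`, `μ'` and the resulting field
    (μ μ' ν : AharonovBohm.MagneticField)
    (hμ : μ = AharonovBohm.MagneticField.discrete Λ hΛ α)
    (hμ' : μ' = AharonovBohm.MagneticField.discrete (Φ '' Λ) hΛ'
      (AharonovBohm.movedIntensity Λ α Φ))
    (hν : ν = μ₀ + μ' - μ) :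
    (∃ U : ℂ → ℝ, AharonovBohm.IsPotential ν U ∧
      ∀ γ' : ℝ, 0 < γ' → γ' < γ →
        ∃ R : ℝ, ∀ z : ℂ, R ≤ ‖z‖ → z ∉ μ₀.solenoids ∪ Λ ∪ Φ '' Λ →
          γ' * ‖z‖ ^ 2 ≤ U z - AharonovBohm.logTerm μ₀ n₀ z
            - AharonovBohm.logTerm μ' n' z + AharonovBohm.logTerm μ n z) ∧
    ((∀ l ∈ μ₀.solenoids, 0 < μ₀.intensity l ∧ μ₀.intensity l ≤ θ₀) →
      (∀ l ∈ ν.solenoids, ν.intensity l ≤ θ₀) →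
      ∀ V : ℂ → ℝ, AharonovBohm.IsPotential ν V →
        ¬ FiniteDimensional ℂ
          (AharonovBohm.zeroModes (AharonovBohm.pauliMinusMax ν V))) ∧
    ((∀ l ∈ μ₀.solenoids, -(1 / 2) ≤ μ₀.intensity l ∧ μ₀.intensity l < 1 / 2) →
      (∀ l ∈ ν.solenoids, -(1 / 2) ≤ ν.intensity l ∧ ν.intensity l < 1 / 2) →
      ∀ V : ℂ → ℝ, AharonovBohm.IsPotential ν V →
        ¬ FiniteDimensional ℂ
          (AharonovBohm.zeroModes (AharonovBohm.pauliMinusEV V))) := by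
  subst hμ hμ' hν
  set μ := AharonovBohm.MagneticField.discrete Λ hΛ α
  set μ' := AharonovBohm.MagneticField.discrete (Φ '' Λ) hΛ'
    (AharonovBohm.movedIntensity Λ α Φ)
  have hα1 : ∀ l ∈ Λ, |α l| ≤ 1 := fun l hl => (hα l hl).trans hθ₀.le
  have hα1' : ∀ l' ∈ Φ '' Λ, |AharonovBohm.movedIntensity Λ α Φ l'| ≤ 1 :=
    fun l hl => (hα' l hl).trans hθ₀.le
  obtain ⟨W, C, q, R, hC, hq, hq2, hW, hWφ, hWR⟩ :=
    AharonovBohm.exists_perturbation hΛ hΛ' hα1 hα1' ht hΦ hn hn'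
  have hU := AharonovBohm.isPotential_add_perturbation hΨ₀ hW hWφ
  obtain ⟨R₀, hR₀⟩ := hgrowth
  have hgr : ∀ γ' : ℝ, 0 < γ' → γ' < γ →
      ∃ R : ℝ, ∀ z : ℂ, R ≤ ‖z‖ → z ∉ μ₀.solenoids ∪ Λ ∪ Φ '' Λ →
        γ' * ‖z‖ ^ 2 ≤ (Ψ₀ z + W z) - AharonovBohm.logTerm μ₀ n₀ z
          - AharonovBohm.logTerm μ' n' z + AharonovBohm.logTerm μ n z := by
    intro γ' _ hγ'
    obtain ⟨R₁, hR₁⟩ := AharonovBohm.exists_forall_mul_one_add_rpow_le hC hq hq2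
      (sub_pos.2 hγ')
    refine ⟨max R₀ (max R R₁), fun z hz hzD => ?_⟩
    have h1 := hR₀ z ((le_max_left _ _).trans hz) fun h => hzD (Or.inl (Or.inl h))
    have h2 := (abs_le.1 (hWR z ((le_max_left _ _).trans ((le_max_right _ _).trans hz)))).1
    have h3 := hR₁ ‖z‖ ((le_max_right _ _).trans ((le_max_right _ _).trans hz))
    linarith
  refine ⟨⟨_, hU, hgr⟩, fun h₀ hν V hV => ?_, fun h₀ hν V hV => ?_⟩
  · have hi (z : ℂ) : |μ₀.intensity z| ≤ 1 := by
      by_cases hz : μ₀.intensity z = 0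
      · rw [hz, abs_zero]; exact zero_le_one
      · have := h₀ z hz
        rw [abs_of_pos this.1]
        exact this.2.trans hθ₀.le
    -- The maximum with `0` covers points that are not solenoids, since `θ₀` may be negative.
    have hνθ (z : ℂ) : (μ₀ + μ' - μ).intensity z ≤ max θ₀ 0 := by
      by_cases hz : (μ₀ + μ' - μ).intensity z = 0
      · rw [hz]; exact le_max_right _ _
      · exact (hν z hz).trans (le_max_left _ _)
    exact AharonovBohm.not_finiteDimensional_zeroModes_of_growth subset_rfl
      (AharonovBohm.MagneticField.solenoids_discrete_subset hΛ α)
      (AharonovBohm.MagneticField.solenoids_discrete_subset hΛ' _) hunion hi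
      (AharonovBohm.MagneticField.abs_intensity_discrete_le hΛ hα1)
      (AharonovBohm.MagneticField.abs_intensity_discrete_le hΛ' hα1') hn₀ hn hn' hU hV
      (half_pos hγ) (hgr _ (half_pos hγ) (half_lt_self hγ))
      (max_lt hθ₀ one_pos) hνθ _
  · have hi (z : ℂ) : |μ₀.intensity z| ≤ 1 := by
      by_cases hz : μ₀.intensity z = 0
      · rw [hz, abs_zero]; exact zero_le_one
      · have := h₀ z hz
        rw [abs_le]
        constructor <;> linarith
    have hνθ (z : ℂ) : (μ₀ + μ' - μ).intensity z ≤ 1 / 2 := by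
      by_cases hz : (μ₀ + μ' - μ).intensity z = 0
      · rw [hz]; norm_num
      · exact (hν z hz).2.le
    exact AharonovBohm.not_finiteDimensional_zeroModes_of_growth subset_rfl
      (AharonovBohm.MagneticField.solenoids_discrete_subset hΛ α)
      (AharonovBohm.MagneticField.solenoids_discrete_subset hΛ' _) hunion hi
      (AharonovBohm.MagneticField.abs_intensity_discrete_le hΛ hα1)
      (AharonovBohm.MagneticField.abs_intensity_discrete_le hΛ' hα1') hn₀ hn hn' hU hV
      (half_pos hγ) (hgr _ (half_pos hγ) (half_lt_self hγ)) (by norm_num) hνθ _
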